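/- Let $S\subset\mathbb R^3$ be an embedded surface without boundary, let $\kappa_1,\kappa_2$ be its principal curvatures, and put $\Delta=(\kappa_1-\kappa_2)^2$, $K=\kappa_1\kappa_2$. The renormalized $r^{-4}$-potential of $S$ at $x\in S$ and the Auckly–Sadun energy of $S$ are \[ V(x;S)=\lim_{\varepsilon\to0^+}\left(\int_{S\setminus B_\varepsilon(x)}\frac{d^2y}{|x-y|^4}-\frac{\pi}{\varepsilon^2}+\frac{\pi\Delta(x)}{16}\log\bigl(\Delta(x)\varepsilon^2\bigr)+\frac{\pi K(x)}{4}\right),\qquad E(S)=\int_S V(x;S)\,d^2x, \] where $d^2x,d^2y$ denote the area element of $S$ and $B_\varepsilon(x)$ is the ball of radius $\varepsilon$ about $x$; the logarithmic term is read as $0$ where $\Delta(x)=0$. Let $\Sigma\subset\mathbb R^3$ be the image of the Clifford torus $\{(z_1,z_2)\in\mathbb C^2: |z_1|=|z_2|=1/\sqrt2\}$ under the stereographic projection $(z_1,z_2)\mapsto \frac{1}{1-\operatorname{Im}z_2}(\operatorname{Re}z_1,\operatorname{Im}z_1,\operatorname{Re}z_2)$ of the unit sphere $S^3\subset\mathbb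 C^2$. Then $\Sigma$ is the torus of revolution whose axis is the third coordinate axis and whose generating circle has radius $1$ and center at the point at distance $\sqrt2$ from the axis, in the plane through the origin orthogonal to the axis. Moreover: 1. $E(\Sigma)=\dfrac{\pi^3(6\log 2-1)}{2}$. 2. Let $T\subset\mathbb R^3$ be any torus of revolution (with arbitrary axis) whose generating circle has radius $r>0$ and center at distance $R>r$ from the axis. Then $E(T)$ is well defined and \[ E(T)\ \ge\ \frac{\pi^3(6\log 2-1)}{2}, \] with equality if and only if $R=\sqrt2\,r$. -/

import Mathlib

open MeasureTheory Filter Topology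

/-- Euclidean three-space. -/
abbrev E3 : Type := EuclideanSpace ℝ (Fin 3)

/-- `g` is a `C²` local defining function at the point `x` of the set `S`:
near `x` the set `S` is the zero set of `g`, and the differential of `g` at `x` is not zero. -/
structure IsLocalDefiningFunction (S : Set E3) (x : E3) (g : E3 → ℝ) : Prop where
  contDiffAt : ContDiffAt ℝ 2 g x
  fderiv_ne_zero : fderiv ℝ g x ≠ 0
  mem_iff : ∀ᶠ y in 𝓝 x, (y ∈ S ↔ g y = 0)

/-- `κ₁` and `κ₂` are the principal curvatures at `x ∈ S` of the embedded surface `S`, with respect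
to the unit normal `∇g / ‖∇g‖` given by some local defining function `g`. The tangent plane is the
kernel of `Dg`, the second fundamental form on it is (up to the choice of a global sign)
`D²g / ‖∇g‖`, and the principal curvatures are its diagonal entries in an orthonormal basis
`e₁, e₂` of the tangent plane that diagonalizes it. The pair `(κ₁, κ₂)` is
determined up to its order and a common change of sign (the choice of the unit normal). -/
def HasPrincipalCurvatures (S : Set E3) (x : E3) (κ₁ κ₂ : ℝ) : Prop :=
  x ∈ S ∧ ∃ g : E3 → ℝ, IsLocalDefiningFunction S x g ∧
    ∃ e₁ e₂ : E3, ‖e₁‖ = 1 ∧ ‖e₂‖ = 1 ∧ inner ℝ e₁ e₂ = 0 ∧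
      fderiv ℝ g x e₁ = 0 ∧ fderiv ℝ g x e₂ = 0 ∧
      fderiv ℝ (fderiv ℝ g) x e₁ e₁ = κ₁ * ‖fderiv ℝ g x‖ ∧
      fderiv ℝ (fderiv ℝ g) x e₂ e₂ = κ₂ * ‖fderiv ℝ g x‖ ∧
      fderiv ℝ (fderiv ℝ g) x e₁ e₂ = 0

/-- `v` is the renormalized `r⁻⁴`-potential `V(x; S)` of the embedded surface `S` at `x ∈ S`.
Here `μHE[2]` is the area measure (two-dimensional Hausdorff measure, normalized to agree
with Lebesgue measure in the plane), `(κ₁ - κ₂) ^ 2` is `Δ(x)`, and `κ₁ * κ₂` is the Gauss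
curvature `K(x)`. At an umbilic point, where `κ₁ = κ₂`, the logarithmic term is zero. -/
def HasRenormalizedPotential (S : Set E3) (x : E3) (v : ℝ) : Prop :=
  ∃ κ₁ κ₂ : ℝ, HasPrincipalCurvatures S x κ₁ κ₂ ∧
    (∀ ε : ℝ, 0 < ε →
      IntegrableOn (fun y : E3 => 1 / dist x y ^ 4) (S \ Metric.ball x ε) μHE[2]) ∧
    Tendsto (fun ε : ℝ =>
        (∫ y in S \ Metric.ball x ε, 1 / dist x y ^ 4 ∂μHE[2]) - Real.pi / ε ^ 2
          + Real.pi * (κ₁ - κ₂) ^ 2 / 16 * Real.log ((κ₁ - κ₂) ^ 2 * ε ^ 2)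
          + Real.pi * (κ₁ * κ₂) / 4)
      (𝓝[>] 0) (𝓝 v)

/-- `E` is the Auckly–Sadun renormalized `r⁻⁴`-potential energy of the embedded surface `S`: the
potential exists at every point of `S`, it is integrable over `S`, and its integral with respect
to area is `E`. -/
def HasAucklySadunEnergy (S : Set E3) (E : ℝ) : Prop :=
  ∃ V : E3 → ℝ, (∀ x ∈ S, HasRenormalizedPotential S x (V x)) ∧
    IntegrableOn V S μHE[2] ∧ ∫ x in S, V x ∂μHE[2] = E

/-- The torus of revolution with center `c`, axis through `c` in the direction of the unit vector
`n`, and generating circle of radius `r` whose center is at distance `R` from the axis. For each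
unit vector `w` orthogonal to `n` the points below with that `w` form one position of the
rotated generating circle. -/
def torusOfRevolution (c n : E3) (R r : ℝ) : Set E3 :=
  {x | ∃ w : E3, ‖w‖ = 1 ∧ inner ℝ n w = 0 ∧
    ∃ u : ℝ, x = c + (R + r * Real.cos u) • w + (r * Real.sin u) • n}

/-- The Clifford torus in the unit sphere of `ℂ × ℂ`. -/
def cliffordTorus : Set (ℂ × ℂ) :=
  {z | ‖z.1‖ = 1 / √2 ∧ ‖z.2‖ = 1 / √2}

/-- Stereographic projection of the unit sphere of `ℂ × ℂ = ℝ⁴` from the pole `(0, i) = (0,0,0,1)`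
onto the equatorial hyperplane `ℝ³`. -/
noncomputable def stereographicProjection (z : ℂ × ℂ) : E3 :=
  (1 / (1 - z.2.im)) • !₂[z.1.re, z.1.im, z.2.re]

/-!
The area form of a torus of revolution and the chord length are made explicit in one chart, the
truncated potential becomes a plane integral with an elementary asymptotic expansion, and the
energy becomes an elementary function of `R / r`.

*Area.* Let `y` be the cotangent of half the angle along the generating circle, measured from the
base point, and `ζ` the tangent of half the angle of rotation. In these coordinates the squared
distance of two points of the torus is
`a p * a q * (p.1 - q.1) ^ 2 + b p * b q * (p.2 - q.2) ^ 2` with `a = 2 * r / (1 + y ^ 2)` and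
`b = 2 * ρ(y) / (1 + ζ ^ 2)` (`dist_sq_torusChart`). The chart is therefore locally almost isometric
to a diagonal linear map, and `μHE[2]` on the torus has density `a * b`
(`map_withDensity_eq_restrict_range`, `restrict_torusOfRevolution_eq`).

*Potential.* The base point, with `cos` and `sin` of its angle equal to `c₀` and `s₀`, lies at
distance `ρ = R + r * c₀` from the axis. An affine change of `y` to `z` and a substitution
of `ζ` by `η` turn the integral of `1 / |x - y| ^ 4` outside of a ball of radius `ε` into
`1 / (4 * r ^ 2 * ρ ^ 2)` times the integral of `chordDensity` over
`(z + σ) ^ 2 + ρ ^ 2 ≤ N * (1 + η ^ 2)`, where `σ = r * s₀` and `N = 4 * r ^ 2 * ρ ^ 2 / ε ^ 2`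
(`lintegral_torusOfRevolution_diff_ball`). The strip `(z + σ) ^ 2 + ρ ^ 2 ≤ N` is integrated exactly
over lines `z = const`. On the rest, which moves off to infinity, `chordDensity` may be replaced by
the simpler `chordModel`, because the difference is integrable over the whole plane
(`integrable_chordDensity_sub_chordModel`), and the model is integrated over lines `η = const`.
The sum is `π * N + (π / 4) * R ^ 2 * log N + const + o(1)` (`tendsto_integral_chordDensity`).

*Curvature.* Differentiating `Dg(∂Φ) = 0` along the parametrization `Φ` of the torus shows that
every local defining function `g` has, in the frame of the generating circle and the circle of
latitude, a diagonal second fundamental form with entries `1 / r` and `c₀ / ρ` up to a common sign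
(`fderiv_defining_torusOfRevolution`). These never agree, so `(κ₁ - κ₂) ^ 2 = (R / (r * ρ)) ^ 2` and
`κ₁ * κ₂ = c₀ / (r * ρ)` whatever choices are made. Existence of a defining function is witnessed by
the quartic equation of the torus. With these values the divergent terms cancel, and the potential
is `torusPotentialConstant R r / ρ ^ 2`.

*Energy.* The integral of `1 / ρ ^ 2` over the torus is `4 * π ^ 2 * r / √(R ^ 2 - r ^ 2)`. With
`k = 3 * log 2 - 1`, `X = (R / r) ^ 2` and `t = X / √(X - 1)` the energy is
`(π ^ 3 / 2) * (k * t + 2 / t)`. Since `t ≥ 2`, with equality only for `X = 2`, and since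
`k * t + 2 / t - (2 * k + 1) = (t - 2) * (k - 1 / t)` with `k > 1 / 2`, the minimum is attained
exactly at `R = √2 * r` (`le_torusEnergy`).
-/

/-! ### Hausdorff measure of parametrized surfaces -/

open scoped ENNReal NNReal in
/-- Comparison of the Hausdorff measures of the images of one set under two maps `f` and `g`: the
map `f` factors through `g` by a Lipschitz map. -/
theorem euclideanHausdorffMeasure_image_le_of_dist_le {ι X Y : Type*}
    [MetricSpace X] [MeasurableSpace X] [BorelSpace X]
    [MetricSpace Y] [MeasurableSpace Y] [BorelSpace Y] {f : ι → X} {g : ι → Y} {K : ℝ≥0}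
    {s : Set ι} (h : ∀ p ∈ s, ∀ q ∈ s, dist (f p) (f q) ≤ K * dist (g p) (g q)) (d : ℕ) :
    μHE[d] (f '' s) ≤ (K : ℝ≥0∞) ^ d * μHE[d] (g '' s) := by
  rcases s.eq_empty_or_nonempty with rfl | ⟨p₀, hp₀⟩
  · simp
  have : Nonempty ι := ⟨p₀⟩
  set k : Y → X := fun y => f (Function.invFunOn g s y) with hk
  have hinv : ∀ y ∈ g '' s, Function.invFunOn g s y ∈ s ∧ g (Function.invFunOn g s y) = y :=
    fun y hy => ⟨Function.invFunOn_mem hy, Function.invFunOn_eq hy⟩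
  have hlip : LipschitzOnWith K k (g '' s) := by
    refine LipschitzOnWith.of_dist_le_mul fun x hx y hy => ?_
    have := h _ (hinv x hx).1 _ (hinv y hy).1
    rwa [(hinv x hx).2, (hinv y hy).2] at this
  have himg : f '' s ⊆ k '' (g '' s) := by
    rintro _ ⟨p, hp, rfl⟩
    refine ⟨g p, ⟨p, hp, rfl⟩, ?_⟩
    have h1 := hinv (g p) ⟨p, hp, rfl⟩
    have h2 := h _ h1.1 p hp
    rw [h1.2, dist_self, mul_zero] at h2
    exact dist_le_zero.1 h2
  have key := hlip.hausdorffMeasure_image_le (d := d) (Nat.cast_nonneg d)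
  rw [Measure.euclideanHausdorffMeasure_def, Measure.euclideanHausdorffMeasure_def,
    Measure.smul_apply, Measure.smul_apply, ENNReal.smul_def, ENNReal.smul_def, smul_eq_mul,
    smul_eq_mul, mul_left_comm]
  gcongr
  refine (measure_mono himg).trans (key.trans_eq ?_)
  rw [ENNReal.rpow_natCast]

/-- The area of the image of a plane set under a diagonal linear map. -/
theorem euclideanHausdorffMeasure_image_diagonal {a b : ℝ} (ha : 0 < a) (hb : 0 < b)
    (s : Set (ℝ × ℝ)) :
    μHE[2] ((fun p : ℝ × ℝ => (!₂[a * p.1, b * p.2] : EuclideanSpace ℝ (Fin 2))) '' s)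
      = ENNReal.ofReal (a * b) * volume s := by
  let L : ℝ × ℝ →ₗ[ℝ] ℝ × ℝ := LinearMap.prodMap (a • LinearMap.id) (b • LinearMap.id)
  let e : ℝ × ℝ ≃ᵐ EuclideanSpace ℝ (Fin 2) :=
    MeasurableEquiv.finTwoArrow.symm.trans (MeasurableEquiv.toLp 2 (Fin 2 → ℝ))
  have he : MeasurePreserving e volume volume :=
    (PiLp.volume_preserving_toLp (Fin 2)).comp (volume_preserving_finTwoArrow ℝ).symm
  have himg : (fun p : ℝ × ℝ => (!₂[a * p.1, b * p.2] : EuclideanSpace ℝ (Fin 2))) '' s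
      = e '' (L '' s) := by
    rw [Set.image_image]
    rfl
  have hdet : LinearMap.det L = a * b := by
    simp [L, LinearMap.det_prodMap]
  rw [himg, EuclideanSpace.euclideanHausdorffMeasure_eq_volume, ← he.measure_preimage_equiv,
    Set.preimage_image_eq _ e.injective, Measure.addHaar_image_linearMap, hdet,
    abs_of_pos (mul_pos ha hb)]

/-- A local comparison of two measures is a global one, by a countable measurable partition. -/
theorem measure_le_of_forall_restrict_le {α : Type*} [TopologicalSpace α]
    [SecondCountableTopology α] [MeasurableSpace α] [OpensMeasurableSpace α] {μ ν : Measure α}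
    {C : ENNReal}
    (h : ∀ x : α, ∃ U : Set α, IsOpen U ∧ x ∈ U ∧
      ∀ s, MeasurableSet s → s ⊆ U → μ s ≤ C * ν s) {s : Set α} (hs : MeasurableSet s) :
    μ s ≤ C * ν s := by
  choose U hUo hxU hU using h
  rcases s.eq_empty_or_nonempty with rfl | ⟨p₀, hp₀⟩
  · simp
  obtain ⟨t, htc, htU⟩ :=
    TopologicalSpace.countable_cover_nhds fun x => (hUo x).mem_nhds (hxU x)
  have htne : t.Nonempty := by
    by_contra hne
    rw [Set.not_nonempty_iff_eq_empty.1 hne] at htU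
    simp only [Set.mem_empty_iff_false, Set.iUnion_of_empty, Set.iUnion_empty] at htU
    exact (Set.mem_univ p₀ |> htU.symm.subset).elim
  obtain ⟨x, rfl⟩ := htc.exists_eq_range htne
  set D : ℕ → Set α := disjointed fun n => U (x n) with hD
  have hDm : ∀ n, MeasurableSet (D n) :=
    fun n => MeasurableSet.disjointed (fun n => (hUo (x n)).measurableSet) n
  have hDU : ⋃ n, D n = Set.univ := by
    rw [hD, iUnion_disjointed, ← htU]
    simp
  have hsum : ∀ κ : Measure α, κ s = ∑' n, κ (s ∩ D n) := fun κ => by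
    rw [← measure_iUnion, ← Set.inter_iUnion, hDU, Set.inter_univ]
    · exact fun i j hij => ((disjoint_disjointed _ hij).mono Set.inter_subset_right
        Set.inter_subset_right)
    · exact fun n => hs.inter (hDm n)
  rw [hsum μ, hsum ν, ← ENNReal.tsum_mul_left]
  exact ENNReal.tsum_le_tsum fun n => hU (x n) _ (hs.inter (hDm n))
    (Set.inter_subset_right.trans (disjointed_subset _ _))

open scoped ENNReal NNReal in
theorem ENNReal.le_of_forall_one_lt_pow_mul_le {x y : ℝ≥0∞} {k : ℕ}
    (h : ∀ K : ℝ≥0, 1 < K → x ≤ (K : ℝ≥0∞) ^ k * y) : x ≤ y := by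
  have h1 : Tendsto (fun K : ℝ≥0 => (K : ℝ≥0∞) ^ k * y) (𝓝[>] 1) (𝓝 (1 * y)) := by
    refine ENNReal.Tendsto.mul_const ?_ (Or.inl one_ne_zero)
    have : Continuous fun K : ℝ≥0 => (K : ℝ≥0∞) ^ k := by fun_prop
    simpa using (this.tendsto 1).mono_left nhdsWithin_le_nhds
  rw [one_mul] at h1
  exact ge_of_tendsto h1 (eventually_nhdsWithin_of_forall fun K hK => h K hK)

theorem dist_diagonal_sq (a b : ℝ) (p q : ℝ × ℝ) :
    dist (!₂[a * p.1, b * p.2] : EuclideanSpace ℝ (Fin 2)) !₂[a * q.1, b * q.2] ^ 2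
      = a ^ 2 * (p.1 - q.1) ^ 2 + b ^ 2 * (p.2 - q.2) ^ 2 := by
  rw [EuclideanSpace.dist_sq_eq]
  simp [Real.dist_eq, sq_abs, Fin.sum_univ_two]
  ring

/-- Area formula for a chart in which the squared chord length is a diagonal quadratic form in the
coordinate differences. Such a chart is locally bi-Lipschitz to a diagonal linear map, with a
constant as close to `1` as desired, which pins the area down. -/
theorem map_withDensity_eq_restrict_range {X : Type*} [MetricSpace X] [SecondCountableTopology X]
    [MeasurableSpace X] [BorelSpace X] {Ψ : ℝ × ℝ → X} {a b : ℝ × ℝ → ℝ}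
    (ha : Continuous a) (hb : Continuous b) (ha0 : ∀ p, 0 < a p) (hb0 : ∀ p, 0 < b p)
    (hdist : ∀ p q, dist (Ψ p) (Ψ q) ^ 2
      = a p * a q * (p.1 - q.1) ^ 2 + b p * b q * (p.2 - q.2) ^ 2) :
    MeasurableEmbedding Ψ ∧
    Measure.map Ψ (volume.withDensity fun p => ENNReal.ofReal (a p * b p))
      = μHE[2].restrict (Set.range Ψ) := by
  have hinj : Function.Injective Ψ := by
    intro p q hpq
    have h := hdist p q
    rw [hpq, dist_self] at h
    have h1 : 0 ≤ a p * a q * (p.1 - q.1) ^ 2 :=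
      mul_nonneg (mul_pos (ha0 p) (ha0 q)).le (sq_nonneg _)
    have h2 : 0 ≤ b p * b q * (p.2 - q.2) ^ 2 :=
      mul_nonneg (mul_pos (hb0 p) (hb0 q)).le (sq_nonneg _)
    have h3 : a p * a q * (p.1 - q.1) ^ 2 = 0 := by linarith
    have h4 : b p * b q * (p.2 - q.2) ^ 2 = 0 := by linarith
    have := ha0 p; have := ha0 q; have := hb0 p; have := hb0 q
    ext
    · have : (p.1 - q.1) ^ 2 = 0 := by
        rcases mul_eq_zero.1 h3 with h | h
        · exact absurd h (by positivity)
        · exact h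
      linarith [pow_eq_zero_iff (two_ne_zero) |>.1 this]
    · have : (p.2 - q.2) ^ 2 = 0 := by
        rcases mul_eq_zero.1 h4 with h | h
        · exact absurd h (by positivity)
        · exact h
      linarith [pow_eq_zero_iff (two_ne_zero) |>.1 this]
  have hcont : Continuous Ψ := by
    rw [continuous_iff_continuousAt]
    intro p
    rw [ContinuousAt, tendsto_iff_dist_tendsto_zero]
    have h1 : Tendsto (fun q => a q * a p * (q.1 - p.1) ^ 2 + b q * b p * (q.2 - p.2) ^ 2)
        (𝓝 p) (𝓝 0) := by
      have : Continuous
          fun q : ℝ × ℝ => a q * a p * (q.1 - p.1) ^ 2 + b q * b p * (q.2 - p.2) ^ 2 := by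
        fun_prop
      simpa using this.tendsto p
    have h2 := h1.sqrt
    rw [Real.sqrt_zero] at h2
    refine h2.congr fun q => ?_
    rw [← hdist, Real.sqrt_sq dist_nonneg]
  have hemb : MeasurableEmbedding Ψ := hcont.measurableEmbedding hinj
  refine ⟨hemb, ?_⟩
  -- Near each point the coefficients change by a factor of at most `K`.
  have hloc : ∀ (K : NNReal), 1 < K → ∀ p₀ : ℝ × ℝ, ∃ U : Set (ℝ × ℝ), IsOpen U ∧ p₀ ∈ U ∧
      ∀ p ∈ U, (a p ≤ K * a p₀ ∧ a p₀ ≤ K * a p) ∧ (b p ≤ K * b p₀ ∧ b p₀ ≤ K * b p) := by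
    intro K hK p₀
    have hK' : (1 : ℝ) < K := by exact_mod_cast hK
    refine ⟨{p | (a p < K * a p₀ ∧ a p₀ < K * a p) ∧ (b p < K * b p₀ ∧ b p₀ < K * b p)},
      ?_, ?_, fun p hp => ⟨⟨hp.1.1.le, hp.1.2.le⟩, ⟨hp.2.1.le, hp.2.2.le⟩⟩⟩
    · have o1 : IsOpen {p | a p < K * a p₀} := isOpen_lt (by fun_prop) (by fun_prop)
      have o2 : IsOpen {p | a p₀ < K * a p} := isOpen_lt (by fun_prop) (by fun_prop)
      have o3 : IsOpen {p | b p < K * b p₀} := isOpen_lt (by fun_prop) (by fun_prop)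
      have o4 : IsOpen {p | b p₀ < K * b p} := isOpen_lt (by fun_prop) (by fun_prop)
      exact (o1.inter o2).inter (o3.inter o4)
    · have := ha0 p₀
      have := hb0 p₀
      refine ⟨⟨?_, ?_⟩, ?_, ?_⟩ <;> nlinarith
  have hcomp : ∀ (K : NNReal), 1 < K → ∀ s, MeasurableSet s →
      (μHE[2].comap Ψ s ≤ (K : ENNReal) ^ 4 *
        (volume.withDensity fun p => ENNReal.ofReal (a p * b p)) s ∧
      (volume.withDensity fun p => ENNReal.ofReal (a p * b p)) s ≤
        (K : ENNReal) ^ 4 * μHE[2].comap Ψ s) := by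
    intro K hK
    have hK0 : (0 : ℝ) ≤ K := K.2
    have hboth : ∀ p₀ : ℝ × ℝ, ∃ U : Set (ℝ × ℝ), IsOpen U ∧ p₀ ∈ U ∧ ∀ s, MeasurableSet s →
        s ⊆ U → (μHE[2].comap Ψ s ≤ (K : ENNReal) ^ 4 *
          (volume.withDensity fun p => ENNReal.ofReal (a p * b p)) s ∧
        (volume.withDensity fun p => ENNReal.ofReal (a p * b p)) s ≤
          (K : ENNReal) ^ 4 * μHE[2].comap Ψ s) := by
      intro p₀
      obtain ⟨U, hUo, hpU, hU⟩ := hloc K hK p₀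
      refine ⟨U, hUo, hpU, fun s hs hsU => ?_⟩
      have hK2 : ENNReal.ofReal ((K : ℝ) ^ 2) = (K : ENNReal) ^ 2 := by
        rw [ENNReal.ofReal_pow hK0, ENNReal.ofReal_coe_nnreal]
      have hd1 : ∀ p ∈ s, ∀ q ∈ s, dist (Ψ p) (Ψ q) ≤ K *
          dist (!₂[a p₀ * p.1, b p₀ * p.2] : EuclideanSpace ℝ (Fin 2))
            !₂[a p₀ * q.1, b p₀ * q.2] := by
        intro p hp q hq
        refine abs_le_of_sq_le_sq' ?_ (mul_nonneg hK0 dist_nonneg) |>.2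
        rw [mul_pow, dist_diagonal_sq, hdist]
        obtain ⟨⟨h1, -⟩, h2, -⟩ := hU p (hsU hp)
        obtain ⟨⟨h3, -⟩, h4, -⟩ := hU q (hsU hq)
        have e1 := mul_le_mul h1 h3 (ha0 q).le (mul_nonneg hK0 (ha0 p₀).le)
        have e2 := mul_le_mul h2 h4 (hb0 q).le (mul_nonneg hK0 (hb0 p₀).le)
        have e3 := mul_le_mul_of_nonneg_right e1 (sq_nonneg (p.1 - q.1))
        have e4 := mul_le_mul_of_nonneg_right e2 (sq_nonneg (p.2 - q.2))
        linarith
      have hd2 : ∀ p ∈ s, ∀ q ∈ s,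
          dist (!₂[a p₀ * p.1, b p₀ * p.2] : EuclideanSpace ℝ (Fin 2))
            !₂[a p₀ * q.1, b p₀ * q.2] ≤ K * dist (Ψ p) (Ψ q) := by
        intro p hp q hq
        refine abs_le_of_sq_le_sq' ?_ (mul_nonneg hK0 dist_nonneg) |>.2
        rw [mul_pow, dist_diagonal_sq, hdist]
        obtain ⟨⟨-, h1⟩, -, h2⟩ := hU p (hsU hp)
        obtain ⟨⟨-, h3⟩, -, h4⟩ := hU q (hsU hq)
        have e1 := mul_le_mul h1 h3 (ha0 p₀).le (mul_nonneg hK0 (ha0 p).le)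
        have e2 := mul_le_mul h2 h4 (hb0 p₀).le (mul_nonneg hK0 (hb0 p).le)
        have e3 := mul_le_mul_of_nonneg_right e1 (sq_nonneg (p.1 - q.1))
        have e4 := mul_le_mul_of_nonneg_right e2 (sq_nonneg (p.2 - q.2))
        linarith
      have m1 := euclideanHausdorffMeasure_image_le_of_dist_le hd1 2
      have m2 := euclideanHausdorffMeasure_image_le_of_dist_le hd2 2
      rw [euclideanHausdorffMeasure_image_diagonal (ha0 p₀) (hb0 p₀)] at m1 m2
      have i1 : ENNReal.ofReal (a p₀ * b p₀) * volume s ≤ (K : ENNReal) ^ 2 *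
          (volume.withDensity fun p => ENNReal.ofReal (a p * b p)) s := by
        rw [withDensity_apply _ hs, ← lintegral_const_mul _ (by fun_prop), ← setLIntegral_const]
        refine setLIntegral_mono (by fun_prop) fun p hp => ?_
        rw [← hK2, ← ENNReal.ofReal_mul (by positivity)]
        refine ENNReal.ofReal_le_ofReal ?_
        obtain ⟨⟨-, h1⟩, -, h2⟩ := hU p (hsU hp)
        have := mul_le_mul h1 h2 (hb0 p₀).le (mul_nonneg hK0 (ha0 p).le)
        linarith
      have i2 : (volume.withDensity fun p => ENNReal.ofReal (a p * b p)) s ≤ (K : ENNReal) ^ 2 *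
          (ENNReal.ofReal (a p₀ * b p₀) * volume s) := by
        rw [withDensity_apply _ hs, ← mul_assoc, ← setLIntegral_const]
        refine setLIntegral_mono (by fun_prop) fun p hp => ?_
        rw [← hK2, ← ENNReal.ofReal_mul (by positivity)]
        refine ENNReal.ofReal_le_ofReal ?_
        obtain ⟨⟨h1, -⟩, h2, -⟩ := hU p (hsU hp)
        have := mul_le_mul h1 h2 (hb0 p).le (mul_nonneg hK0 (ha0 p₀).le)
        linarith
      rw [hemb.comap_apply, show (4 : ℕ) = 2 + 2 from rfl, pow_add, mul_assoc, mul_assoc]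
      exact ⟨m1.trans (mul_le_mul_right i1 _), i2.trans (mul_le_mul_right m2 _)⟩
    choose U h1 h2 h3 using hboth
    intro s hs
    exact ⟨measure_le_of_forall_restrict_le
        (fun p => ⟨U p, h1 p, h2 p, fun s hs hsU => (h3 p s hs hsU).1⟩) hs,
      measure_le_of_forall_restrict_le
        (fun p => ⟨U p, h1 p, h2 p, fun s hs hsU => (h3 p s hs hsU).2⟩) hs⟩
  have heq : μHE[2].comap Ψ = volume.withDensity fun p => ENNReal.ofReal (a p * b p) := by
    ext s hs
    exact le_antisymm
      (ENNReal.le_of_forall_one_lt_pow_mul_le fun K hK => (hcomp K hK s hs).1)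
      (ENNReal.le_of_forall_one_lt_pow_mul_le fun K hK => (hcomp K hK s hs).2)
  rw [← heq, hemb.map_comap]

/-! ### Tori of revolution and their rational charts -/

theorem dist_sq_orthonormalBasis_sum (F : OrthonormalBasis (Fin 3) ℝ E3) (c : E3)
    (α β γ α' β' γ' : ℝ) :
    dist (c + α • F 0 + β • F 1 + γ • F 2) (c + α' • F 0 + β' • F 1 + γ' • F 2) ^ 2
      = (α - α') ^ 2 + (β - β') ^ 2 + (γ - γ') ^ 2 := by
  have h : (c + α • F 0 + β • F 1 + γ • F 2) - (c + α' • F 0 + β' • F 1 + γ' • F 2)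
      = ∑ i, (![α - α', β - β', γ - γ'] i) • F i := by
    simp only [Fin.sum_univ_three, Matrix.cons_val_zero, Matrix.cons_val_one, Matrix.cons_val,
      sub_smul]
    abel
  rw [dist_eq_norm, h, ← real_inner_self_eq_norm_sq, F.orthonormal.inner_sum]
  simp [Fin.sum_univ_three]
  ring

theorem exists_orthonormalBasis_fin_three {w n : E3} (hw : ‖w‖ = 1) (hn : ‖n‖ = 1)
    (hnw : inner ℝ n w = 0) :
    ∃ F : OrthonormalBasis (Fin 3) ℝ E3, F 0 = w ∧ F 2 = n := by
  have hwn : inner ℝ w n = 0 := by rw [real_inner_comm]; exact hnw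
  have hv : Orthonormal ℝ (({0, 2} : Set (Fin 3)).domRestrict ![w, 0, n]) := by
    constructor
    · rintro ⟨i, hi | hi⟩ <;> subst hi <;> simpa
    · rintro ⟨i, hi | hi⟩ ⟨j, hj | hj⟩ hij <;> subst hi <;> subst hj <;>
        simp_all [Set.domRestrict]
  obtain ⟨F, hF⟩ := hv.exists_orthonormalBasis_extension_of_card_eq (by simp)
  exact ⟨F, by simpa using hF 0 (by simp), by simpa using hF 2 (by simp)⟩

theorem exists_orthonormalBasis_fin_three_of_norm {n : E3} (hn : ‖n‖ = 1) :
    ∃ F : OrthonormalBasis (Fin 3) ℝ E3, F 2 = n := by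
  have hv : Orthonormal ℝ (({2} : Set (Fin 3)).domRestrict ![0, 0, n]) := by
    constructor
    · rintro ⟨i, hi⟩
      rw [Set.mem_singleton_iff] at hi
      subst hi
      simpa
    · rintro ⟨i, hi⟩ ⟨j, hj⟩ hij
      rw [Set.mem_singleton_iff] at hi hj
      exact absurd (by simp [hi, hj]) hij
  obtain ⟨F, hF⟩ := hv.exists_orthonormalBasis_extension_of_card_eq (by simp)
  exact ⟨F, by simpa using hF 2 (by simp)⟩

theorem exists_cos_sin_of_sq_add_sq_eq_one {x y : ℝ} (h : x ^ 2 + y ^ 2 = 1) :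
    ∃ t : ℝ, x = Real.cos t ∧ y = Real.sin t := by
  have hz : (⟨x, y⟩ : ℂ) ≠ 0 := by
    intro h0
    have h1 := congrArg Complex.re h0
    have h2 := congrArg Complex.im h0
    simp only [Complex.zero_re, Complex.zero_im] at h1 h2
    subst h1; subst h2; norm_num at h
  have hn : ‖(⟨x, y⟩ : ℂ)‖ = 1 := by
    rw [Complex.norm_def, Complex.normSq_mk, ← sq, ← sq, h, Real.sqrt_one]
  exact ⟨Complex.arg ⟨x, y⟩, by rw [Complex.cos_arg hz, hn, div_one],
    by rw [Complex.sin_arg, hn, div_one]⟩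

/-- Membership in a torus of revolution, in the coordinates of an orthonormal frame whose last
vector spans the axis. -/
theorem mem_torusOfRevolution_iff (F : OrthonormalBasis (Fin 3) ℝ E3) (c : E3) (R r : ℝ) (x : E3) :
    x ∈ torusOfRevolution c (F 2) R r ↔ ∃ u v : ℝ,
      x = c + ((R + r * Real.cos u) * Real.cos v) • F 0 +
        ((R + r * Real.cos u) * Real.sin v) • F 1 + (r * Real.sin u) • F 2 := by
  constructor
  · rintro ⟨w, hw, hnw, u, rfl⟩
    have hexp : w = inner ℝ (F 0) w • F 0 + inner ℝ (F 1) w • F 1 := by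
      have := F.sum_repr' w
      rw [Fin.sum_univ_three, hnw, zero_smul, add_zero] at this
      exact this.symm
    have hsq : (inner ℝ (F 0) w : ℝ) ^ 2 + (inner ℝ (F 1) w : ℝ) ^ 2 = 1 := by
      have := F.sum_sq_inner_right w
      rw [Fin.sum_univ_three, hnw, hw] at this
      linarith
    obtain ⟨v, h1, h2⟩ := exists_cos_sin_of_sq_add_sq_eq_one hsq
    refine ⟨u, v, ?_⟩
    nth_rewrite 1 [hexp]
    rw [← h1, ← h2]
    module
  · rintro ⟨u, v, rfl⟩
    have h00 : (inner ℝ (F 0) (F 0) : ℝ) = 1 := by simp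
    have h11 : (inner ℝ (F 1) (F 1) : ℝ) = 1 := by simp
    have h01 : (inner ℝ (F 0) (F 1) : ℝ) = 0 := F.inner_eq_zero (by decide)
    have h20 : (inner ℝ (F 2) (F 0) : ℝ) = 0 := F.inner_eq_zero (by decide)
    have h21 : (inner ℝ (F 2) (F 1) : ℝ) = 0 := F.inner_eq_zero (by decide)
    refine ⟨Real.cos v • F 0 + Real.sin v • F 1, ?_, ?_, u, ?_⟩
    · have : ‖Real.cos v • F 0 + Real.sin v • F 1‖ ^ 2 = 1 := by
        rw [norm_add_sq_real, norm_smul, norm_smul, real_inner_smul_left, real_inner_smul_right,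
          h01, F.norm_eq_one, F.norm_eq_one]
        simp
      exact (pow_eq_one_iff_of_nonneg (norm_nonneg _) two_ne_zero).1 this
    · rw [inner_add_right, real_inner_smul_right, real_inner_smul_right, h20, h21]
      simp
    · module

theorem torusRadius_pos {R r c₀ s₀ : ℝ} (hr : 0 < r) (hR : r < R) (h : c₀ ^ 2 + s₀ ^ 2 = 1) :
    0 < R + r * c₀ := by
  have h1 : -1 ≤ c₀ := by nlinarith [sq_nonneg s₀]
  nlinarith

/-- The distance from the axis of the points of `torusChart` with first coordinate `y`. -/
noncomputable def torusChartRadius (R r c₀ s₀ y : ℝ) : ℝ :=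
  R + r * ((c₀ * (y ^ 2 - 1) - 2 * s₀ * y) / (1 + y ^ 2))

/-- Rational chart of the torus of revolution around the point
`c + (R + r * c₀) • F 0 + (r * s₀) • F 2`, where `(c₀, s₀)` is a point of the unit circle. The first
coordinate is the cotangent of half the angle between a point and the base point along the
generating circle, so that the base point sits at infinity, and the second one is the tangent of
half the angle of rotation about the axis. -/
noncomputable def torusChart (F : OrthonormalBasis (Fin 3) ℝ E3) (c : E3) (R r c₀ s₀ : ℝ)
    (p : ℝ × ℝ) : E3 :=
  c + (torusChartRadius R r c₀ s₀ p.1 * ((1 - p.2 ^ 2) / (1 + p.2 ^ 2))) • F 0 +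
    (torusChartRadius R r c₀ s₀ p.1 * (2 * p.2 / (1 + p.2 ^ 2))) • F 1 +
    (r * ((s₀ * (p.1 ^ 2 - 1) + 2 * c₀ * p.1) / (1 + p.1 ^ 2))) • F 2

theorem one_add_sq_pos (y : ℝ) : 0 < 1 + y ^ 2 := by positivity

theorem torusChartRadius_pos {R r c₀ s₀ : ℝ} (hr : 0 < r) (hR : r < R) (h : c₀ ^ 2 + s₀ ^ 2 = 1)
    (y : ℝ) : 0 < torusChartRadius R r c₀ s₀ y := by
  have hy := one_add_sq_pos y
  have h1 : |(c₀ * (y ^ 2 - 1) - 2 * s₀ * y) / (1 + y ^ 2)| ≤ 1 := by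
    rw [abs_div, abs_of_pos hy, div_le_one hy]
    refine abs_le_of_sq_le_sq ?_ hy.le
    nlinarith [sq_nonneg (s₀ * (y ^ 2 - 1) + 2 * c₀ * y),
      congrArg (fun t => t * (1 + y ^ 2) ^ 2) h]
  have h2 := (abs_le.1 h1).1
  rw [torusChartRadius]
  nlinarith

theorem continuous_torusChartRadius {R r c₀ s₀ : ℝ} :
    Continuous (torusChartRadius R r c₀ s₀) := by
  unfold torusChartRadius
  have : ∀ y : ℝ, 1 + y ^ 2 ≠ 0 := fun y => (one_add_sq_pos y).ne'
  fun_prop (disch := exact this)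

theorem dist_sq_torusChart (F : OrthonormalBasis (Fin 3) ℝ E3) (c : E3) {R r c₀ s₀ : ℝ}
    (h : c₀ ^ 2 + s₀ ^ 2 = 1) (p q : ℝ × ℝ) :
    dist (torusChart F c R r c₀ s₀ p) (torusChart F c R r c₀ s₀ q) ^ 2
      = 2 * r / (1 + p.1 ^ 2) * (2 * r / (1 + q.1 ^ 2)) * (p.1 - q.1) ^ 2 +
        2 * torusChartRadius R r c₀ s₀ p.1 / (1 + p.2 ^ 2) *
          (2 * torusChartRadius R r c₀ s₀ q.1 / (1 + q.2 ^ 2)) * (p.2 - q.2) ^ 2 := by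
  obtain ⟨y, ζ⟩ := p
  obtain ⟨y', ζ'⟩ := q
  rw [torusChart, torusChart, dist_sq_orthonormalBasis_sum]
  dsimp only
  have hy := (one_add_sq_pos y).ne'
  have hy' := (one_add_sq_pos y').ne'
  have hz := (one_add_sq_pos ζ).ne'
  have hz' := (one_add_sq_pos ζ').ne'
  -- The chord along the generating circle.
  have e1 : (torusChartRadius R r c₀ s₀ y - torusChartRadius R r c₀ s₀ y') ^ 2 +
      (r * ((s₀ * (y ^ 2 - 1) + 2 * c₀ * y) / (1 + y ^ 2)) -
        r * ((s₀ * (y' ^ 2 - 1) + 2 * c₀ * y') / (1 + y' ^ 2))) ^ 2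
      = (c₀ ^ 2 + s₀ ^ 2) * (2 * r / (1 + y ^ 2) * (2 * r / (1 + y' ^ 2)) * (y - y') ^ 2) := by
    unfold torusChartRadius
    field_simp
    ring
  -- The law of cosines for the rotation, in terms of the half-angle tangents.
  have e2 : ∀ ρ ρ' : ℝ, (ρ * ((1 - ζ ^ 2) / (1 + ζ ^ 2)) - ρ' * ((1 - ζ' ^ 2) / (1 + ζ' ^ 2))) ^ 2 +
      (ρ * (2 * ζ / (1 + ζ ^ 2)) - ρ' * (2 * ζ' / (1 + ζ' ^ 2))) ^ 2
      = (ρ - ρ') ^ 2 + 2 * ρ / (1 + ζ ^ 2) * (2 * ρ' / (1 + ζ' ^ 2)) * (ζ - ζ') ^ 2 := by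
    intro ρ ρ'
    field_simp
    ring
  rw [h, one_mul] at e1
  rw [e2, ← e1]
  ring

/-- The squared distance from the base point, which is the limit of `dist_sq_torusChart` when the
first coordinate of the other point tends to infinity and its second coordinate is zero. -/
theorem dist_sq_base_torusChart (F : OrthonormalBasis (Fin 3) ℝ E3) (c : E3) {R r c₀ s₀ : ℝ}
    (h : c₀ ^ 2 + s₀ ^ 2 = 1) (p : ℝ × ℝ) :
    dist (c + (R + r * c₀) • F 0 + (r * s₀) • F 2) (torusChart F c R r c₀ s₀ p) ^ 2
      = 4 / (1 + p.1 ^ 2) * (r ^ 2 + (R + r * c₀) *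
          (torusChartRadius R r c₀ s₀ p.1 * (1 + p.1 ^ 2)) * p.2 ^ 2 / (1 + p.2 ^ 2)) := by
  obtain ⟨y, ζ⟩ := p
  have := dist_sq_orthonormalBasis_sum F c (R + r * c₀) 0 (r * s₀)
    (torusChartRadius R r c₀ s₀ y * ((1 - ζ ^ 2) / (1 + ζ ^ 2)))
    (torusChartRadius R r c₀ s₀ y * (2 * ζ / (1 + ζ ^ 2)))
    (r * ((s₀ * (y ^ 2 - 1) + 2 * c₀ * y) / (1 + y ^ 2)))
  rw [zero_smul, add_zero] at this
  rw [torusChart, this]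
  have hy := (one_add_sq_pos y).ne'
  have hz := (one_add_sq_pos ζ).ne'
  have e1 : (R + r * c₀ - torusChartRadius R r c₀ s₀ y) ^ 2 +
      (r * s₀ - r * ((s₀ * (y ^ 2 - 1) + 2 * c₀ * y) / (1 + y ^ 2))) ^ 2
      = (c₀ ^ 2 + s₀ ^ 2) * (4 * r ^ 2 / (1 + y ^ 2)) := by
    unfold torusChartRadius
    field_simp
    ring
  have e2 : ∀ ρ ρ' : ℝ, (ρ - ρ' * ((1 - ζ ^ 2) / (1 + ζ ^ 2))) ^ 2 +
      (0 - ρ' * (2 * ζ / (1 + ζ ^ 2))) ^ 2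
      = (ρ - ρ') ^ 2 + 4 * ρ * ρ' * ζ ^ 2 / (1 + ζ ^ 2) := by
    intro ρ ρ'
    field_simp
    ring
  rw [h, one_mul] at e1
  rw [e2, add_right_comm, e1]
  field_simp

theorem torusChartRadius_mul_quadratic {R r c₀ s₀ : ℝ} (h : c₀ ^ 2 + s₀ ^ 2 = 1) (y : ℝ) :
    (R + r * c₀) * (torusChartRadius R r c₀ s₀ y * (1 + y ^ 2))
      = ((R + r * c₀) * y - r * s₀) ^ 2 + (R ^ 2 - r ^ 2) := by
  have hy := (one_add_sq_pos y).ne'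
  unfold torusChartRadius
  field_simp
  linear_combination (-r ^ 2) * h

theorem torusChart_mem (F : OrthonormalBasis (Fin 3) ℝ E3) (c : E3) {R r c₀ s₀ : ℝ}
    (h : c₀ ^ 2 + s₀ ^ 2 = 1) (p : ℝ × ℝ) :
    torusChart F c R r c₀ s₀ p ∈ torusOfRevolution c (F 2) R r := by
  have hy := (one_add_sq_pos p.1).ne'
  have hz := (one_add_sq_pos p.2).ne'
  obtain ⟨u, hu, hu'⟩ : ∃ u, (c₀ * (p.1 ^ 2 - 1) - 2 * s₀ * p.1) / (1 + p.1 ^ 2) = Real.cos u ∧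
      (s₀ * (p.1 ^ 2 - 1) + 2 * c₀ * p.1) / (1 + p.1 ^ 2) = Real.sin u := by
    refine exists_cos_sin_of_sq_add_sq_eq_one ?_
    field_simp
    linear_combination (1 + p.1 ^ 2) ^ 2 * h
  obtain ⟨v, hv, hv'⟩ : ∃ v, (1 - p.2 ^ 2) / (1 + p.2 ^ 2) = Real.cos v ∧
      2 * p.2 / (1 + p.2 ^ 2) = Real.sin v := by
    refine exists_cos_sin_of_sq_add_sq_eq_one ?_
    field_simp
    ring
  rw [mem_torusOfRevolution_iff]
  exact ⟨u, v, by rw [torusChart, torusChartRadius, hu, hu', hv, hv']⟩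

/-- The chart misses only the circle of latitude of the base point and the opposite generating
circle. -/
theorem mem_range_torusChart (F : OrthonormalBasis (Fin 3) ℝ E3) (c : E3) {R r c₀ s₀ u v : ℝ}
    (h : c₀ ^ 2 + s₀ ^ 2 = 1) (hu : ¬ (Real.cos u = c₀ ∧ Real.sin u = s₀))
    (hv : Real.cos v ≠ -1) :
    c + ((R + r * Real.cos u) * Real.cos v) • F 0 + ((R + r * Real.cos u) * Real.sin v) • F 1 +
      (r * Real.sin u) • F 2 ∈ Set.range (torusChart F c R r c₀ s₀) := by
  have hcs := Real.cos_sq_add_sin_sq u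
  have hcs' := Real.cos_sq_add_sin_sq v
  set C := Real.cos u
  set S := Real.sin u
  set C' := Real.cos v
  set S' := Real.sin v
  have hv1 : 1 + C' ≠ 0 := fun h0 => hv (by linarith)
  have hu1 : 1 - (C * c₀ + S * s₀) ≠ 0 := by
    intro h0
    have : (C - c₀) ^ 2 + (S - s₀) ^ 2 = 0 := by linear_combination hcs + h + 2 * h0
    have h1 : C - c₀ = 0 := by nlinarith [sq_nonneg (C - c₀), sq_nonneg (S - s₀)]
    have h2 : S - s₀ = 0 := by nlinarith [sq_nonneg (C - c₀), sq_nonneg (S - s₀)]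
    exact hu ⟨by linarith, by linarith⟩
  have hΔ : (C * c₀ + S * s₀) ^ 2 + (S * c₀ - C * s₀) ^ 2 = 1 := by
    linear_combination (c₀ ^ 2 + s₀ ^ 2) * hcs + h
  have hC : C = c₀ * (C * c₀ + S * s₀) - s₀ * (S * c₀ - C * s₀) := by linear_combination -C * h
  have hS : S = s₀ * (C * c₀ + S * s₀) + c₀ * (S * c₀ - C * s₀) := by linear_combination -S * h
  generalize C * c₀ + S * s₀ = X at hu1 hΔ hC hS
  generalize S * c₀ - C * s₀ = Y at hΔ hC hS
  set y := Y / (1 - X) with hy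
  set ζ := S' / (1 + C') with hζ
  have hy2 : 1 + y ^ 2 = 2 / (1 - X) := by
    rw [hy]
    field_simp
    linear_combination hΔ
  have hζ2 : 1 + ζ ^ 2 = 2 / (1 + C') := by
    rw [hζ]
    field_simp
    linear_combination hcs'
  have e1 : (1 - ζ ^ 2) / (1 + ζ ^ 2) = C' := by
    rw [show 1 - ζ ^ 2 = 2 - (1 + ζ ^ 2) by ring, hζ2]
    field_simp
    ring
  have e2 : 2 * ζ / (1 + ζ ^ 2) = S' := by
    rw [hζ2, hζ]
    field_simp
  have e3 : (c₀ * (y ^ 2 - 1) - 2 * s₀ * y) / (1 + y ^ 2) = C := by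
    rw [show y ^ 2 - 1 = (1 + y ^ 2) - 2 by ring, hy2, hy, hC]
    field_simp
    ring
  have e4 : (s₀ * (y ^ 2 - 1) + 2 * c₀ * y) / (1 + y ^ 2) = S := by
    rw [show y ^ 2 - 1 = (1 + y ^ 2) - 2 by ring, hy2, hy, hS]
    field_simp
    ring
  exact ⟨(y, ζ), by rw [torusChart, torusChartRadius, e1, e2, e3, e4]⟩

theorem euclideanHausdorffMeasure_two_range_of_contDiff {γ : ℝ → E3} (h : ContDiff ℝ 1 γ) :
    μHE[2] (Set.range γ) = 0 := by
  have h1 : dimH (Set.range γ) < ((2 : NNReal) : ENNReal) :=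
    h.dimH_range_le.trans_lt (by simp)
  have h2 := hausdorffMeasure_of_dimH_lt h1
  rw [Measure.euclideanHausdorffMeasure_def, Measure.smul_apply]
  simp only [NNReal.coe_ofNat] at h2
  simp [h2]

/-- The chart covers the torus up to two circles, which have no area. -/
theorem restrict_torusOfRevolution_eq (F : OrthonormalBasis (Fin 3) ℝ E3) (c : E3)
    {R r c₀ s₀ : ℝ} (hr : 0 < r) (hR : r < R) (h : c₀ ^ 2 + s₀ ^ 2 = 1) :
    MeasurableEmbedding (torusChart F c R r c₀ s₀) ∧
    μHE[2].restrict (torusOfRevolution c (F 2) R r)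
      = Measure.map (torusChart F c R r c₀ s₀) (volume.withDensity fun p =>
          ENNReal.ofReal (2 * r / (1 + p.1 ^ 2) *
            (2 * torusChartRadius R r c₀ s₀ p.1 / (1 + p.2 ^ 2)))) := by
  have hne : ∀ y : ℝ, 1 + y ^ 2 ≠ 0 := fun y => (one_add_sq_pos y).ne'
  have hρ := torusChartRadius_pos hr hR h
  obtain ⟨h1, h2⟩ := map_withDensity_eq_restrict_range (Ψ := torusChart F c R r c₀ s₀)
    (a := fun p => 2 * r / (1 + p.1 ^ 2))
    (b := fun p => 2 * torusChartRadius R r c₀ s₀ p.1 / (1 + p.2 ^ 2))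
    (by fun_prop (disch := exact fun _ => hne _))
    (by
      have := continuous_torusChartRadius (R := R) (r := r) (c₀ := c₀) (s₀ := s₀)
      fun_prop (disch := exact fun _ => hne _))
    (fun p => div_pos (by linarith) (one_add_sq_pos _))
    (fun p => div_pos (by linarith [hρ p.1]) (one_add_sq_pos _))
    (dist_sq_torusChart F c h)
  refine ⟨h1, ?_⟩
  rw [h2]
  refine Measure.restrict_congr_set ?_
  set γ₁ : ℝ → E3 := fun v => c + ((R + r * c₀) * Real.cos v) • F 0 +
    ((R + r * c₀) * Real.sin v) • F 1 + (r * s₀) • F 2 with hγ₁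
  set γ₂ : ℝ → E3 := fun u => c + ((R + r * Real.cos u) * (-1)) • F 0 + (r * Real.sin u) • F 2
    with hγ₂
  have hnull : μHE[2] (Set.range γ₁ ∪ Set.range γ₂) = 0 := by
    refine measure_union_null (euclideanHausdorffMeasure_two_range_of_contDiff ?_)
      (euclideanHausdorffMeasure_two_range_of_contDiff ?_)
    · have := Real.contDiff_cos (n := 1)
      have := Real.contDiff_sin (n := 1)
      fun_prop
    · have := Real.contDiff_cos (n := 1)
      have := Real.contDiff_sin (n := 1)
      fun_prop
  refine (ae_le_set.2 ?_).antisymm (ae_le_set.2 ?_)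
  · refine measure_mono_null ?_ hnull
    rintro x ⟨hx, hx'⟩
    obtain ⟨u, v, rfl⟩ := (mem_torusOfRevolution_iff F c R r x).1 hx
    by_contra hcon
    rw [Set.mem_union, not_or] at hcon
    refine hx' (mem_range_torusChart F c h ?_ ?_)
    · rintro ⟨e1, e2⟩
      exact hcon.1 ⟨v, by rw [hγ₁, e1, e2]⟩
    · intro e1
      have e2 : Real.sin v = 0 := by nlinarith [Real.sin_sq_add_cos_sq v]
      exact hcon.2 ⟨u, by rw [hγ₂, e1, e2, mul_zero, zero_smul, add_zero]⟩
  · rw [Set.sdiff_eq_empty.2, measure_empty]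
    rintro _ ⟨p, rfl⟩
    exact torusChart_mem F c h p

/-! ### Chord coordinates -/

theorem hasDerivAt_div_sqrt_one_add_sq (x : ℝ) :
    HasDerivAt (fun x : ℝ => x / √(1 + x ^ 2)) (1 / ((1 + x ^ 2) * √(1 + x ^ 2))) x := by
  have h0 := one_add_sq_pos x
  have h1 : HasDerivAt (fun x : ℝ => 1 + x ^ 2) (2 * x) x := by
    simpa using (hasDerivAt_pow 2 x).const_add 1
  have h2 := (hasDerivAt_id x).div (h1.sqrt h0.ne') (Real.sqrt_pos.2 h0).ne'
  refine h2.congr_deriv ?_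
  have h3 := Real.sq_sqrt h0.le
  have h4 := (Real.sqrt_pos.2 h0).ne'
  simp only [id]
  field_simp
  rw [h3]
  ring

/-- Substitution of `η = k * ζ / √(1 + ζ ^ 2)`, which maps the line onto `(-k, k)`. -/
theorem lintegral_comp_mul_div_sqrt_one_add_sq {k : ℝ} (hk : 0 < k) (F : ℝ → ENNReal) :
    ∫⁻ ζ : ℝ, ENNReal.ofReal (k / ((1 + ζ ^ 2) * √(1 + ζ ^ 2))) * F (k * ζ / √(1 + ζ ^ 2))
      = ∫⁻ η in {η : ℝ | η ^ 2 < k ^ 2}, F η := by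
  have hd : ∀ x : ℝ, HasDerivAt (fun ζ : ℝ => k * ζ / √(1 + ζ ^ 2))
      (k / ((1 + x ^ 2) * √(1 + x ^ 2))) x := fun x => by
    have := (hasDerivAt_div_sqrt_one_add_sq x).const_mul k
    simp only [mul_one_div] at this
    exact this.congr_of_eventuallyEq (Eventually.of_forall fun y => mul_div_assoc _ _ _)
  have hpos : ∀ x : ℝ, 0 < k / ((1 + x ^ 2) * √(1 + x ^ 2)) := fun x => by positivity
  have hinj : Function.Injective (fun ζ : ℝ => k * ζ / √(1 + ζ ^ 2)) :=
    (strictMono_of_hasDerivAt_pos hd hpos).injective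
  have himg : (fun ζ : ℝ => k * ζ / √(1 + ζ ^ 2)) '' Set.univ = {η : ℝ | η ^ 2 < k ^ 2} := by
    ext η
    simp only [Set.image_univ, Set.mem_range, Set.mem_ofPred_eq]
    constructor
    · rintro ⟨ζ, rfl⟩
      have h0 := one_add_sq_pos ζ
      rw [div_pow, Real.sq_sqrt h0.le, div_lt_iff₀ h0]
      nlinarith [pow_pos hk 2]
    · intro h
      have h0 : 0 < k ^ 2 - η ^ 2 := by linarith
      refine ⟨η / √(k ^ 2 - η ^ 2), ?_⟩
      have h1 : 1 + (η / √(k ^ 2 - η ^ 2)) ^ 2 = (k / √(k ^ 2 - η ^ 2)) ^ 2 := by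
        rw [div_pow, div_pow, Real.sq_sqrt h0.le]
        field_simp
        ring
      have h2 := Real.sqrt_pos.2 h0
      rw [h1, Real.sqrt_sq (by positivity)]
      field_simp
  have := lintegral_image_eq_lintegral_abs_deriv_mul MeasurableSet.univ
    (fun x _ => (hd x).hasDerivWithinAt) hinj.injOn F
  rw [himg, Measure.restrict_univ] at this
  rw [this]
  exact lintegral_congr fun ζ => by rw [abs_of_pos (hpos ζ)]

theorem lintegral_comp_mul_sub {k : ℝ} (hk : 0 < k) (σ : ℝ) (F : ℝ → ENNReal) :
    ∫⁻ y : ℝ, F (k * y - σ) = ENNReal.ofReal (1 / k) * ∫⁻ z : ℝ, F z := by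
  have hd : ∀ x : ℝ, HasDerivAt (fun y : ℝ => k * y - σ) k x := fun x => by
    simpa using ((hasDerivAt_id x).const_mul k).sub_const σ
  have himg : (fun y : ℝ => k * y - σ) '' Set.univ = Set.univ := by
    rw [Set.image_univ, Set.range_eq_univ]
    exact fun z => ⟨(z + σ) / k, by field_simp; ring⟩
  have := lintegral_image_eq_lintegral_abs_deriv_mul MeasurableSet.univ
    (fun x _ => (hd x).hasDerivWithinAt)
    (strictMono_of_hasDerivAt_pos hd fun _ => hk).injective.injOn F
  rw [himg, Measure.restrict_univ, abs_of_pos hk, lintegral_const_mul' _ _ ENNReal.ofReal_ne_top]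
    at this
  rw [this, ← mul_assoc, ← ENNReal.ofReal_mul (by positivity), one_div_mul_cancel hk.ne',
    ENNReal.ofReal_one, one_mul]

/-- The area element of the torus divided by the fourth power of the distance from the base point,
up to a constant factor, in the coordinates `(z, η)` of `lintegral_torusOfRevolution_diff_ball`;
here `h = R ^ 2 - r ^ 2`.
The torus occupies the region `r ^ 2 * η ^ 2 < z ^ 2 + h`, and outside of it the root in the
denominator is zero, so that the function vanishes there. -/
noncomputable def chordDensity (r h : ℝ) (p : ℝ × ℝ) : ℝ :=
  (p.1 ^ 2 + h) / ((1 + p.2 ^ 2) ^ 2 * √(p.1 ^ 2 + h - r ^ 2 * p.2 ^ 2))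

/-- The part of the `(z, η)`-plane at squared distance at least `4 * r ^ 2 * ρ ^ 2 / N` from the
base point. -/
def truncatedRegion (ρ σ N : ℝ) : Set (ℝ × ℝ) :=
  {p | (p.1 + σ) ^ 2 + ρ ^ 2 ≤ N * (1 + p.2 ^ 2)}

theorem chordDensity_nonneg {r h : ℝ} (hh : 0 < h) (p : ℝ × ℝ) : 0 ≤ chordDensity r h p := by
  unfold chordDensity
  positivity

theorem measurable_chordDensity (r h : ℝ) : Measurable (chordDensity r h) := by
  unfold chordDensity
  fun_prop

theorem measurableSet_truncatedRegion (ρ σ N : ℝ) : MeasurableSet (truncatedRegion ρ σ N) :=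
  measurableSet_le (by fun_prop) (by fun_prop)

theorem chordDensity_of_le {r h z η : ℝ} (hz : z ^ 2 + h ≤ r ^ 2 * η ^ 2) :
    chordDensity r h (z, η) = 0 := by
  rw [chordDensity, Real.sqrt_eq_zero_of_nonpos (by linarith), mul_zero, div_zero]

/-- The substitution `η = √(z ^ 2 + h) / r * ζ / √(1 + ζ ^ 2)` in `chordDensity`. -/
theorem chordDensity_comp {r h : ℝ} (hr : 0 < r) (hh : 0 < h) (z ζ : ℝ) :
    √(z ^ 2 + h) / r / ((1 + ζ ^ 2) * √(1 + ζ ^ 2)) *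
        chordDensity r h (z, √(z ^ 2 + h) / r * ζ / √(1 + ζ ^ 2))
      = r ^ 3 * (z ^ 2 + h) * (1 + ζ ^ 2) / (r ^ 2 * (1 + ζ ^ 2) + (z ^ 2 + h) * ζ ^ 2) ^ 2 := by
  have hB : 0 < z ^ 2 + h := by positivity
  have h0 := one_add_sq_pos ζ
  unfold chordDensity
  dsimp only
  generalize z ^ 2 + h = B at hB
  have e1 : (√B / r * ζ / √(1 + ζ ^ 2)) ^ 2 = B * ζ ^ 2 / (r ^ 2 * (1 + ζ ^ 2)) := by
    rw [div_pow, mul_pow, div_pow, Real.sq_sqrt hB.le, Real.sq_sqrt h0.le]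
    field_simp
  have e2 : B - r ^ 2 * (B * ζ ^ 2 / (r ^ 2 * (1 + ζ ^ 2))) = B / (1 + ζ ^ 2) := by
    field_simp
    ring
  rw [e1, e2, Real.sqrt_div hB.le]
  have hs := Real.sq_sqrt hB.le
  have hs0 := Real.sqrt_pos.2 hB
  have ht0 := Real.sqrt_pos.2 h0
  have e3 : 0 < r ^ 2 * (1 + ζ ^ 2) + B * ζ ^ 2 := by positivity
  have e4 : 1 + B * ζ ^ 2 / (r ^ 2 * (1 + ζ ^ 2))
      = (r ^ 2 * (1 + ζ ^ 2) + B * ζ ^ 2) / (r ^ 2 * (1 + ζ ^ 2)) := by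
    field_simp
  rw [e4]
  field_simp

theorem lintegral_chordDensity_mul {r h : ℝ} (hr : 0 < r) (hh : 0 < h) (z : ℝ)
    {G : ℝ → ENNReal} :
    ∫⁻ η : ℝ, ENNReal.ofReal (chordDensity r h (z, η)) * G η
      = ∫⁻ ζ : ℝ, ENNReal.ofReal (r ^ 3 * (z ^ 2 + h) * (1 + ζ ^ 2) /
          (r ^ 2 * (1 + ζ ^ 2) + (z ^ 2 + h) * ζ ^ 2) ^ 2) *
            G (√(z ^ 2 + h) / r * ζ / √(1 + ζ ^ 2)) := by
  have hB : 0 < z ^ 2 + h := by positivity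
  have hk : 0 < √(z ^ 2 + h) / r := by positivity
  have h1 : ∀ η ∉ {η : ℝ | η ^ 2 < (√(z ^ 2 + h) / r) ^ 2},
      ENNReal.ofReal (chordDensity r h (z, η)) * G η = 0 := by
    intro η hη
    rw [Set.mem_ofPred_eq, not_lt, div_pow, Real.sq_sqrt hB.le, div_le_iff₀ (by positivity)] at hη
    rw [chordDensity_of_le (by linarith), ENNReal.ofReal_zero, zero_mul]
  rw [← setLIntegral_eq_of_support_subset (Function.support_subset_iff'.2 h1),
    ← lintegral_comp_mul_div_sqrt_one_add_sq hk]
  refine lintegral_congr fun ζ => ?_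
  rw [← mul_assoc, ← ENNReal.ofReal_mul (by positivity), chordDensity_comp hr hh]

/-! ### The truncated integral in chord coordinates -/

/-- The truncated potential as an integral in the coordinates `(z, η)`, where
`z = (R + r * c₀) * y - r * s₀`, and `η ^ 2` is the ratio of the two terms in the squared distance
from the base point, that of the rotation and that of the generating circle. -/
theorem lintegral_torusOfRevolution_diff_ball (F : OrthonormalBasis (Fin 3) ℝ E3) (c : E3)
    {R r c₀ s₀ ε : ℝ} (hr : 0 < r) (hR : r < R) (h : c₀ ^ 2 + s₀ ^ 2 = 1) (hε : 0 < ε) :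
    ∫⁻ y in torusOfRevolution c (F 2) R r \
        Metric.ball (c + (R + r * c₀) • F 0 + (r * s₀) • F 2) ε,
        ENNReal.ofReal (1 / dist (c + (R + r * c₀) • F 0 + (r * s₀) • F 2) y ^ 4) ∂μHE[2]
      = ENNReal.ofReal (1 / (4 * r ^ 2 * (R + r * c₀) ^ 2)) *
        ∫⁻ p in truncatedRegion (R + r * c₀) (r * s₀) (4 * r ^ 2 * (R + r * c₀) ^ 2 / ε ^ 2),
          ENNReal.ofReal (chordDensity r (R ^ 2 - r ^ 2) p) := by
  obtain ⟨hemb, hmap⟩ := restrict_torusOfRevolution_eq F c hr hR h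
  have hdist := dist_sq_base_torusChart F c (R := R) (r := r) h
  have hquad := torusChartRadius_mul_quadratic (R := R) (r := r) h
  have hρpos := torusChartRadius_pos hr hR h
  have hh : 0 < R ^ 2 - r ^ 2 := by nlinarith
  have hρ : 0 < R + r * c₀ := torusRadius_pos hr hR h
  set x := c + (R + r * c₀) • F 0 + (r * s₀) • F 2 with hx
  set Ψ := torusChart F c R r c₀ s₀ with hΨ
  set J : ℝ × ℝ → ℝ := fun p => 2 * r / (1 + p.1 ^ 2) *
            (2 * torusChartRadius R r c₀ s₀ p.1 / (1 + p.2 ^ 2)) with hJ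
  have hJm : Measurable fun p => ENNReal.ofReal (J p) := by
    have := (continuous_torusChartRadius (R := R) (r := r) (c₀ := c₀) (s₀ := s₀)).measurable
    fun_prop
  set ρ := R + r * c₀ with hρdef
  set σ := r * s₀ with hσdef
  set I : ℝ × ℝ → ENNReal := (truncatedRegion ρ σ (4 * r ^ 2 * ρ ^ 2 / ε ^ 2)).indicator 1 with hI
  have hIm : Measurable I := measurable_one.indicator (measurableSet_truncatedRegion _ _ _)
  have hgm : Measurable ((Metric.ball x ε)ᶜ.indicator
      fun y => ENNReal.ofReal (1 / dist x y ^ 4)) :=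
    Measurable.indicator (by fun_prop) Metric.isOpen_ball.measurableSet.compl
  rw [Set.sdiff_eq, Set.inter_comm, ← Measure.restrict_restrict
    Metric.isOpen_ball.measurableSet.compl, hmap,
    ← lintegral_indicator Metric.isOpen_ball.measurableSet.compl, hemb.lintegral_map]
  refine (lintegral_withDensity_eq_lintegral_mul _ hJm (hgm.comp hemb.measurable)).trans ?_
  have key : ∀ p : ℝ × ℝ, ((fun p => ENNReal.ofReal (J p)) *
      ((Metric.ball x ε)ᶜ.indicator (fun y => ENNReal.ofReal (1 / dist x y ^ 4)) ∘ Ψ)) p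
      = ENNReal.ofReal (1 / (4 * r ^ 2 * ρ)) *
        (ENNReal.ofReal (r ^ 3 * ((ρ * p.1 - σ) ^ 2 + (R ^ 2 - r ^ 2)) * (1 + p.2 ^ 2) /
          (r ^ 2 * (1 + p.2 ^ 2) + ((ρ * p.1 - σ) ^ 2 + (R ^ 2 - r ^ 2)) * p.2 ^ 2) ^ 2) *
          I (ρ * p.1 - σ,
            √((ρ * p.1 - σ) ^ 2 + (R ^ 2 - r ^ 2)) / r * p.2 / √(1 + p.2 ^ 2))) := by
    rintro ⟨y, ζ⟩
    have hy := one_add_sq_pos y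
    have hz := one_add_sq_pos ζ
    have hd := hdist (y, ζ)
    have hq := hquad y
    have hρy := hρpos y
    dsimp only [Pi.mul_apply, Function.comp, J] at hd ⊢
    have hBpos : 0 < (ρ * y - σ) ^ 2 + (R ^ 2 - r ^ 2) := by positivity
    have hη : (√((ρ * y - σ) ^ 2 + (R ^ 2 - r ^ 2)) / r * ζ / √(1 + ζ ^ 2)) ^ 2
        = ((ρ * y - σ) ^ 2 + (R ^ 2 - r ^ 2)) * ζ ^ 2 / (r ^ 2 * (1 + ζ ^ 2)) := by
      rw [div_pow, mul_pow, div_pow, Real.sq_sqrt hBpos.le, Real.sq_sqrt hz.le]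
      field_simp
    rw [hq] at hd
    have hmem : Ψ (y, ζ) ∈ (Metric.ball x ε)ᶜ ↔ (ρ * y - σ,
        √((ρ * y - σ) ^ 2 + (R ^ 2 - r ^ 2)) / r * ζ / √(1 + ζ ^ 2)) ∈
          truncatedRegion ρ σ (4 * r ^ 2 * ρ ^ 2 / ε ^ 2) := by
      rw [Set.mem_compl_iff, Metric.mem_ball, not_lt, dist_comm,
        ← sq_le_sq₀ hε.le dist_nonneg, hd, truncatedRegion, Set.mem_ofPred_eq]
      dsimp only
      rw [hη, sub_add_cancel]
      generalize (ρ * y - σ) ^ 2 + (R ^ 2 - r ^ 2) = B at hBpos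
      rw [div_mul_eq_mul_div, le_div_iff₀ hy]
      have e1 : 4 * r ^ 2 * ρ ^ 2 / ε ^ 2 * (1 + B * ζ ^ 2 / (r ^ 2 * (1 + ζ ^ 2)))
          = ρ ^ 2 / ε ^ 2 * (4 * (r ^ 2 + B * ζ ^ 2 / (1 + ζ ^ 2))) := by
        field_simp
      rw [e1, show (ρ * y) ^ 2 + ρ ^ 2 = ρ ^ 2 / ε ^ 2 * (ε ^ 2 * (1 + y ^ 2)) by
        field_simp; ring]
      exact (mul_le_mul_iff_right₀ (by positivity)).symm
    by_cases hcase : Ψ (y, ζ) ∈ (Metric.ball x ε)ᶜ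
    · rw [Set.indicator_of_mem hcase, hI, Set.indicator_of_mem (hmem.1 hcase), Pi.one_apply,
        mul_one, ← ENNReal.ofReal_mul (by positivity), ← ENNReal.ofReal_mul (by positivity)]
      congr 1
      rw [show dist x (Ψ (y, ζ)) ^ 4 = (dist x (Ψ (y, ζ)) ^ 2) ^ 2 by ring, hd]
      have hρ' : torusChartRadius R r c₀ s₀ y
          = ((ρ * y - σ) ^ 2 + (R ^ 2 - r ^ 2)) / (ρ * (1 + y ^ 2)) := by
        rw [← hq]
        field_simp
      rw [hρ']
      generalize (ρ * y - σ) ^ 2 + (R ^ 2 - r ^ 2) = B at hBpos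
      have e3 : r ^ 2 + B * ζ ^ 2 / (1 + ζ ^ 2)
          = (r ^ 2 * (1 + ζ ^ 2) + B * ζ ^ 2) / (1 + ζ ^ 2) := by
        field_simp
      have e4 : 0 < r ^ 2 * (1 + ζ ^ 2) + B * ζ ^ 2 := by positivity
      rw [e3]
      field_simp
      ring
    · rw [Set.indicator_of_notMem hcase, hI, Set.indicator_of_notMem (fun h => hcase (hmem.2 h)),
        mul_zero, mul_zero, mul_zero]
  rw [lintegral_congr key, lintegral_const_mul' _ _ ENNReal.ofReal_ne_top, Measure.volume_eq_prod,
    lintegral_prod _ (by fun_prop)]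
  dsimp only
  have h1 : ∀ y : ℝ, ∫⁻ ζ : ℝ, ENNReal.ofReal (r ^ 3 * ((ρ * y - σ) ^ 2 + (R ^ 2 - r ^ 2)) *
      (1 + ζ ^ 2) / (r ^ 2 * (1 + ζ ^ 2) + ((ρ * y - σ) ^ 2 + (R ^ 2 - r ^ 2)) * ζ ^ 2) ^ 2) *
        I (ρ * y - σ, √((ρ * y - σ) ^ 2 + (R ^ 2 - r ^ 2)) / r * ζ / √(1 + ζ ^ 2))
      = (fun z : ℝ => ∫⁻ η : ℝ, ENNReal.ofReal (chordDensity r (R ^ 2 - r ^ 2) (z, η)) * I (z, η))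
        (ρ * y - σ) := fun y =>
    (lintegral_chordDensity_mul hr hh (ρ * y - σ) (G := fun η => I (ρ * y - σ, η))).symm
  rw [lintegral_congr h1, lintegral_comp_mul_sub hρ σ (fun z : ℝ =>
    ∫⁻ η : ℝ, ENNReal.ofReal (chordDensity r (R ^ 2 - r ^ 2) (z, η)) * I (z, η)), ← mul_assoc,
    ← ENNReal.ofReal_mul (by positivity)]
  have hdm := measurable_chordDensity r (R ^ 2 - r ^ 2)
  rw [← lintegral_prod (fun p : ℝ × ℝ =>
    ENNReal.ofReal (chordDensity r (R ^ 2 - r ^ 2) p) * I p) (by fun_prop),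
    ← lintegral_indicator (measurableSet_truncatedRegion _ _ _)]
  congr 1
  · congr 1
    field_simp
  · refine lintegral_congr fun p => ?_
    by_cases hp : p ∈ truncatedRegion ρ σ (4 * r ^ 2 * ρ ^ 2 / ε ^ 2) <;> simp [hI, hp]

theorem integral_one_div_one_add_sq_sq :
    Integrable (fun x : ℝ => 1 / (1 + x ^ 2) ^ 2) ∧
      ∫ x : ℝ, 1 / (1 + x ^ 2) ^ 2 = Real.pi / 2 := by
  have hint : Integrable (fun x : ℝ => 1 / (1 + x ^ 2) ^ 2) := by
    refine integrable_inv_one_add_sq.mono' (Measurable.aestronglyMeasurable (by fun_prop))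
      (Eventually.of_forall fun x => ?_)
    have := one_add_sq_pos x
    rw [Real.norm_of_nonneg (by positivity), ← one_div]
    exact one_div_le_one_div_of_le this (by nlinarith [sq_nonneg x])
  refine ⟨hint, ?_⟩
  have hd : ∀ x : ℝ, HasDerivAt (fun x : ℝ => (x / (1 + x ^ 2) + Real.arctan x) / 2)
      (1 / (1 + x ^ 2) ^ 2) x := fun x => by
    have h0 := (one_add_sq_pos x).ne'
    have h1 : HasDerivAt (fun x : ℝ => 1 + x ^ 2) (2 * x) x := by
      simpa using (hasDerivAt_pow 2 x).const_add 1
    refine ((((hasDerivAt_id x).div h1 h0).add (Real.hasDerivAt_arctan x)).div_const 2).congr_deriv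
      ?_
    simp only [id]
    field_simp
    ring
  have hlim : ∀ l : Filter ℝ, Tendsto (fun x : ℝ => |x|) l atTop →
      Tendsto (fun x : ℝ => x / (1 + x ^ 2)) l (𝓝 0) := fun l hl => by
    refine squeeze_zero_norm (fun x => ?_) (tendsto_inv_atTop_zero.comp hl)
    rw [norm_div, Real.norm_eq_abs, Real.norm_of_nonneg (one_add_sq_pos x).le, Function.comp,
      ← one_div]
    rcases eq_or_ne x 0 with rfl | hx
    · simp
    · rw [div_le_div_iff₀ (one_add_sq_pos x) (abs_pos.2 hx), ← sq, sq_abs]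
      linarith
  have := integral_of_hasDerivAt_of_tendsto hd hint
    (((hlim _ tendsto_abs_atBot_atTop).add
      (tendsto_nhds_of_tendsto_nhdsWithin Real.tendsto_arctan_atBot)).div_const 2)
    (((hlim _ tendsto_abs_atTop_atTop).add
      (tendsto_nhds_of_tendsto_nhdsWithin Real.tendsto_arctan_atTop)).div_const 2)
  rw [this]
  ring

theorem integral_sq_div_one_add_sq_sq :
    Integrable (fun x : ℝ => x ^ 2 / (1 + x ^ 2) ^ 2) ∧
      ∫ x : ℝ, x ^ 2 / (1 + x ^ 2) ^ 2 = Real.pi / 2 := by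
  obtain ⟨h1, h2⟩ := integral_one_div_one_add_sq_sq
  have h3 : (fun x : ℝ => x ^ 2 / (1 + x ^ 2) ^ 2)
      = fun x => (1 + x ^ 2)⁻¹ - 1 / (1 + x ^ 2) ^ 2 := by
    funext x
    have := (one_add_sq_pos x).ne'
    field_simp
    ring
  rw [h3, integral_sub integrable_inv_one_add_sq h1, integral_univ_inv_one_add_sq, h2]
  exact ⟨integrable_inv_one_add_sq.sub h1, by ring⟩

/-- The integral of `chordDensity` over a line `z = const`, which is a circle of latitude. -/
theorem lintegral_chordDensity {r h : ℝ} (hr : 0 < r) (hh : 0 < h) (z : ℝ) :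
    ∫⁻ η : ℝ, ENNReal.ofReal (chordDensity r h (z, η))
      = ENNReal.ofReal (Real.pi / 2 *
        (√(z ^ 2 + (h + r ^ 2)) - r ^ 4 / √(z ^ 2 + (h + r ^ 2)) ^ 3)) := by
  have h1 := lintegral_chordDensity_mul hr hh z (G := fun _ => 1)
  simp only [mul_one] at h1
  rw [h1]
  have hB : 0 < z ^ 2 + h := by positivity
  obtain ⟨i1, j1⟩ := integral_one_div_one_add_sq_sq
  obtain ⟨i2, j2⟩ := integral_sq_div_one_add_sq_sq
  rw [← add_assoc]
  generalize z ^ 2 + h = B at hB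
  set κ := √(B + r ^ 2) with hκ
  have hκ0 : 0 < κ := by positivity
  have hκ2 : κ ^ 2 = B + r ^ 2 := Real.sq_sqrt (by positivity)
  have e1 : ∀ ζ : ℝ, r ^ 3 * B * (1 + ζ ^ 2) / (r ^ 2 * (1 + ζ ^ 2) + B * ζ ^ 2) ^ 2
      = (fun x : ℝ => B / r * (1 / (1 + x ^ 2) ^ 2) +
          B * r / κ ^ 2 * (x ^ 2 / (1 + x ^ 2) ^ 2)) (κ / r * ζ) := by
    intro ζ
    have e2 : r ^ 2 * (1 + ζ ^ 2) + B * ζ ^ 2 = r ^ 2 * (1 + (κ / r * ζ) ^ 2) := by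
      rw [mul_pow, div_pow, hκ2]
      field_simp
      ring
    have := one_add_sq_pos (κ / r * ζ)
    rw [e2]
    dsimp only
    have e5 : (κ / r * ζ) ^ 2 * (r ^ 2 / κ ^ 2) = ζ ^ 2 := by field_simp
    generalize hX : 1 + (κ / r * ζ) ^ 2 = X at *
    have e6 : (κ / r * ζ) ^ 2 = X - 1 := by linarith
    rw [← e5, e6]
    field_simp
  have hi : Integrable (fun x : ℝ => B / r * (1 / (1 + x ^ 2) ^ 2) +
      B * r / κ ^ 2 * (x ^ 2 / (1 + x ^ 2) ^ 2)) :=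
    (i1.const_mul (B / r)).add (i2.const_mul (B * r / κ ^ 2))
  have hk : κ / r ≠ 0 := by positivity
  rw [lintegral_congr fun ζ => by rw [e1 ζ], ← ofReal_integral_eq_lintegral_ofReal
    (hi.comp_mul_left' hk)
      (Eventually.of_forall fun ζ => by dsimp only [Pi.zero_apply]; positivity),
    Measure.integral_comp_mul_left (fun x : ℝ => B / r * (1 / (1 + x ^ 2) ^ 2) +
      B * r / κ ^ 2 * (x ^ 2 / (1 + x ^ 2) ^ 2)),
    integral_add (i1.const_mul _) (i2.const_mul _), integral_const_mul, integral_const_mul, j1, j2,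
    abs_of_pos (by positivity)]
  congr 1
  have hBκ : B = κ ^ 2 - r ^ 2 := by linarith
  rw [hBκ, smul_eq_mul]
  field_simp
  ring

/-! ### One-dimensional integrals -/

theorem add_sqrt_sq_add_pos {b : ℝ} (hb : 0 < b) (z : ℝ) : 0 < z + √(z ^ 2 + b) := by
  have h : |z| < √(z ^ 2 + b) := by
    rw [← Real.sqrt_sq_eq_abs]
    exact Real.sqrt_lt_sqrt (sq_nonneg z) (by linarith)
  linarith [neg_abs_le z]

theorem hasDerivAt_sqrt_sq_add {b : ℝ} (hb : 0 < b) (z : ℝ) :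
    HasDerivAt (fun z : ℝ => √(z ^ 2 + b)) (z / √(z ^ 2 + b)) z := by
  have h0 : z ^ 2 + b ≠ 0 := by positivity
  have h1 : HasDerivAt (fun z : ℝ => z ^ 2 + b) (2 * z) z := by
    simpa using (hasDerivAt_pow 2 z).add_const b
  exact (h1.sqrt h0).congr_deriv (mul_div_mul_left _ _ two_ne_zero)

theorem hasDerivAt_log_add_sqrt_sq_add {b : ℝ} (hb : 0 < b) (z : ℝ) :
    HasDerivAt (fun z : ℝ => Real.log (z + √(z ^ 2 + b))) (1 / √(z ^ 2 + b)) z := by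
  have h1 := ((hasDerivAt_id z).add (hasDerivAt_sqrt_sq_add hb z)).log
    (add_sqrt_sq_add_pos hb z).ne'
  refine h1.congr_deriv ?_
  have h2 := (add_sqrt_sq_add_pos hb z).ne'
  have h3 : √(z ^ 2 + b) ≠ 0 := by positivity
  simp only [Pi.add_apply, id]
  field_simp
  ring

theorem continuous_inv_sqrt_sq_add_pow {b : ℝ} (hb : 0 < b) (n : ℕ) :
    Continuous fun z : ℝ => 1 / √(z ^ 2 + b) ^ n := by
  have : ∀ z : ℝ, √(z ^ 2 + b) ^ n ≠ 0 := fun z => by positivity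
  fun_prop (disch := exact this)

theorem integral_inv_sqrt_sq_add {b : ℝ} (hb : 0 < b) (x y : ℝ) :
    ∫ z in x..y, 1 / √(z ^ 2 + b)
      = Real.log (y + √(y ^ 2 + b)) - Real.log (x + √(x ^ 2 + b)) := by
  refine intervalIntegral.integral_eq_sub_of_hasDerivAt
    (fun z _ => hasDerivAt_log_add_sqrt_sq_add hb z) ?_
  simpa using (continuous_inv_sqrt_sq_add_pow hb 1).intervalIntegrable x y

theorem integral_sqrt_sq_add {b : ℝ} (hb : 0 < b) (x y : ℝ) :
    ∫ z in x..y, √(z ^ 2 + b)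
      = (y * √(y ^ 2 + b) + b * Real.log (y + √(y ^ 2 + b))) / 2 -
        (x * √(x ^ 2 + b) + b * Real.log (x + √(x ^ 2 + b))) / 2 := by
  refine intervalIntegral.integral_eq_sub_of_hasDerivAt (f := fun z : ℝ =>
    (z * √(z ^ 2 + b) + b * Real.log (z + √(z ^ 2 + b))) / 2) (fun z _ => ?_) ?_
  · refine ((((hasDerivAt_id z).mul (hasDerivAt_sqrt_sq_add hb z)).add
      ((hasDerivAt_log_add_sqrt_sq_add hb z).const_mul b)).div_const 2).congr_deriv ?_
    have h3 : √(z ^ 2 + b) ≠ 0 := by positivity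
    have h4 : √(z ^ 2 + b) ^ 2 = z ^ 2 + b := Real.sq_sqrt (by positivity)
    simp only [id]
    field_simp
    rw [h4]
    ring
  · exact Continuous.intervalIntegrable (by fun_prop) x y

theorem integral_inv_sqrt_sq_add_cube {b : ℝ} (hb : 0 < b) (x y : ℝ) :
    ∫ z in x..y, 1 / √(z ^ 2 + b) ^ 3
      = y / √(y ^ 2 + b) / b - x / √(x ^ 2 + b) / b := by
  refine intervalIntegral.integral_eq_sub_of_hasDerivAt (f := fun z : ℝ =>
    z / √(z ^ 2 + b) / b) (fun z _ => ?_)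
    ((continuous_inv_sqrt_sq_add_pow hb 3).intervalIntegrable x y)
  have h3 : √(z ^ 2 + b) ≠ 0 := by positivity
  have h4 : √(z ^ 2 + b) ^ 2 = z ^ 2 + b := Real.sq_sqrt (by positivity)
  refine (((hasDerivAt_id z).div (hasDerivAt_sqrt_sq_add hb z) h3).div_const b).congr_deriv ?_
  simp only [id]
  field_simp
  rw [h4]
  ring

theorem tendsto_add_const_div_self (s : ℝ) : Tendsto (fun Z : ℝ => (Z + s) / Z) atTop (𝓝 1) := by
  have h : Tendsto (fun Z : ℝ => 1 + s * Z⁻¹) atTop (𝓝 (1 + s * 0)) :=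
    (tendsto_inv_atTop_zero.const_mul s).const_add 1
  rw [mul_zero, add_zero] at h
  refine h.congr' ?_
  filter_upwards [eventually_gt_atTop 0] with Z hZ
  field_simp

theorem tendsto_sqrt_sq_add_div_self (s b : ℝ) :
    Tendsto (fun Z : ℝ => √((Z + s) ^ 2 + b) / Z) atTop (𝓝 1) := by
  have h : Tendsto (fun Z : ℝ => √(((Z + s) / Z) ^ 2 + b * (Z⁻¹) ^ 2)) atTop
      (𝓝 √(1 ^ 2 + b * 0 ^ 2)) :=
    (((tendsto_add_const_div_self s).pow 2).add
      ((tendsto_inv_atTop_zero.pow 2).const_mul b)).sqrt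
  rw [one_pow, zero_pow two_ne_zero, mul_zero, add_zero, Real.sqrt_one] at h
  refine h.congr' ?_
  filter_upwards [eventually_gt_atTop 0] with Z hZ
  have : ((Z + s) / Z) ^ 2 + b * (Z⁻¹) ^ 2 = ((Z + s) ^ 2 + b) / Z ^ 2 := by field_simp
  rw [this, Real.sqrt_div' _ (sq_nonneg Z), Real.sqrt_sq hZ.le]

theorem tendsto_add_sqrt_sq_add_div_self (s b : ℝ) :
    Tendsto (fun Z : ℝ => ((Z + s) + √((Z + s) ^ 2 + b)) / Z) atTop (𝓝 2) := by
  have h := (tendsto_add_const_div_self s).add (tendsto_sqrt_sq_add_div_self s b)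
  rw [one_add_one_eq_two] at h
  exact h.congr fun Z => (add_div _ _ _).symm

theorem log_neg_add_sqrt_sq_add {b : ℝ} (hb : 0 < b) (z : ℝ) :
    Real.log (-z + √((-z) ^ 2 + b)) = Real.log b - Real.log (z + √(z ^ 2 + b)) := by
  have h1 := add_sqrt_sq_add_pos hb z
  have h2 : √(z ^ 2 + b) ^ 2 = z ^ 2 + b := Real.sq_sqrt (by positivity)
  rw [← Real.log_div hb.ne' h1.ne', neg_sq]
  congr 1
  field_simp
  linear_combination h2

theorem tendsto_integral_inv_sqrt_sq_add {b : ℝ} (hb : 0 < b) (σ ρ : ℝ) :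
    Tendsto (fun Z : ℝ => (∫ z in (-σ - Z)..(-σ + Z), 1 / √(z ^ 2 + b)) -
      Real.log (ρ ^ 2 + Z ^ 2)) atTop (𝓝 (2 * Real.log 2 - Real.log b)) := by
  have h1 : Tendsto (fun Z : ℝ => (ρ ^ 2 + Z ^ 2) / Z ^ 2) atTop (𝓝 1) := by
    have : Tendsto (fun Z : ℝ => ρ ^ 2 * (Z⁻¹) ^ 2 + 1) atTop (𝓝 (ρ ^ 2 * 0 ^ 2 + 1)) :=
      ((tendsto_inv_atTop_zero.pow 2).const_mul _).add_const 1
    rw [zero_pow two_ne_zero, mul_zero, zero_add] at this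
    refine this.congr' ?_
    filter_upwards [eventually_gt_atTop 0] with Z hZ
    field_simp
  have h2 := (((tendsto_add_sqrt_sq_add_div_self (-σ) b).mul
    (tendsto_add_sqrt_sq_add_div_self σ b)).div h1 one_ne_zero).log (by norm_num)
  have h3 := h2.sub_const (Real.log b)
  rw [show (2 : ℝ) * 2 / 1 = 2 ^ 2 by norm_num, Real.log_pow, Nat.cast_ofNat] at h3
  refine h3.congr' ?_
  filter_upwards [eventually_gt_atTop 0] with Z hZ
  have e1 := add_sqrt_sq_add_pos hb (Z + -σ)
  have e2 := add_sqrt_sq_add_pos hb (Z + σ)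
  have e3 : 0 < ρ ^ 2 + Z ^ 2 := by positivity
  rw [integral_inv_sqrt_sq_add hb, show -σ - Z = -(Z + σ) by ring, log_neg_add_sqrt_sq_add hb,
    show -σ + Z = Z + -σ by ring, Pi.div_apply]
  rw [show (Z + -σ + √((Z + -σ) ^ 2 + b)) / Z * ((Z + σ + √((Z + σ) ^ 2 + b)) / Z) /
      ((ρ ^ 2 + Z ^ 2) / Z ^ 2)
      = (Z + -σ + √((Z + -σ) ^ 2 + b)) * (Z + σ + √((Z + σ) ^ 2 + b)) / (ρ ^ 2 + Z ^ 2) by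
    field_simp, Real.log_div (by positivity) e3.ne', Real.log_mul e1.ne' e2.ne']
  ring

theorem tendsto_integral_sqrt_sq_add {b : ℝ} (hb : 0 < b) (σ ρ : ℝ) :
    Tendsto (fun Z : ℝ => (∫ z in (-σ - Z)..(-σ + Z), √(z ^ 2 + b)) - Z ^ 2 -
      b / 2 * Real.log (ρ ^ 2 + Z ^ 2)) atTop
      (𝓝 (σ ^ 2 + b / 2 + b / 2 * (2 * Real.log 2 - Real.log b))) := by
  have h0 : ∀ s : ℝ, Tendsto (fun Z : ℝ => (Z + s) * √((Z + s) ^ 2 + b) - (Z + s) ^ 2) atTop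
      (𝓝 (b / 2)) := fun s => by
    have := ((tendsto_add_const_div_self s).div (tendsto_add_sqrt_sq_add_div_self s b)
      two_ne_zero).const_mul b
    rw [mul_one_div] at this
    refine this.congr' ?_
    filter_upwards [eventually_gt_atTop 0] with Z hZ
    have e1 := add_sqrt_sq_add_pos hb (Z + s)
    have h2 : √((Z + s) ^ 2 + b) ^ 2 = (Z + s) ^ 2 + b := Real.sq_sqrt (by positivity)
    rw [Pi.div_apply]
    field_simp
    linear_combination (-(Z + s)) * h2
  have h1 := (((h0 (-σ)).add (h0 σ)).div_const 2).add_const (σ ^ 2)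
  have h2 := h1.add ((tendsto_integral_inv_sqrt_sq_add hb σ ρ).const_mul (b / 2))
  rw [show (b / 2 + b / 2) / 2 + σ ^ 2 = σ ^ 2 + b / 2 by ring] at h2
  refine h2.congr fun Z => ?_
  rw [integral_inv_sqrt_sq_add hb, integral_sqrt_sq_add hb, show -σ + Z = Z + -σ by ring,
    show -σ - Z = -(Z + σ) by ring, neg_sq]
  ring

theorem tendsto_integral_inv_sqrt_sq_add_cube {b : ℝ} (hb : 0 < b) (σ : ℝ) :
    Tendsto (fun Z : ℝ => ∫ z in (-σ - Z)..(-σ + Z), 1 / √(z ^ 2 + b) ^ 3) atTop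
      (𝓝 (2 / b)) := by
  have h0 : ∀ s : ℝ, Tendsto (fun Z : ℝ => (Z + s) / √((Z + s) ^ 2 + b) / b) atTop
      (𝓝 (1 / b)) := fun s => by
    have := ((tendsto_add_const_div_self s).div (tendsto_sqrt_sq_add_div_self s b)
      one_ne_zero).div_const b
    rw [div_one] at this
    refine this.congr' ?_
    filter_upwards [eventually_gt_atTop 0] with Z hZ
    rw [Pi.div_apply, div_div_div_cancel_right₀ hZ.ne']
  have h1 := (h0 (-σ)).add (h0 σ)
  rw [← add_div, one_add_one_eq_two] at h1
  refine h1.congr fun Z => ?_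
  rw [integral_inv_sqrt_sq_add_cube hb, show -σ + Z = Z + -σ by ring,
    show -σ - Z = -(Z + σ) by ring, neg_sq]
  ring

/-- By the substitution `x = tan θ` this is the integral of `log (cos θ)`. -/
theorem integral_log_one_add_sq_div_one_add_sq :
    Integrable (fun x : ℝ => Real.log (1 + x ^ 2) / (1 + x ^ 2)) ∧
      ∫ x : ℝ, Real.log (1 + x ^ 2) / (1 + x ^ 2) = 2 * Real.pi * Real.log 2 := by
  have hd : ∀ θ ∈ Set.Ioo (-(Real.pi / 2)) (Real.pi / 2),
      HasDerivWithinAt Real.tan (1 / Real.cos θ ^ 2) (Set.Ioo (-(Real.pi / 2)) (Real.pi / 2)) θ :=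
    fun θ hθ => (Real.hasDerivAt_tan (Real.cos_pos_of_mem_Ioo hθ).ne').hasDerivWithinAt
  have himg := Real.image_tan_Ioo
  have heq : ∀ θ ∈ Set.Ioo (-(Real.pi / 2)) (Real.pi / 2),
      |1 / Real.cos θ ^ 2| • (Real.log (1 + Real.tan θ ^ 2) / (1 + Real.tan θ ^ 2))
        = -2 * Real.log (Real.cos θ) := by
    intro θ hθ
    have hc := Real.cos_pos_of_mem_Ioo hθ
    have h1 : 1 + Real.tan θ ^ 2 = (Real.cos θ ^ 2)⁻¹ := by
      rw [← Real.inv_one_add_tan_sq hc.ne', inv_inv]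
    rw [h1, abs_of_pos (by positivity), Real.log_inv, Real.log_pow, smul_eq_mul]
    push_cast
    field_simp
  have hle : -(Real.pi / 2) ≤ Real.pi / 2 := by linarith [Real.pi_pos]
  have hint : IntegrableOn (fun θ => -2 * Real.log (Real.cos θ))
      (Set.Ioo (-(Real.pi / 2)) (Real.pi / 2)) := by
    have := (intervalIntegrable_log_cos (a := -(Real.pi / 2)) (b := Real.pi / 2)).const_mul (-2)
    exact ((intervalIntegrable_iff_integrableOn_Ioo_of_le hle).1 this)
  constructor
  · rw [← integrableOn_univ, ← himg,
      integrableOn_image_iff_integrableOn_abs_deriv_smul measurableSet_Ioo hd Real.injOn_tan]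
    exact hint.congr_fun (fun θ hθ => (heq θ hθ).symm) measurableSet_Ioo
  · rw [← setIntegral_univ, ← himg,
      integral_image_eq_integral_abs_deriv_smul measurableSet_Ioo hd Real.injOn_tan,
      setIntegral_congr_fun measurableSet_Ioo heq, ← integral_Ioc_eq_integral_Ioo,
      ← intervalIntegral.integral_of_le hle, intervalIntegral.integral_const_mul]
    have h2 : ∀ θ : ℝ, Real.log (Real.cos θ) = Real.log (Real.sin (Real.pi / 2 - θ)) := fun θ => by
      rw [Real.sin_pi_div_two_sub]
    simp only [h2]
    rw [intervalIntegral.integral_comp_sub_left (fun θ => Real.log (Real.sin θ))]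
    rw [sub_self, sub_neg_eq_add, add_halves, integral_log_sin_zero_pi]
    ring

/-- Obtained from `integral_log_one_add_sq_div_one_add_sq` by integrating the derivative of
`x * log (1 + x ^ 2) / (1 + x ^ 2)`. -/
theorem integral_log_one_add_sq_div_one_add_sq_sq :
    Integrable (fun x : ℝ => Real.log (1 + x ^ 2) / (1 + x ^ 2) ^ 2) ∧
      ∫ x : ℝ, Real.log (1 + x ^ 2) / (1 + x ^ 2) ^ 2
        = Real.pi * Real.log 2 - Real.pi / 2 := by
  obtain ⟨i0, j0⟩ := integral_log_one_add_sq_div_one_add_sq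
  obtain ⟨i2, j2⟩ := integral_sq_div_one_add_sq_sq
  have i1 : Integrable (fun x : ℝ => Real.log (1 + x ^ 2) / (1 + x ^ 2) ^ 2) := by
    refine i0.mono' (Measurable.aestronglyMeasurable (by fun_prop))
      (Eventually.of_forall fun x => ?_)
    have h0 := one_add_sq_pos x
    have h1 : 0 ≤ Real.log (1 + x ^ 2) := Real.log_nonneg (by nlinarith)
    rw [Real.norm_of_nonneg (by positivity)]
    exact div_le_div_of_nonneg_left h1 h0 (by nlinarith [sq_nonneg x])
  refine ⟨i1, ?_⟩
  have hd : ∀ x : ℝ, HasDerivAt (fun x : ℝ => x * Real.log (1 + x ^ 2) / (1 + x ^ 2))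
      (2 * (Real.log (1 + x ^ 2) / (1 + x ^ 2) ^ 2) - Real.log (1 + x ^ 2) / (1 + x ^ 2) +
        2 * (x ^ 2 / (1 + x ^ 2) ^ 2)) x := fun x => by
    have h0 := (one_add_sq_pos x).ne'
    have h1 : HasDerivAt (fun x : ℝ => 1 + x ^ 2) (2 * x) x := by
      simpa using (hasDerivAt_pow 2 x).const_add 1
    refine (((hasDerivAt_id x).mul (h1.log h0)).div h1 h0).congr_deriv ?_
    simp only [id, Pi.mul_apply]
    field_simp
    ring
  have hlim : ∀ l : Filter ℝ, Tendsto (fun x : ℝ => |x|) l atTop →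
      Tendsto (fun x : ℝ => x * Real.log (1 + x ^ 2) / (1 + x ^ 2)) l (𝓝 0) := fun l hl => by
    have h1 : Tendsto (fun x : ℝ => 1 + x ^ 2) l atTop :=
      tendsto_atTop_add_const_left _ _
        (((tendsto_pow_atTop two_ne_zero).comp hl).congr fun x => sq_abs x)
    have h2 := ((isLittleO_log_rpow_atTop (r := 1 / 2) (by norm_num)).tendsto_div_nhds_zero).comp h1
    refine squeeze_zero_norm (fun x => ?_) h2
    have h0 := one_add_sq_pos x
    have h1 : 0 ≤ Real.log (1 + x ^ 2) := Real.log_nonneg (by nlinarith)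
    have h3 : |x| ≤ √(1 + x ^ 2) := Real.abs_le_sqrt (by linarith)
    have h4 : √(1 + x ^ 2) ^ 2 = 1 + x ^ 2 := Real.sq_sqrt h0.le
    have h5 : 0 < √(1 + x ^ 2) := Real.sqrt_pos.2 h0
    rw [Function.comp, ← Real.sqrt_eq_rpow, norm_div, norm_mul, Real.norm_of_nonneg h1,
      Real.norm_of_nonneg h0.le, Real.norm_eq_abs, div_le_div_iff₀ h0 h5]
    calc |x| * Real.log (1 + x ^ 2) * √(1 + x ^ 2)
        ≤ √(1 + x ^ 2) * Real.log (1 + x ^ 2) * √(1 + x ^ 2) := by gcongr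
      _ = Real.log (1 + x ^ 2) * √(1 + x ^ 2) ^ 2 := by ring
      _ = Real.log (1 + x ^ 2) * (1 + x ^ 2) := by rw [h4]
  have i3 : Integrable (fun x : ℝ => 2 * (Real.log (1 + x ^ 2) / (1 + x ^ 2) ^ 2) -
      Real.log (1 + x ^ 2) / (1 + x ^ 2)) := (i1.const_mul 2).sub i0
  have h := integral_of_hasDerivAt_of_tendsto hd (i3.add (i2.const_mul 2))
    (hlim _ tendsto_abs_atBot_atTop) (hlim _ tendsto_abs_atTop_atTop)
  rw [integral_add i3 (i2.const_mul 2), integral_sub (i1.const_mul 2) i0, integral_const_mul,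
    integral_const_mul, j0, j2] at h
  linarith

/-! ### Comparison with a model density -/

/-- The leading terms of `chordDensity` for large `z`, from the expansion of the root in
`r ^ 2 * η ^ 2 / (z ^ 2 + h)`. -/
noncomputable def chordModel (r h : ℝ) (p : ℝ × ℝ) : ℝ :=
  (√(p.1 ^ 2 + h) + r ^ 2 * p.2 ^ 2 / (2 * √(p.1 ^ 2 + h))) / (1 + p.2 ^ 2) ^ 2

theorem chordModel_nonneg (r h : ℝ) (p : ℝ × ℝ) : 0 ≤ chordModel r h p := by
  unfold chordModel
  positivity

theorem measurable_chordModel (r h : ℝ) : Measurable (chordModel r h) := by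
  unfold chordModel
  fun_prop

theorem chordModel_le_chordDensity {r h : ℝ} (hh : 0 < h) {p : ℝ × ℝ}
    (hp : r ^ 2 * p.2 ^ 2 < p.1 ^ 2 + h) : chordModel r h p ≤ chordDensity r h p := by
  obtain ⟨z, η⟩ := p
  unfold chordModel chordDensity
  dsimp only at hp ⊢
  have h0 := one_add_sq_pos η
  have hB : 0 < z ^ 2 + h := by positivity
  generalize z ^ 2 + h = B at hB hp
  have hM : 0 < B - r ^ 2 * η ^ 2 := by linarith
  have hs := Real.sq_sqrt hB.le
  have ht := Real.sq_sqrt hM.le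
  have hs0 := Real.sqrt_pos.2 hB
  have ht0 := Real.sqrt_pos.2 hM
  set s := √B
  set t := √(B - r ^ 2 * η ^ 2)
  rw [show r ^ 2 * η ^ 2 = s ^ 2 - t ^ 2 by linarith, ← hs,
    show s ^ 2 / ((1 + η ^ 2) ^ 2 * t) = s ^ 2 / t / (1 + η ^ 2) ^ 2 by rw [div_div, mul_comm]]
  refine div_le_div_of_nonneg_right (c := (1 + η ^ 2) ^ 2) ?_ (by positivity)
  have h1 : s + (s ^ 2 - t ^ 2) / (2 * s) = (3 * s ^ 2 - t ^ 2) / (2 * s) := by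
    field_simp
    ring
  have h2 : 0 ≤ 2 * s + t := by linarith
  rw [h1, div_le_div_iff₀ (by positivity) ht0]
  nlinarith [mul_nonneg (sq_nonneg (s - t)) h2]

theorem lintegral_chordModel (r h z : ℝ) :
    ∫⁻ η : ℝ, ENNReal.ofReal (chordModel r h (z, η))
      = ENNReal.ofReal (Real.pi / 2 * (√(z ^ 2 + h) + r ^ 2 / (2 * √(z ^ 2 + h)))) := by
  obtain ⟨i1, j1⟩ := integral_one_div_one_add_sq_sq
  obtain ⟨i2, j2⟩ := integral_sq_div_one_add_sq_sq
  have e : ∀ η : ℝ, chordModel r h (z, η) = √(z ^ 2 + h) * (1 / (1 + η ^ 2) ^ 2) +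
      r ^ 2 / (2 * √(z ^ 2 + h)) * (η ^ 2 / (1 + η ^ 2) ^ 2) := fun η => by
    unfold chordModel
    ring
  have hi := (i1.const_mul √(z ^ 2 + h)).add (i2.const_mul (r ^ 2 / (2 * √(z ^ 2 + h))))
  have hI : ∫ η : ℝ, chordModel r h (z, η)
      = Real.pi / 2 * (√(z ^ 2 + h) + r ^ 2 / (2 * √(z ^ 2 + h))) := by
    simp only [e]
    rw [integral_add (i1.const_mul _) (i2.const_mul _), integral_const_mul, integral_const_mul, j1,
      j2]
    ring
  rw [← hI, ofReal_integral_eq_lintegral_ofReal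
    (hi.congr (Eventually.of_forall fun η => (e η).symm))
    (Eventually.of_forall fun η => chordModel_nonneg _ _ _)]

theorem lintegral_chordDensity_le_lintegral_chordModel {r h : ℝ} (hr : 0 < r) (hh : 0 < h) (z : ℝ) :
    ∫⁻ η : ℝ, ENNReal.ofReal (chordDensity r h (z, η))
      ≤ ∫⁻ η : ℝ, ENNReal.ofReal (chordModel r h (z, η)) := by
  rw [lintegral_chordDensity hr hh, lintegral_chordModel]
  refine ENNReal.ofReal_le_ofReal (mul_le_mul_of_nonneg_left ?_ (by positivity))
  rw [← add_assoc]
  have hB : 0 < z ^ 2 + h := by positivity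
  generalize z ^ 2 + h = B at hB
  have h1 : √(B + r ^ 2) ≤ √B + r ^ 2 / (2 * √B) := by
    refine Real.sqrt_le_iff.2 ⟨by positivity, ?_⟩
    have h2 := Real.sq_sqrt hB.le
    have h3 := Real.sqrt_pos.2 hB
    have : (√B + r ^ 2 / (2 * √B)) ^ 2 = √B ^ 2 + r ^ 2 + (r ^ 2 / (2 * √B)) ^ 2 := by
      field_simp
      ring
    nlinarith [sq_nonneg (r ^ 2 / (2 * √B))]
  have h2 : 0 ≤ r ^ 4 / √(B + r ^ 2) ^ 3 := by positivity
  linarith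

/-- The points of the `(z, η)`-plane that do not correspond to points of the torus. -/
def chordExterior (r h : ℝ) : Set (ℝ × ℝ) := {p | p.1 ^ 2 + h ≤ r ^ 2 * p.2 ^ 2}

theorem measurableSet_chordExterior (r h : ℝ) : MeasurableSet (chordExterior r h) :=
  measurableSet_le (by fun_prop) (by fun_prop)

theorem integrable_one_add_sq_rpow : Integrable fun x : ℝ => (1 + x ^ 2) ^ (-(3 / 4) : ℝ) := by
  have h := integrable_rpow_neg_one_add_norm_sq (E := ℝ) (μ := volume) (r := 3 / 2) (by norm_num)
  refine h.congr (Eventually.of_forall fun x => ?_)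
  simp only [Real.norm_eq_abs, sq_abs]
  norm_num

theorem chordModel_le_of_mem_chordExterior {r h : ℝ} (hr : 0 < r) (hh : 0 < h) {p : ℝ × ℝ}
    (hp : p ∈ chordExterior r h) :
    chordModel r h p ≤ 3 / 2 * r ^ 2 * (r ^ 2) ^ (1 / 4 : ℝ) * (min 1 h) ^ (-(3 / 4) : ℝ) *
      ((1 + p.1 ^ 2) ^ (-(3 / 4) : ℝ) * (1 + p.2 ^ 2) ^ (-(3 / 4) : ℝ)) := by
  obtain ⟨z, η⟩ := p
  change z ^ 2 + h ≤ r ^ 2 * η ^ 2 at hp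
  have hY := one_add_sq_pos η
  have hB : 0 < z ^ 2 + h := by positivity
  have hm : 0 < min 1 h := lt_min one_pos hh
  have hBm : min 1 h * (1 + z ^ 2) ≤ z ^ 2 + h := by
    nlinarith [min_le_left 1 h, min_le_right 1 h, sq_nonneg z]
  have hB' : (z ^ 2 + h) ^ (-(3 / 4) : ℝ)
      ≤ (min 1 h) ^ (-(3 / 4) : ℝ) * (1 + z ^ 2) ^ (-(3 / 4) : ℝ) := by
    rw [← Real.mul_rpow hm.le (one_add_sq_pos z).le]
    exact Real.rpow_le_rpow_of_nonpos (by positivity) hBm (by norm_num)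
  unfold chordModel
  dsimp only
  generalize z ^ 2 + h = B at hp hB hB'
  have hs := Real.sqrt_pos.2 hB
  have hs2 := Real.sq_sqrt hB.le
  have hMY : r ^ 2 * η ^ 2 ≤ r ^ 2 * (1 + η ^ 2) := by nlinarith [sq_nonneg r]
  have e1 : √B + r ^ 2 * η ^ 2 / (2 * √B) ≤ 3 / 2 * (r ^ 2 * (1 + η ^ 2)) / √B := by
    rw [← sub_nonneg]
    have : 3 / 2 * (r ^ 2 * (1 + η ^ 2)) / √B - (√B + r ^ 2 * η ^ 2 / (2 * √B))
        = (3 * (r ^ 2 * (1 + η ^ 2)) - 2 * √B ^ 2 - r ^ 2 * η ^ 2) / (2 * √B) := by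
      field_simp
      ring
    rw [this, hs2]
    exact div_nonneg (by linarith) (by positivity)
  -- `B ≤ r ^ 2 * (1 + η ^ 2)` shifts a quarter of the decay in `η` to `z`
  have e2 : 1 / √B ≤ B ^ (-(3 / 4) : ℝ) * ((r ^ 2) ^ (1 / 4 : ℝ) * (1 + η ^ 2) ^ (1 / 4 : ℝ)) := by
    rw [← Real.mul_rpow (by positivity) hY.le]
    calc 1 / √B = B ^ (-(3 / 4) : ℝ) * B ^ (1 / 4 : ℝ) := by
          rw [← Real.rpow_add hB, Real.sqrt_eq_rpow, one_div, ← Real.rpow_neg hB.le]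
          norm_num
      _ ≤ _ := by
          gcongr
          linarith
  have e3 : (1 + η ^ 2) ^ (1 / 4 : ℝ) / (1 + η ^ 2) = (1 + η ^ 2) ^ (-(3 / 4) : ℝ) := by
    nth_rewrite 2 [← Real.rpow_one (1 + η ^ 2)]
    rw [← Real.rpow_sub hY]
    norm_num
  calc (√B + r ^ 2 * η ^ 2 / (2 * √B)) / (1 + η ^ 2) ^ 2
      ≤ (3 / 2 * (r ^ 2 * (1 + η ^ 2)) / √B) / (1 + η ^ 2) ^ 2 := by gcongr
    _ = 3 / 2 * r ^ 2 * (1 / √B) / (1 + η ^ 2) := by field_simp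
    _ ≤ 3 / 2 * r ^ 2 * ((min 1 h) ^ (-(3 / 4) : ℝ) * (1 + z ^ 2) ^ (-(3 / 4) : ℝ) *
        ((r ^ 2) ^ (1 / 4 : ℝ) * (1 + η ^ 2) ^ (1 / 4 : ℝ))) / (1 + η ^ 2) := by
        gcongr
        exact e2.trans (by gcongr)
    _ = _ := by
        rw [← e3]
        ring

theorem lintegral_chordModel_chordExterior_lt_top {r h : ℝ} (hr : 0 < r) (hh : 0 < h) :
    ∫⁻ p, (chordExterior r h).indicator (fun p => ENNReal.ofReal (chordModel r h p)) p < ⊤ := by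
  have hi := (integrable_one_add_sq_rpow.mul_prod integrable_one_add_sq_rpow).const_mul
    (3 / 2 * r ^ 2 * (r ^ 2) ^ (1 / 4 : ℝ) * (min 1 h) ^ (-(3 / 4) : ℝ))
  refine lt_of_le_of_lt (lintegral_mono fun p => ?_) hi.lintegral_lt_top
  by_cases hp : p ∈ chordExterior r h
  · rw [Set.indicator_of_mem hp]
    exact ENNReal.ofReal_le_ofReal (chordModel_le_of_mem_chordExterior hr hh hp)
  · rw [Set.indicator_of_notMem hp]
    exact zero_le

/-- The model approximates the density with an integrable error. On the torus it is a lower bound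
for the density, while its integral over each line `z = const` is an upper bound for that of the
density, so the error is controlled by the model on the exterior. -/
theorem integrable_chordDensity_sub_chordModel {r h : ℝ} (hr : 0 < r) (hh : 0 < h) :
    Integrable fun p => chordDensity r h p - chordModel r h p := by
  have hfm := measurable_chordDensity r h
  have hmm := measurable_chordModel r h
  have hE := measurableSet_chordExterior r h
  set E := chordExterior r h with hEdef
  set g₁ : ℝ × ℝ → ENNReal :=
    Eᶜ.indicator fun p => ENNReal.ofReal (chordDensity r h p - chordModel r h p) with hg₁
  set g₂ : ℝ × ℝ → ENNReal := E.indicator fun p => ENNReal.ofReal (chordModel r h p) with hg₂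
  set g₃ : ℝ × ℝ → ENNReal := Eᶜ.indicator fun p => ENNReal.ofReal (chordModel r h p) with hg₃
  have hg₁m : Measurable g₁ := Measurable.indicator (by fun_prop) hE.compl
  have hg₂m : Measurable g₂ := Measurable.indicator (by fun_prop) hE
  have hg₃m : Measurable g₃ := Measurable.indicator (by fun_prop) hE.compl
  have hout : ∀ p ∈ E, chordDensity r h p = 0 := fun p hp => chordDensity_of_le hp
  have hin : ∀ p ∉ E, chordModel r h p ≤ chordDensity r h p := fun p hp =>
    chordModel_le_chordDensity hh (not_le.1 hp)
  have h13 : ∀ p, g₁ p + g₃ p = ENNReal.ofReal (chordDensity r h p) := fun p => by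
    by_cases hp : p ∈ E
    · have hp' : p ∉ Eᶜ := fun h => h hp
      rw [hg₁, hg₃, Set.indicator_of_notMem hp', Set.indicator_of_notMem hp', hout p hp,
        ENNReal.ofReal_zero, add_zero]
    · have hp' : p ∈ Eᶜ := hp
      rw [hg₁, hg₃, Set.indicator_of_mem hp', Set.indicator_of_mem hp',
        ← ENNReal.ofReal_add (sub_nonneg.2 (hin p hp)) (chordModel_nonneg _ _ _), sub_add_cancel]
  have h23 : ∀ p, g₂ p + g₃ p = ENNReal.ofReal (chordModel r h p) := fun p => by
    exact congrFun (Set.indicator_self_add_compl E fun p => ENNReal.ofReal (chordModel r h p)) p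
  have hline : ∀ z : ℝ, ∫⁻ η : ℝ, g₁ (z, η) ≤ ∫⁻ η : ℝ, g₂ (z, η) := fun z => by
    have h1 := lintegral_chordDensity_le_lintegral_chordModel hr hh z
    have hfin : ∫⁻ η : ℝ, g₃ (z, η) ≠ ⊤ := by
      refine ne_top_of_le_ne_top ?_ (lintegral_mono fun η => (h23 (z, η)).le.trans' le_add_self)
      rw [lintegral_chordModel]
      exact ENNReal.ofReal_ne_top
    simp only [← h13, ← h23] at h1
    rw [lintegral_add_left (by fun_prop), lintegral_add_left (by fun_prop)] at h1
    exact ENNReal.le_of_add_le_add_right hfin h1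
  have hplane : ∫⁻ p, g₁ p ≤ ∫⁻ p, g₂ p := by
    rw [Measure.volume_eq_prod, lintegral_prod _ hg₁m.aemeasurable,
      lintegral_prod _ hg₂m.aemeasurable]
    exact lintegral_mono hline
  have htop := lintegral_chordModel_chordExterior_lt_top hr hh
  refine ⟨(hfm.sub hmm).aestronglyMeasurable, ?_⟩
  rw [hasFiniteIntegral_iff_norm]
  refine lt_of_le_of_lt (b := ∫⁻ p, (g₁ p + g₂ p)) (lintegral_mono fun p => ?_) ?_
  · by_cases hp : p ∈ E
    · rw [hout p hp, zero_sub, norm_neg, Real.norm_of_nonneg (chordModel_nonneg _ _ _), hg₂,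
        Set.indicator_of_mem hp]
      exact le_add_self
    · have hp' : p ∈ Eᶜ := hp
      rw [Real.norm_of_nonneg (sub_nonneg.2 (hin p hp)), hg₁, Set.indicator_of_mem hp']
      exact le_self_add
  · rw [lintegral_add_left hg₁m]
    exact ENNReal.add_lt_top.2 ⟨hplane.trans_lt htop, htop⟩

/-! ### Integration over the strip -/

/-- The strip of lines `z = const` that lie in `truncatedRegion`. -/
def truncatedStrip (ρ σ N : ℝ) : Set (ℝ × ℝ) := {p | (p.1 + σ) ^ 2 + ρ ^ 2 ≤ N}

theorem measurableSet_truncatedStrip (ρ σ N : ℝ) : MeasurableSet (truncatedStrip ρ σ N) :=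
  measurableSet_le (by fun_prop) (by fun_prop)

theorem truncatedStrip_subset {ρ σ N : ℝ} (hN : 0 ≤ N) :
    truncatedStrip ρ σ N ⊆ truncatedRegion ρ σ N := fun p hp =>
  le_trans (show (p.1 + σ) ^ 2 + ρ ^ 2 ≤ N from hp) (by nlinarith [mul_nonneg hN (sq_nonneg p.2)])

theorem setOf_add_sq_add_sq_le {ρ σ t : ℝ} (ht : ρ ^ 2 ≤ t) :
    {z : ℝ | (z + σ) ^ 2 + ρ ^ 2 ≤ t} = Set.Icc (-σ - √(t - ρ ^ 2)) (-σ + √(t - ρ ^ 2)) := by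
  ext z
  rw [Set.mem_ofPred_eq, ← le_sub_iff_add_le, Real.sq_le (by linarith), Set.mem_Icc]
  constructor <;> rintro ⟨h1, h2⟩ <;> constructor <;> linarith

theorem integral_Icc_symm (σ : ℝ) {Z : ℝ} (hZ : 0 ≤ Z) (f : ℝ → ℝ) :
    ∫ z in Set.Icc (-σ - Z) (-σ + Z), f z = ∫ z in (-σ - Z)..(-σ + Z), f z := by
  rw [integral_Icc_eq_integral_Ioc, intervalIntegral.integral_of_le (by linarith)]

/-- The integral of the density over a strip is computed by integrating over the lines
`z = const` first. -/
theorem integral_chordDensity_truncatedStrip {r h ρ σ N : ℝ} (hr : 0 < r) (hh : 0 < h)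
    (hN : ρ ^ 2 ≤ N) :
    IntegrableOn (chordDensity r h) (truncatedStrip ρ σ N) ∧
    ∫ p in truncatedStrip ρ σ N, chordDensity r h p
      = Real.pi / 2 * ((∫ z in (-σ - √(N - ρ ^ 2))..(-σ + √(N - ρ ^ 2)), √(z ^ 2 + (h + r ^ 2))) -
        r ^ 4 * ∫ z in (-σ - √(N - ρ ^ 2))..(-σ + √(N - ρ ^ 2)),
          1 / √(z ^ 2 + (h + r ^ 2)) ^ 3) := by
  have hk : 0 < h + r ^ 2 := by positivity
  set Z := √(N - ρ ^ 2) with hZ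
  have hprod : truncatedStrip ρ σ N = Set.Icc (-σ - Z) (-σ + Z) ×ˢ Set.univ := by
    rw [← setOf_add_sq_add_sq_le hN]
    ext p
    simp [truncatedStrip]
  have hc1 : Continuous fun z : ℝ => √(z ^ 2 + (h + r ^ 2)) := by fun_prop
  have hc3 := continuous_inv_sqrt_sq_add_pow hk 3
  set Q : ℝ → ℝ := fun z => Real.pi / 2 *
    (√(z ^ 2 + (h + r ^ 2)) - r ^ 4 / √(z ^ 2 + (h + r ^ 2)) ^ 3) with hQ
  have hQc : Continuous Q := by
    have : Q = fun z => Real.pi / 2 *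
        (√(z ^ 2 + (h + r ^ 2)) - r ^ 4 * (1 / √(z ^ 2 + (h + r ^ 2)) ^ 3)) := by
      simp only [hQ, mul_one_div]
    rw [this]
    fun_prop
  have hQ0 : ∀ z, 0 ≤ Q z := fun z => by
    have h1 : √(z ^ 2 + (h + r ^ 2)) ^ 2 = z ^ 2 + (h + r ^ 2) := Real.sq_sqrt (by positivity)
    have h2 : 0 < √(z ^ 2 + (h + r ^ 2)) := by positivity
    have h3 : r ^ 2 ≤ √(z ^ 2 + (h + r ^ 2)) ^ 2 := by rw [h1]; nlinarith [sq_nonneg z]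
    have h4 : r ^ 4 / √(z ^ 2 + (h + r ^ 2)) ^ 3 ≤ √(z ^ 2 + (h + r ^ 2)) := by
      rw [div_le_iff₀ (by positivity)]
      nlinarith [sq_nonneg r]
    exact mul_nonneg (by positivity) (sub_nonneg.2 h4)
  have hlint : ∫⁻ p in truncatedStrip ρ σ N, ENNReal.ofReal (chordDensity r h p)
      = ENNReal.ofReal (∫ z in Set.Icc (-σ - Z) (-σ + Z), Q z) := by
    rw [hprod, Measure.volume_eq_prod, ← Measure.prod_restrict, Measure.restrict_univ,
      lintegral_prod _ (measurable_chordDensity r h).ennreal_ofReal.aemeasurable,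
      ofReal_integral_eq_lintegral_ofReal (hQc.integrableOn_Icc) (Eventually.of_forall hQ0)]
    exact lintegral_congr fun z => lintegral_chordDensity hr hh z
  constructor
  · refine ⟨(measurable_chordDensity r h).aestronglyMeasurable, ?_⟩
    rw [hasFiniteIntegral_iff_ofReal (Eventually.of_forall fun p => chordDensity_nonneg hh p),
      hlint]
    exact ENNReal.ofReal_lt_top
  · rw [integral_eq_lintegral_of_nonneg_ae (Eventually.of_forall fun p => chordDensity_nonneg hh p)
      (measurable_chordDensity r h).aestronglyMeasurable, hlint,
      ENNReal.toReal_ofReal (integral_nonneg hQ0), integral_Icc_symm σ (Real.sqrt_nonneg _),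
      hQ, intervalIntegral.integral_const_mul]
    simp only [div_eq_mul_one_div (r ^ 4)]
    rw [intervalIntegral.integral_sub (hc1.intervalIntegrable _ _)
      ((hc3.const_mul _).intervalIntegrable _ _), intervalIntegral.integral_const_mul]

/-- The integral of `chordModel` over the part of a line `η = const` between `truncatedStrip` and
the boundary of `truncatedRegion`. -/
noncomputable def chordModelSlice (r h ρ σ N η : ℝ) : ℝ :=
  (((∫ z in (-σ - √(N * (1 + η ^ 2) - ρ ^ 2))..(-σ + √(N * (1 + η ^ 2) - ρ ^ 2)),
      √(z ^ 2 + h)) - ∫ z in (-σ - √(N - ρ ^ 2))..(-σ + √(N - ρ ^ 2)), √(z ^ 2 + h)) +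
    r ^ 2 * η ^ 2 / 2 *
      ((∫ z in (-σ - √(N * (1 + η ^ 2) - ρ ^ 2))..(-σ + √(N * (1 + η ^ 2) - ρ ^ 2)),
        1 / √(z ^ 2 + h)) -
        ∫ z in (-σ - √(N - ρ ^ 2))..(-σ + √(N - ρ ^ 2)), 1 / √(z ^ 2 + h))) / (1 + η ^ 2) ^ 2

theorem lintegral_chordModel_slice {r h ρ σ N : ℝ} (hh : 0 < h) (hN : ρ ^ 2 ≤ N) (η : ℝ) :
    0 ≤ chordModelSlice r h ρ σ N η ∧
    ∫⁻ z : ℝ, (truncatedRegion ρ σ N \ truncatedStrip ρ σ N).indicator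
        (fun p => ENNReal.ofReal (chordModel r h p)) (z, η)
      = ENNReal.ofReal (chordModelSlice r h ρ σ N η) := by
  have hN0 : 0 ≤ N := (sq_nonneg ρ).trans hN
  have hη := one_add_sq_pos η
  have hN' : ρ ^ 2 ≤ N * (1 + η ^ 2) := by nlinarith [mul_nonneg hN0 (sq_nonneg η)]
  unfold chordModelSlice
  set Z₀ := √(N - ρ ^ 2) with hZ₀
  set Z := √(N * (1 + η ^ 2) - ρ ^ 2) with hZ
  have hZ0 : 0 ≤ Z₀ := Real.sqrt_nonneg _
  have hZZ : Z₀ ≤ Z := Real.sqrt_le_sqrt (by nlinarith [mul_nonneg hN0 (sq_nonneg η)])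
  have hslice : ∀ z : ℝ, ((truncatedRegion ρ σ N \ truncatedStrip ρ σ N).indicator
      (fun p => ENNReal.ofReal (chordModel r h p)) (z, η))
      = (Set.Icc (-σ - Z) (-σ + Z) \ Set.Icc (-σ - Z₀) (-σ + Z₀)).indicator
        (fun z => ENNReal.ofReal (chordModel r h (z, η))) z := fun z => by
    rw [hZ₀, hZ, ← setOf_add_sq_add_sq_le hN, ← setOf_add_sq_add_sq_le hN']
    rfl
  have hc0 : Continuous fun z : ℝ => √(z ^ 2 + h) := by fun_prop
  have hc1 : Continuous fun z : ℝ => 1 / √(z ^ 2 + h) := by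
    simpa using continuous_inv_sqrt_sq_add_pow hh 1
  have hmodel : ∀ z, chordModel r h (z, η)
      = (√(z ^ 2 + h) + r ^ 2 * η ^ 2 / 2 * (1 / √(z ^ 2 + h))) / (1 + η ^ 2) ^ 2 := fun z => by
    unfold chordModel
    dsimp only
    rw [div_mul_div_comm, mul_one]
  have hmc : Continuous fun z => chordModel r h (z, η) := by
    simp only [hmodel]
    fun_prop
  have hint : ∀ Z : ℝ, 0 ≤ Z → ∫ z in Set.Icc (-σ - Z) (-σ + Z), chordModel r h (z, η)
      = ((∫ z in (-σ - Z)..(-σ + Z), √(z ^ 2 + h)) +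
        r ^ 2 * η ^ 2 / 2 * ∫ z in (-σ - Z)..(-σ + Z), 1 / √(z ^ 2 + h)) / (1 + η ^ 2) ^ 2 :=
    fun Z hZ => by
      rw [integral_Icc_symm σ hZ]
      simp only [hmodel]
      rw [intervalIntegral.integral_div, intervalIntegral.integral_add
        (hc0.intervalIntegrable _ _) ((hc1.const_mul _).intervalIntegrable _ _),
        intervalIntegral.integral_const_mul]
  have hval := setIntegral_sdiff (measurableSet_Icc (a := -σ - Z₀) (b := -σ + Z₀))
    (hmc.integrableOn_Icc (μ := volume) (a := -σ - Z) (b := -σ + Z))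
    (Set.Icc_subset_Icc (by linarith) (by linarith))
  rw [hint Z (hZ0.trans hZZ), hint Z₀ hZ0, ← sub_div, add_sub_add_comm, ← mul_sub] at hval
  rw [← hval]
  refine ⟨integral_nonneg fun z => chordModel_nonneg _ _ _, ?_⟩
  simp only [hslice]
  rw [lintegral_indicator (measurableSet_Icc.diff measurableSet_Icc),
    ← ofReal_integral_eq_lintegral_ofReal (hmc.integrableOn_Icc.mono_set Set.sdiff_subset)
      (Eventually.of_forall fun z => chordModel_nonneg _ _ _)]

theorem lintegral_chordModel_diff {r h ρ σ N : ℝ} (hh : 0 < h) (hN : ρ ^ 2 ≤ N) :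
    ∫⁻ p in truncatedRegion ρ σ N \ truncatedStrip ρ σ N, ENNReal.ofReal (chordModel r h p)
      = ∫⁻ η : ℝ, ENNReal.ofReal (chordModelSlice r h ρ σ N η) := by
  have hW := (measurableSet_truncatedRegion ρ σ N).diff (measurableSet_truncatedStrip ρ σ N)
  have hm := measurable_chordModel r h
  rw [← lintegral_indicator hW, Measure.volume_eq_prod,
    lintegral_prod_symm' _ (Measurable.indicator (by fun_prop) hW)]
  exact lintegral_congr fun η => (lintegral_chordModel_slice hh hN η).2

/-! ### Asymptotics of the truncated integral -/

/-- The slice integral of the model, with the errors `E₁` and `E₂` of the one-dimensional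
asymptotics separated from the main terms. -/
theorem chordModelSlice_eq {r h ρ σ N : ℝ} (hN0 : 0 < N) (hN : ρ ^ 2 ≤ N)
    {E₁ E₂ : ℝ → ℝ}
    (hE₁ : ∀ Z, E₁ Z = (∫ z in (-σ - Z)..(-σ + Z), √(z ^ 2 + h)) - Z ^ 2 -
      h / 2 * Real.log (ρ ^ 2 + Z ^ 2))
    (hE₂ : ∀ Z, E₂ Z = (∫ z in (-σ - Z)..(-σ + Z), 1 / √(z ^ 2 + h)) -
      Real.log (ρ ^ 2 + Z ^ 2)) (η : ℝ) :
    chordModelSlice r h ρ σ N η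
      = (N * (η ^ 2 / (1 + η ^ 2) ^ 2) + h / 2 * (Real.log (1 + η ^ 2) / (1 + η ^ 2) ^ 2) +
          r ^ 2 / 2 * (Real.log (1 + η ^ 2) / (1 + η ^ 2) -
            Real.log (1 + η ^ 2) / (1 + η ^ 2) ^ 2)) +
        ((E₁ √(N * (1 + η ^ 2) - ρ ^ 2) - E₁ √(N - ρ ^ 2)) +
          r ^ 2 * η ^ 2 / 2 * (E₂ √(N * (1 + η ^ 2) - ρ ^ 2) - E₂ √(N - ρ ^ 2))) /
            (1 + η ^ 2) ^ 2 := by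
  have hη := one_add_sq_pos η
  have hN' : ρ ^ 2 ≤ N * (1 + η ^ 2) := by nlinarith [mul_nonneg hN0.le (sq_nonneg η)]
  have h1 : √(N - ρ ^ 2) ^ 2 = N - ρ ^ 2 := Real.sq_sqrt (by linarith)
  have h2 : √(N * (1 + η ^ 2) - ρ ^ 2) ^ 2 = N * (1 + η ^ 2) - ρ ^ 2 := Real.sq_sqrt (by linarith)
  unfold chordModelSlice
  rw [hE₁, hE₁, hE₂, hE₂, h1, h2, add_sub_cancel, add_sub_cancel, Real.log_mul hN0.ne' hη.ne']
  field_simp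
  ring

/-- Integration of the slices over `η`. The constants `c₁` and `c₂` cancel between the two ends of a
slice, so only the oscillation of the errors beyond `√(N - ρ ^ 2)` matters. -/
theorem integral_chordModel_diff {r h ρ σ N δ c₁ c₂ : ℝ} (hh : 0 < h) (hN0 : 0 < N)
    (hN : ρ ^ 2 ≤ N) {E₁ E₂ : ℝ → ℝ}
    (hE₁ : ∀ Z, E₁ Z = (∫ z in (-σ - Z)..(-σ + Z), √(z ^ 2 + h)) - Z ^ 2 -
      h / 2 * Real.log (ρ ^ 2 + Z ^ 2))
    (hE₂ : ∀ Z, E₂ Z = (∫ z in (-σ - Z)..(-σ + Z), 1 / √(z ^ 2 + h)) -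
      Real.log (ρ ^ 2 + Z ^ 2))
    (hc₁ : ∀ Z ≥ √(N - ρ ^ 2), |E₁ Z - c₁| ≤ δ) (hc₂ : ∀ Z ≥ √(N - ρ ^ 2), |E₂ Z - c₂| ≤ δ) :
    IntegrableOn (chordModel r h) (truncatedRegion ρ σ N \ truncatedStrip ρ σ N) ∧
    |(∫ p in truncatedRegion ρ σ N \ truncatedStrip ρ σ N, chordModel r h p) - Real.pi * N / 2 -
      (h / 2 * (Real.pi * Real.log 2 - Real.pi / 2) +
        r ^ 2 / 2 * (Real.pi * Real.log 2 + Real.pi / 2))| ≤ δ * (2 + r ^ 2) * Real.pi := by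
  have hδ : 0 ≤ δ := (abs_nonneg _).trans (hc₁ _ le_rfl)
  obtain ⟨i2, j2⟩ := integral_sq_div_one_add_sq_sq
  obtain ⟨l0, m0⟩ := integral_log_one_add_sq_div_one_add_sq
  obtain ⟨l1, m1⟩ := integral_log_one_add_sq_div_one_add_sq_sq
  set rem : ℝ → ℝ := fun η => ((E₁ √(N * (1 + η ^ 2) - ρ ^ 2) - E₁ √(N - ρ ^ 2)) +
          r ^ 2 * η ^ 2 / 2 * (E₂ √(N * (1 + η ^ 2) - ρ ^ 2) - E₂ √(N - ρ ^ 2))) /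
            (1 + η ^ 2) ^ 2 with hrem
  have hE₁m : Measurable E₁ := by
    rw [funext hE₁]
    simp only [integral_sqrt_sq_add hh]
    fun_prop
  have hE₂m : Measurable E₂ := by
    rw [funext hE₂]
    simp only [integral_inv_sqrt_sq_add hh]
    fun_prop
  have hbound : ∀ η, ‖rem η‖ ≤ δ * (2 + r ^ 2) * (1 + η ^ 2)⁻¹ := fun η => by
    have hη := one_add_sq_pos η
    have hZZ : √(N * (1 + η ^ 2) - ρ ^ 2) ≥ √(N - ρ ^ 2) :=
      Real.sqrt_le_sqrt (by nlinarith [mul_nonneg hN0.le (sq_nonneg η)])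
    have a1 := abs_le.1 (hc₁ _ hZZ)
    have a2 := abs_le.1 (hc₁ _ le_rfl)
    have a3 := abs_le.1 (hc₂ _ hZZ)
    have a4 := abs_le.1 (hc₂ _ le_rfl)
    have b1 : |E₁ √(N * (1 + η ^ 2) - ρ ^ 2) - E₁ √(N - ρ ^ 2)| ≤ 2 * δ :=
      abs_le.2 ⟨by linarith, by linarith⟩
    have b2 : |E₂ √(N * (1 + η ^ 2) - ρ ^ 2) - E₂ √(N - ρ ^ 2)| ≤ 2 * δ :=
      abs_le.2 ⟨by linarith, by linarith⟩
    have b3 : |r ^ 2 * η ^ 2 / 2 * (E₂ √(N * (1 + η ^ 2) - ρ ^ 2) - E₂ √(N - ρ ^ 2))|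
        ≤ r ^ 2 * η ^ 2 / 2 * (2 * δ) := by
      rw [abs_mul, abs_of_nonneg (by positivity)]
      gcongr
    rw [hrem, norm_div, Real.norm_eq_abs, Real.norm_of_nonneg (by positivity), ← div_eq_mul_inv,
      div_le_div_iff₀ (by positivity) hη]
    have b4 := (abs_add_le _ _).trans (add_le_add b1 b3)
    have b5 : 2 * δ + r ^ 2 * η ^ 2 / 2 * (2 * δ) ≤ δ * (2 + r ^ 2) * (1 + η ^ 2) := by
      nlinarith [mul_nonneg hδ (sq_nonneg η), mul_nonneg hδ (sq_nonneg r)]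
    nlinarith [b4.trans b5]
  have irem : Integrable rem :=
    (integrable_inv_one_add_sq.const_mul (δ * (2 + r ^ 2))).mono'
      (Measurable.aestronglyMeasurable (by fun_prop)) (Eventually.of_forall hbound)
  have iA : Integrable fun η : ℝ => N * (η ^ 2 / (1 + η ^ 2) ^ 2) := i2.const_mul N
  have iB : Integrable fun η : ℝ => h / 2 * (Real.log (1 + η ^ 2) / (1 + η ^ 2) ^ 2) :=
    l1.const_mul _
  have iC : Integrable fun η : ℝ => r ^ 2 / 2 * (Real.log (1 + η ^ 2) / (1 + η ^ 2) -
            Real.log (1 + η ^ 2) / (1 + η ^ 2) ^ 2) := (l0.sub l1).const_mul _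
  have iAB : Integrable fun η : ℝ => N * (η ^ 2 / (1 + η ^ 2) ^ 2) +
      h / 2 * (Real.log (1 + η ^ 2) / (1 + η ^ 2) ^ 2) := iA.add iB
  have iABC : Integrable fun η : ℝ => N * (η ^ 2 / (1 + η ^ 2) ^ 2) +
      h / 2 * (Real.log (1 + η ^ 2) / (1 + η ^ 2) ^ 2) +
      r ^ 2 / 2 * (Real.log (1 + η ^ 2) / (1 + η ^ 2) -
            Real.log (1 + η ^ 2) / (1 + η ^ 2) ^ 2) := iAB.add iC
  have heq := fun η => chordModelSlice_eq (r := r) hN0 hN hE₁ hE₂ η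
  have iS : Integrable fun η => chordModelSlice r h ρ σ N η :=
    (iABC.add irem).congr (Eventually.of_forall fun η => (heq η).symm)
  have hlint := lintegral_chordModel_diff (r := r) (σ := σ) hh hN
  rw [← ofReal_integral_eq_lintegral_ofReal iS
    (Eventually.of_forall fun η => (lintegral_chordModel_slice hh hN η).1)] at hlint
  have hmeas : AEStronglyMeasurable (chordModel r h)
      (volume.restrict (truncatedRegion ρ σ N \ truncatedStrip ρ σ N)) :=
    (measurable_chordModel r h).aestronglyMeasurable
  refine ⟨⟨hmeas, ?_⟩, ?_⟩
  · rw [hasFiniteIntegral_iff_ofReal (Eventually.of_forall fun p => chordModel_nonneg _ _ p), hlint]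
    exact ENNReal.ofReal_lt_top
  · rw [integral_eq_lintegral_of_nonneg_ae (Eventually.of_forall fun p => chordModel_nonneg _ _ p)
      hmeas, hlint, ENNReal.toReal_ofReal
      (integral_nonneg fun η => (lintegral_chordModel_slice hh hN η).1), integral_congr_ae
      (Eventually.of_forall heq), integral_add iABC irem, integral_add iAB iC, integral_add iA iB,
      integral_const_mul, integral_const_mul, integral_const_mul, integral_sub l0 l1, j2, m0, m1]
    have hb := norm_integral_le_of_norm_le (integrable_inv_one_add_sq.const_mul (δ * (2 + r ^ 2)))
      (Eventually.of_forall hbound)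
    rw [integral_const_mul, integral_univ_inv_one_add_sq, Real.norm_eq_abs] at hb
    convert hb using 2
    ring

theorem tendsto_integral_chordModel_diff {r h : ℝ} (hh : 0 < h) (ρ σ : ℝ) :
    (∀ᶠ N in atTop, IntegrableOn (chordModel r h)
      (truncatedRegion ρ σ N \ truncatedStrip ρ σ N)) ∧
    Tendsto (fun N => (∫ p in truncatedRegion ρ σ N \ truncatedStrip ρ σ N, chordModel r h p) -
      Real.pi * N / 2) atTop (𝓝 (h / 2 * (Real.pi * Real.log 2 - Real.pi / 2) +
        r ^ 2 / 2 * (Real.pi * Real.log 2 + Real.pi / 2))) := by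
  have t1 := tendsto_integral_sqrt_sq_add hh σ ρ
  have t2 := tendsto_integral_inv_sqrt_sq_add hh σ ρ
  have hZ : Tendsto (fun N : ℝ => √(N - ρ ^ 2)) atTop atTop :=
    Real.tendsto_sqrt_atTop.comp (tendsto_atTop_add_const_right _ _ tendsto_id)
  have hev : ∀ δ > 0, ∀ᶠ N in atTop, IntegrableOn (chordModel r h)
      (truncatedRegion ρ σ N \ truncatedStrip ρ σ N) ∧
      |(∫ p in truncatedRegion ρ σ N \ truncatedStrip ρ σ N, chordModel r h p) -
        Real.pi * N / 2 - (h / 2 * (Real.pi * Real.log 2 - Real.pi / 2) +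
        r ^ 2 / 2 * (Real.pi * Real.log 2 + Real.pi / 2))| ≤ δ * (2 + r ^ 2) * Real.pi := by
    intro δ hδ
    obtain ⟨Z₁, h1⟩ := eventually_atTop.1 (Metric.tendsto_nhds.1 t1 δ hδ)
    obtain ⟨Z₂, h2⟩ := eventually_atTop.1 (Metric.tendsto_nhds.1 t2 δ hδ)
    filter_upwards [eventually_gt_atTop 0, eventually_ge_atTop (ρ ^ 2),
      hZ.eventually_ge_atTop Z₁, hZ.eventually_ge_atTop Z₂] with N hN0 hN hN1 hN2
    exact integral_chordModel_diff hh hN0 hN (fun _ => rfl) (fun _ => rfl)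
      (fun Z hZ => (h1 Z (hN1.trans hZ)).le) (fun Z hZ => (h2 Z (hN2.trans hZ)).le)
  refine ⟨(hev 1 one_pos).mono fun N hN => hN.1, Metric.tendsto_nhds.2 fun e he => ?_⟩
  have hpos : 0 < (2 + r ^ 2) * Real.pi := by positivity
  filter_upwards [hev (e / (2 * ((2 + r ^ 2) * Real.pi))) (by positivity)] with N hN
  refine lt_of_le_of_lt hN.2 ?_
  rw [mul_assoc, div_mul_eq_mul_div, mul_div_mul_right _ _ hpos.ne']
  linarith

theorem tendsto_integral_chordDensity_truncatedStrip {r h : ℝ} (hr : 0 < r) (hh : 0 < h)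
    (ρ σ : ℝ) :
    Tendsto (fun N => (∫ p in truncatedStrip ρ σ N, chordDensity r h p) - Real.pi * N / 2 -
      Real.pi / 4 * (h + r ^ 2) * Real.log N) atTop
      (𝓝 (Real.pi / 2 * (-ρ ^ 2 + (σ ^ 2 + (h + r ^ 2) / 2 +
        (h + r ^ 2) / 2 * (2 * Real.log 2 - Real.log (h + r ^ 2))) -
        r ^ 4 * (2 / (h + r ^ 2))))) := by
  have hb : 0 < h + r ^ 2 := by positivity
  have hZ : Tendsto (fun N : ℝ => √(N - ρ ^ 2)) atTop atTop :=
    Real.tendsto_sqrt_atTop.comp (tendsto_atTop_add_const_right _ _ tendsto_id)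
  have h1 := ((((tendsto_integral_sqrt_sq_add hb σ ρ).comp hZ).const_add (-ρ ^ 2)).sub
    (((tendsto_integral_inv_sqrt_sq_add_cube hb σ).comp hZ).const_mul (r ^ 4))).const_mul
      (Real.pi / 2)
  refine h1.congr' ?_
  filter_upwards [eventually_ge_atTop (ρ ^ 2)] with N hN
  rw [(integral_chordDensity_truncatedStrip hr hh hN).2]
  have h2 : √(N - ρ ^ 2) ^ 2 = N - ρ ^ 2 := Real.sq_sqrt (by linarith)
  simp only [Function.comp, h2, add_sub_cancel]
  ring

/-- Asymptotics of the truncated integral: the strip contributes its exact value, the region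
between the strip and the boundary contributes that of the model. -/
theorem tendsto_integral_chordDensity {r h : ℝ} (hr : 0 < r) (hh : 0 < h) (ρ σ : ℝ) :
    Tendsto (fun N => (∫ p in truncatedRegion ρ σ N, chordDensity r h p) - Real.pi * N -
      Real.pi / 4 * (h + r ^ 2) * Real.log N) atTop
      (𝓝 (Real.pi / 2 * (-ρ ^ 2 + (σ ^ 2 + (h + r ^ 2) / 2 +
        (h + r ^ 2) / 2 * (2 * Real.log 2 - Real.log (h + r ^ 2))) -
        r ^ 4 * (2 / (h + r ^ 2))) +
        (h / 2 * (Real.pi * Real.log 2 - Real.pi / 2) +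
        r ^ 2 / 2 * (Real.pi * Real.log 2 + Real.pi / 2)))) := by
  obtain ⟨hi, ht⟩ := tendsto_integral_chordModel_diff (r := r) hh ρ σ
  have hD := integrable_chordDensity_sub_chordModel hr hh
  have hWm : ∀ N, MeasurableSet (truncatedRegion ρ σ N \ truncatedStrip ρ σ N) := fun N =>
    (measurableSet_truncatedRegion ρ σ N).diff (measurableSet_truncatedStrip ρ σ N)
  have h0 : Tendsto (fun N => ∫ p in truncatedRegion ρ σ N \ truncatedStrip ρ σ N,
      (chordDensity r h p - chordModel r h p)) atTop (𝓝 0) := by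
    have : Tendsto (fun N => ∫ p, (truncatedRegion ρ σ N \ truncatedStrip ρ σ N).indicator
        (fun p => chordDensity r h p - chordModel r h p) p) atTop
        (𝓝 (∫ _ : ℝ × ℝ, (0 : ℝ))) := by
      refine tendsto_integral_filter_of_dominated_convergence _
        (Eventually.of_forall fun N => hD.aestronglyMeasurable.indicator (hWm N))
        (Eventually.of_forall fun N => Eventually.of_forall fun p =>
          norm_indicator_le_norm_self _ _)
        hD.norm (Eventually.of_forall fun p => ?_)
      refine tendsto_const_nhds.congr' ?_
      filter_upwards [eventually_ge_atTop ((p.1 + σ) ^ 2 + ρ ^ 2)] with N hN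
      rw [Set.indicator_of_notMem]
      exact fun hp => hp.2 hN
    rw [integral_zero] at this
    exact this.congr fun N => integral_indicator (hWm N)
  have hs := tendsto_integral_chordDensity_truncatedStrip hr hh ρ σ
  have hall := hs.add (ht.add h0)
  rw [add_zero] at hall
  refine hall.congr' ?_
  filter_upwards [hi, eventually_ge_atTop (ρ ^ 2)] with N hN hN'
  have hN0 : 0 ≤ N := (sq_nonneg ρ).trans hN'
  have e1 : IntegrableOn (chordDensity r h) (truncatedRegion ρ σ N \ truncatedStrip ρ σ N) :=
    (hD.integrableOn.add hN).congr (Eventually.of_forall fun p => sub_add_cancel _ _)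
  have e2 := setIntegral_union (Set.disjoint_sdiff_right) (hWm N)
    (integral_chordDensity_truncatedStrip (σ := σ) hr hh hN').1 e1
  rw [Set.union_sdiff_cancel (truncatedStrip_subset hN0)] at e2
  rw [e2, integral_sub e1 hN]
  ring

/-! ### Principal curvatures of a torus of revolution -/

/-- Near `x` the differential of a defining function vanishes on velocities of curves in the
surface. -/
theorem IsLocalDefiningFunction.eventually_fderiv_eq_zero {S : Set E3} {x : E3} {g : E3 → ℝ}
    (hg : IsLocalDefiningFunction S x g) :
    ∀ᶠ y in 𝓝 x, ∀ (q : ℝ → E3) (s : ℝ) (e : E3), q s = y → HasDerivAt q e s →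
      (∀ t, q t ∈ S) → fderiv ℝ g y e = 0 := by
  filter_upwards [hg.mem_iff.eventually_nhds, hg.contDiffAt.eventually (by simp)]
    with y hy hdy q s e hq hqd hqS
  subst hq
  have h1 : HasDerivAt (fun t => g (q t)) (fderiv ℝ g (q s) e) s :=
    ((hdy.differentiableAt (by simp)).hasFDerivAt).comp_hasDerivAt s hqd
  have h2 : (fun t => g (q t)) =ᶠ[𝓝 s] fun _ => 0 := by
    filter_upwards [hqd.continuousAt.eventually hy] with t ht
    exact ht.1 (hqS t)
  exact h1.unique ((hasDerivAt_const s (0 : ℝ)).congr_of_eventuallyEq h2)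

/-- The second derivative of a defining function on tangent vectors, obtained by differentiating a
tangential vector field `X` along a curve `p` in the surface. Each value `X t` is the velocity of a
curve `q t` in the surface. -/
theorem IsLocalDefiningFunction.fderiv_fderiv_apply {S : Set E3} {x : E3} {g : E3 → ℝ}
    (hg : IsLocalDefiningFunction S x g) {p X : ℝ → E3} {q : ℝ → ℝ → E3} {σ : ℝ → ℝ} {e X' : E3}
    {t₀ : ℝ} (hp : HasDerivAt p e t₀) (hpx : p t₀ = x) (hX : HasDerivAt X X' t₀)
    (hq : ∀ t, q t (σ t) = p t) (hqX : ∀ t, HasDerivAt (q t) (X t) (σ t))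
    (hqS : ∀ t s, q t s ∈ S) :
    fderiv ℝ (fderiv ℝ g) x e (X t₀) = - fderiv ℝ g x X' := by
  subst hpx
  have h1 : HasFDerivAt (fderiv ℝ g) (fderiv ℝ (fderiv ℝ g) (p t₀)) (p t₀) :=
    ((hg.contDiffAt.fderiv_right (m := 1) (by norm_num)).differentiableAt (by simp)).hasFDerivAt
  have h2 := (h1.comp_hasDerivAt t₀ hp).clm_apply hX
  have h3 : (fun t => fderiv ℝ g (p t) (X t)) =ᶠ[𝓝 t₀] fun _ => 0 := by
    filter_upwards [hp.continuousAt.eventually hg.eventually_fderiv_eq_zero] with t ht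
    exact ht (q t) (σ t) (X t) (hq t) (hqX t) (hqS t)
  have h4 := h2.unique ((hasDerivAt_const t₀ (0 : ℝ)).congr_of_eventuallyEq h3)
  simp only [Function.comp] at h4
  linarith

/-- First and second derivatives of a defining function of a torus of revolution, in the frame of
the unit normal `c₀ • F 0 + s₀ • F 2` and the unit tangent vectors `-s₀ • F 0 + c₀ • F 2` and
`F 1`. -/
theorem fderiv_defining_torusOfRevolution (F : OrthonormalBasis (Fin 3) ℝ E3) (c : E3)
    {R r c₀ s₀ : ℝ} (hr : 0 < r) (hR : r < R) (h : c₀ ^ 2 + s₀ ^ 2 = 1) {g : E3 → ℝ}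
    (hg : IsLocalDefiningFunction (torusOfRevolution c (F 2) R r)
      (c + (R + r * c₀) • F 0 + (r * s₀) • F 2) g) :
    ∃ l : ℝ, l ≠ 0 ∧
      ‖fderiv ℝ g (c + (R + r * c₀) • F 0 + (r * s₀) • F 2)‖ = |l| ∧
      (∀ e : E3, fderiv ℝ g (c + (R + r * c₀) • F 0 + (r * s₀) • F 2) e
        = l * (c₀ * inner ℝ (F 0) e + s₀ * inner ℝ (F 2) e)) ∧
      (∀ α β α' β' : ℝ, fderiv ℝ (fderiv ℝ g) (c + (R + r * c₀) • F 0 + (r * s₀) • F 2)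
          (α • (-s₀ • F 0 + c₀ • F 2) + β • F 1) (α' • (-s₀ • F 0 + c₀ • F 2) + β' • F 1)
        = l * (α * α' / r + β * β' * (c₀ / (R + r * c₀)))) := by
  obtain ⟨u₀, hc, hs⟩ := exists_cos_sin_of_sq_add_sq_eq_one h
  have hρ : 0 < R + r * c₀ := torusRadius_pos hr hR h
  set x := c + (R + r * c₀) • F 0 + (r * s₀) • F 2 with hx
  set Φ : ℝ → ℝ → E3 := fun u v => c + ((R + r * Real.cos u) * Real.cos v) • F 0 +
        ((R + r * Real.cos u) * Real.sin v) • F 1 + (r * Real.sin u) • F 2 with hΦ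
  have hΦS : ∀ u v, Φ u v ∈ torusOfRevolution c (F 2) R r := fun u v =>
    (mem_torusOfRevolution_iff F c R r _).2 ⟨u, v, rfl⟩
  have hΦx : Φ u₀ 0 = x := by
    simp only [hΦ, hx, Real.cos_zero, Real.sin_zero, mul_zero, zero_smul, add_zero, mul_one, hc, hs]
  set Φu : ℝ → ℝ → E3 := fun u v => (-r * Real.sin u * Real.cos v) • F 0 +
    (-r * Real.sin u * Real.sin v) • F 1 + (r * Real.cos u) • F 2 with hΦu
  set Φv : ℝ → ℝ → E3 := fun u v => (-(R + r * Real.cos u) * Real.sin v) • F 0 +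
    ((R + r * Real.cos u) * Real.cos v) • F 1 with hΦv
  have hdu : ∀ u v, HasDerivAt (fun u => Φ u v) (Φu u v) u := fun u v => by
    have h1 := ((Real.hasDerivAt_cos u).const_mul r).const_add R
    have h2 := (((((h1.mul_const (Real.cos v)).smul_const (F 0)).const_add c).add
      ((h1.mul_const (Real.sin v)).smul_const (F 1))).add
      (((Real.hasDerivAt_sin u).const_mul r).smul_const (F 2)))
    refine h2.congr_deriv ?_
    simp only [hΦu]
    module
  have hdv : ∀ u v, HasDerivAt (fun v => Φ u v) (Φv u v) v := fun u v => by
    have h2 := ((((((Real.hasDerivAt_cos v).const_mul (R + r * Real.cos u)).smul_const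
      (F 0)).const_add c).add
      (((Real.hasDerivAt_sin v).const_mul (R + r * Real.cos u)).smul_const (F 1))).add_const
      ((r * Real.sin u) • F 2))
    refine h2.congr_deriv ?_
    simp only [hΦv]
    module
  have hduu : HasDerivAt (fun u => Φu u 0) (-r • (c₀ • F 0 + s₀ • F 2)) u₀ := by
    have h2 := (((((Real.hasDerivAt_sin u₀).const_mul (-r)).mul_const (Real.cos 0)).smul_const
      (F 0)).add ((((Real.hasDerivAt_sin u₀).const_mul (-r)).mul_const (Real.sin 0)).smul_const
      (F 1))).add (((Real.hasDerivAt_cos u₀).const_mul r).smul_const (F 2))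
    refine h2.congr_deriv ?_
    rw [← hc, ← hs, Real.sin_zero, Real.cos_zero]
    module
  have hduv : HasDerivAt (fun v => Φu u₀ v) ((-r * s₀) • F 1) 0 := by
    have h2 := ((((Real.hasDerivAt_cos 0).const_mul (-r * Real.sin u₀)).smul_const (F 0)).add
      (((Real.hasDerivAt_sin 0).const_mul (-r * Real.sin u₀)).smul_const (F 1))).add_const
      ((r * Real.cos u₀) • F 2)
    refine h2.congr_deriv ?_
    rw [← hs, Real.sin_zero, Real.cos_zero]
    module
  have hdvu : HasDerivAt (fun u => Φv u 0) ((-r * s₀) • F 1) u₀ := by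
    have h1 := ((Real.hasDerivAt_cos u₀).const_mul r).const_add R
    have h2 := ((h1.neg.mul_const (Real.sin 0)).smul_const (F 0)).add
      ((h1.mul_const (Real.cos 0)).smul_const (F 1))
    refine h2.congr_deriv ?_
    rw [← hs, Real.sin_zero, Real.cos_zero]
    module
  have hdvv : HasDerivAt (fun v => Φv u₀ v) (-(R + r * c₀) • F 0) 0 := by
    have h2 := (((Real.hasDerivAt_sin 0).const_mul (-(R + r * Real.cos u₀))).smul_const
      (F 0)).add (((Real.hasDerivAt_cos 0).const_mul (R + r * Real.cos u₀)).smul_const (F 1))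
    refine h2.congr_deriv ?_
    rw [← hc, Real.sin_zero, Real.cos_zero]
    module
  have hbuu := hg.fderiv_fderiv_apply (hdu u₀ 0) hΦx hduu (q := fun _ u => Φ u 0) (σ := id)
    (fun _ => rfl) (fun t => hdu t 0) (fun _ s => hΦS s 0)
  have hbvv := hg.fderiv_fderiv_apply (hdv u₀ 0) hΦx hdvv (q := fun _ v => Φ u₀ v) (σ := id)
    (fun _ => rfl) (fun t => hdv u₀ t) (fun _ s => hΦS u₀ s)
  have hbvu := hg.fderiv_fderiv_apply (hdv u₀ 0) hΦx hduv (q := fun v u => Φ u v)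
    (σ := fun _ => u₀) (fun _ => rfl) (fun t => hdu u₀ t) (fun t s => hΦS s t)
  have hbuv := hg.fderiv_fderiv_apply (hdu u₀ 0) hΦx hdvu (q := fun u v => Φ u v)
    (σ := fun _ => 0) (fun _ => rfl) (fun t => hdv t 0) (fun t s => hΦS t s)
  have htan := hg.eventually_fderiv_eq_zero.self_of_nhds
  have h1u := htan (fun u => Φ u 0) u₀ _ hΦx (hdu u₀ 0) (fun t => hΦS t 0)
  have h1v := htan (fun v => Φ u₀ v) 0 _ hΦx (hdv u₀ 0) (fun t => hΦS u₀ t)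
  have eu : Φu u₀ 0 = r • (-s₀ • F 0 + c₀ • F 2) := by
    simp only [hΦu, Real.cos_zero, Real.sin_zero, ← hc, ← hs]
    module
  have ev : Φv u₀ 0 = (R + r * c₀) • F 1 := by
    simp only [hΦv, Real.cos_zero, Real.sin_zero, ← hc]
    module
  rw [eu] at hbuu hbvu hbuv h1u
  rw [ev] at hbvv hbvu hbuv h1v
  set τ := -s₀ • F 0 + c₀ • F 2 with hτ
  set D := fderiv ℝ g x with hD
  set b := fderiv ℝ (fderiv ℝ g) x with hb
  simp only [map_smul, smul_apply, smul_eq_mul] at hbuu hbvv hbvu hbuv h1u h1v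
  set ν := c₀ • F 0 + s₀ • F 2 with hν
  have hDτ : D τ = 0 := (mul_eq_zero.1 h1u).resolve_left hr.ne'
  have hD1 : D (F 1) = 0 := (mul_eq_zero.1 h1v).resolve_left hρ.ne'
  have hF0 : F 0 = c₀ • ν - s₀ • τ := by
    rw [hν, hτ]
    have : F 0 = (c₀ ^ 2 + s₀ ^ 2) • F 0 := by rw [h, one_smul]
    nth_rewrite 1 [this]
    module
  have hF2 : F 2 = s₀ • ν + c₀ • τ := by
    rw [hν, hτ]
    have : F 2 = (c₀ ^ 2 + s₀ ^ 2) • F 2 := by rw [h, one_smul]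
    nth_rewrite 1 [this]
    module
  have hD0 : D (F 0) = c₀ * D ν := by
    rw [hF0, map_sub, map_smul, map_smul, hDτ, smul_zero, sub_zero, smul_eq_mul]
  have hD2 : D (F 2) = s₀ * D ν := by
    rw [hF2, map_add, map_smul, map_smul, hDτ, smul_zero, add_zero, smul_eq_mul]
  have hDe : ∀ e, D e = D ν * (c₀ * inner ℝ (F 0) e + s₀ * inner ℝ (F 2) e) := fun e => by
    conv_lhs => rw [← F.sum_repr' e]
    rw [Fin.sum_univ_three]
    simp only [map_add, map_smul, hD0, hD1, hD2, smul_eq_mul]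
    ring
  have h02 : (inner ℝ (F 0) (F 2) : ℝ) = 0 := F.inner_eq_zero (by decide)
  have hνn : ‖ν‖ = 1 := by
    have : ‖ν‖ ^ 2 = 1 := by
      rw [hν, norm_add_sq_real, norm_smul, norm_smul, real_inner_smul_left, real_inner_smul_right,
        h02, F.norm_eq_one, F.norm_eq_one]
      simpa using h
    exact (pow_eq_one_iff_of_nonneg (norm_nonneg _) two_ne_zero).1 this
  have hDin : D = D ν • innerSL ℝ ν := by
    ext e
    rw [hDe e, smul_apply, innerSL_apply_apply, hν, inner_add_left,
      real_inner_smul_left, real_inner_smul_left, smul_eq_mul]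
  have hl : D ν ≠ 0 := fun h0 => hg.fderiv_ne_zero (by rw [← hD, hDin, h0, zero_smul])
  refine ⟨D ν, hl, ?_, hDe, ?_⟩
  · conv_lhs => rw [hDin]
    rw [norm_smul, innerSL_apply_norm, hνn, mul_one, Real.norm_eq_abs]
  · have e1 : b τ τ = D ν / r := by
      field_simp
      have : r * (r * b τ τ - D ν) = 0 := by linear_combination hbuu
      linarith [(mul_eq_zero.1 this).resolve_left hr.ne']
    have e2 : b (F 1) (F 1) = c₀ / (R + r * c₀) * D ν := by
      rw [hD0] at hbvv
      rw [div_mul_eq_mul_div, eq_div_iff hρ.ne']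
      have : (R + r * c₀) * ((R + r * c₀) * b (F 1) (F 1) - c₀ * D ν) = 0 := by
        linear_combination hbvv
      linarith [(mul_eq_zero.1 this).resolve_left hρ.ne']
    have e3 : b (F 1) τ = 0 := by
      rw [hD1, mul_zero, neg_zero] at hbvu
      have := (mul_eq_zero.1 hbvu).resolve_left (by positivity)
      exact (mul_eq_zero.1 this).resolve_left (by positivity)
    have e4 : b τ (F 1) = 0 := by
      rw [hD1, mul_zero, neg_zero] at hbuv
      have := (mul_eq_zero.1 hbuv).resolve_left (by positivity)
      exact (mul_eq_zero.1 this).resolve_left (by positivity)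
    intro α β α' β'
    simp only [map_add, map_smul, add_apply, smul_apply,
      smul_eq_mul, e1, e2, e3, e4]
    ring

/-- The principal curvatures at a point of a torus of revolution enter the potential only through
these two expressions, which are independent of all choices: a
point of a torus of revolution is not umbilic, so the diagonalizing frame is the one of the
generating circle and the circle of latitude. -/
theorem HasPrincipalCurvatures.sub_sq_and_mul_of_torusOfRevolution
    (F : OrthonormalBasis (Fin 3) ℝ E3) (c : E3) {R r c₀ s₀ κ₁ κ₂ : ℝ} (hr : 0 < r) (hR : r < R)
    (h : c₀ ^ 2 + s₀ ^ 2 = 1)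
    (hκ : HasPrincipalCurvatures (torusOfRevolution c (F 2) R r)
      (c + (R + r * c₀) • F 0 + (r * s₀) • F 2) κ₁ κ₂) :
    (κ₁ - κ₂) ^ 2 = (R / (r * (R + r * c₀))) ^ 2 ∧ κ₁ * κ₂ = c₀ / (r * (R + r * c₀)) := by
  have hρ : 0 < R + r * c₀ := torusRadius_pos hr hR h
  obtain ⟨-, g, hg, e₁, e₂, n1, n2, n12, d1, d2, b11, b22, b12⟩ := hκ
  obtain ⟨l, hl, hnl, hD, hb⟩ := fderiv_defining_torusOfRevolution F c hr hR h hg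
  have hrep : ∀ e : E3, c₀ * inner ℝ (F 0) e + s₀ * inner ℝ (F 2) e = 0 → ∃ α β : ℝ,
      e = α • (-s₀ • F 0 + c₀ • F 2) + β • F 1 := fun e he => by
    refine ⟨-s₀ * inner ℝ (F 0) e + c₀ * inner ℝ (F 2) e, inner ℝ (F 1) e, ?_⟩
    conv_lhs => rw [← F.sum_repr' e, Fin.sum_univ_three]
    have a0 : (inner ℝ (F 0) e : ℝ) =
        -s₀ * (-s₀ * inner ℝ (F 0) e + c₀ * inner ℝ (F 2) e) := by
      linear_combination (-inner ℝ (F 0) e) * h + c₀ * he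
    have a2 : (inner ℝ (F 2) e : ℝ) =
        c₀ * (-s₀ * inner ℝ (F 0) e + c₀ * inner ℝ (F 2) e) := by
      linear_combination (-inner ℝ (F 2) e) * h + s₀ * he
    have e1 : (inner ℝ (F 0) e : ℝ) • F 0 + (inner ℝ (F 1) e : ℝ) • F 1 +
        (inner ℝ (F 2) e : ℝ) • F 2
        = (-s₀ * (-s₀ * inner ℝ (F 0) e + c₀ * inner ℝ (F 2) e)) • F 0 + (inner ℝ (F 1) e : ℝ) • F 1
          + (c₀ * (-s₀ * inner ℝ (F 0) e + c₀ * inner ℝ (F 2) e)) • F 2 := by rw [← a0, ← a2]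
    rw [e1]
    module
  obtain ⟨α, β, rfl⟩ := hrep e₁ (by
    rw [hD] at d1; exact (mul_eq_zero.1 d1).resolve_left hl)
  obtain ⟨α', β', rfl⟩ := hrep e₂ (by
    rw [hD] at d2; exact (mul_eq_zero.1 d2).resolve_left hl)
  have hin : ∀ α β α' β' : ℝ, inner ℝ (α • (-s₀ • F 0 + c₀ • F 2) + β • F 1)
      (α' • (-s₀ • F 0 + c₀ • F 2) + β' • F 1) = α * α' + β * β' := fun α β α' β' => by
    have i01 : (inner ℝ (F 0) (F 1) : ℝ) = 0 := F.inner_eq_zero (by decide)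
    have i02 : (inner ℝ (F 0) (F 2) : ℝ) = 0 := F.inner_eq_zero (by decide)
    have i12 : (inner ℝ (F 1) (F 2) : ℝ) = 0 := F.inner_eq_zero (by decide)
    have i10 : (inner ℝ (F 1) (F 0) : ℝ) = 0 := F.inner_eq_zero (by decide)
    have i20 : (inner ℝ (F 2) (F 0) : ℝ) = 0 := F.inner_eq_zero (by decide)
    have i21 : (inner ℝ (F 2) (F 1) : ℝ) = 0 := F.inner_eq_zero (by decide)
    simp only [inner_add_left, inner_add_right, real_inner_smul_left, real_inner_smul_right, i01,
      i02, i12, i10, i20, i21, real_inner_self_eq_norm_sq, F.norm_eq_one]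
    linear_combination α * α' * h
  have q1 : α * α + β * β = 1 := by
    rw [← hin, real_inner_self_eq_norm_sq, n1, one_pow]
  have q2 : α' * α' + β' * β' = 1 := by
    rw [← hin, real_inner_self_eq_norm_sq, n2, one_pow]
  rw [hin] at n12
  rw [hb, hnl] at b11 b22
  rw [hb] at b12
  have hB : 1 / r - c₀ / (R + r * c₀) = R / (r * (R + r * c₀)) := by
    field_simp
    ring
  have hAB : 1 / r * (c₀ / (R + r * c₀)) = c₀ / (r * (R + r * c₀)) := by
    field_simp
  have hB0 : R / (r * (R + r * c₀)) ≠ 0 := (div_pos (hr.trans hR) (mul_pos hr hρ)).ne'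
  have b12' := (mul_eq_zero.1 b12).resolve_left hl
  have h0 : (α * α') * (R / (r * (R + r * c₀))) = 0 := by
    rw [← hB]
    linear_combination b12' - c₀ / (R + r * c₀) * n12
  have h1 : α * α' = 0 := (mul_eq_zero.1 h0).resolve_right hB0
  have h2 : β * β' = 0 := by linarith
  have hll : |l| * |l| = l * l := abs_mul_abs_self l
  have hl2 : l * l ≠ 0 := mul_ne_zero hl hl
  rw [← hB, ← hAB]
  generalize c₀ / (R + r * c₀) = B at *
  have hdiv : ∀ p : ℝ, p / r = p * (1 / r) := fun p => by ring
  rw [hdiv] at b11 b22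
  generalize 1 / r = A at *
  -- In either case the two coordinate pairs are `(±1, 0)` and `(0, ±1)`.
  have key : ∀ a b a' b' k k' : ℝ, a * a + b * b = 1 → a' * a' + b' * b' = 1 → b * b' = 0 →
      a = 0 → l * (a * a * A + b * b * B) = k * |l| → l * (a' * a' * A + b' * b' * B) = k' * |l| →
      (k - k') ^ 2 = (A - B) ^ 2 ∧ k * k' = A * B := by
    intro a b a' b' k k' p1 p2 p3 p4 p5 p6
    subst p4
    have p1' : b * b = 1 := by linarith
    have hb0 : b ≠ 0 := by rintro rfl; norm_num at p1'
    have hb' : b' = 0 := (mul_eq_zero.1 p3).resolve_left hb0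
    subst hb'
    have p2' : a' * a' = 1 := by linarith
    have p5' : k * |l| = l * B := by rw [← p5, p1']; ring
    have p6' : k' * |l| = l * A := by rw [← p6, p2']; ring
    constructor <;> apply mul_right_cancel₀ hl2
    · rw [← hll]
      have : (k - k') ^ 2 * (|l| * |l|) = (k * |l| - k' * |l|) ^ 2 := by ring
      rw [this, p5', p6', hll]
      ring
    · rw [← hll]
      have : k * k' * (|l| * |l|) = (k * |l|) * (k' * |l|) := by ring
      rw [this, p5', p6', hll]
      ring
  rcases mul_eq_zero.1 h1 with ha | ha
  · exact key α β α' β' κ₁ κ₂ q1 q2 h2 ha b11 b22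
  · obtain ⟨k1, k2⟩ := key α' β' α β κ₂ κ₁ q2 q1 (by linarith) ha b22 b11
    exact ⟨by rw [← k1]; ring, by rw [← k2]; ring⟩

/-- The quartic polynomial whose zero set is `torusOfRevolution c n R r`: with `ρ` the distance from
the axis and `t` the height, it is the product of `(ρ - R) ^ 2 + t ^ 2 - r ^ 2` and
`(ρ + R) ^ 2 + t ^ 2 - r ^ 2`. -/
noncomputable def torusPolynomial (c n : E3) (R r : ℝ) (y : E3) : ℝ :=
  (‖y - c‖ ^ 2 + R ^ 2 - r ^ 2) ^ 2 - 4 * R ^ 2 * (‖y - c‖ ^ 2 - inner ℝ n (y - c) ^ 2)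

theorem contDiff_torusPolynomial (c n : E3) (R r : ℝ) : ContDiff ℝ 2 (torusPolynomial c n R r) := by
  have h1 : ContDiff ℝ 2 fun y : E3 => ‖y - c‖ ^ 2 := (contDiff_id.sub contDiff_const).norm_sq ℝ
  have h2 : ContDiff ℝ 2 fun y : E3 => (inner ℝ n (y - c) : ℝ) :=
    contDiff_const.inner ℝ (contDiff_id.sub contDiff_const)
  exact (((h1.add contDiff_const).sub contDiff_const).pow 2).sub
    (contDiff_const.mul (h1.sub (h2.pow 2)))

theorem norm_sq_orthonormalBasis_sum (F : OrthonormalBasis (Fin 3) ℝ E3) (c : E3) (α β γ : ℝ) :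
    ‖c + α • F 0 + β • F 1 + γ • F 2 - c‖ ^ 2 = α ^ 2 + β ^ 2 + γ ^ 2 := by
  have := dist_sq_orthonormalBasis_sum F c α β γ 0 0 0
  simpa [dist_eq_norm] using this

theorem inner_orthonormalBasis_sum (F : OrthonormalBasis (Fin 3) ℝ E3) (c : E3) (α β γ : ℝ) :
    inner ℝ (F 2) (c + α • F 0 + β • F 1 + γ • F 2 - c) = γ := by
  have i20 : (inner ℝ (F 2) (F 0) : ℝ) = 0 := F.inner_eq_zero (by decide)
  have i21 : (inner ℝ (F 2) (F 1) : ℝ) = 0 := F.inner_eq_zero (by decide)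
  have : c + α • F 0 + β • F 1 + γ • F 2 - c = α • F 0 + β • F 1 + γ • F 2 := by abel
  rw [this]
  simp only [inner_add_right, real_inner_smul_right, i20, i21, real_inner_self_eq_norm_sq,
    F.norm_eq_one]
  ring

theorem torusPolynomial_orthonormalBasis_sum (F : OrthonormalBasis (Fin 3) ℝ E3) (c : E3)
    (R r α β γ : ℝ) :
    torusPolynomial c (F 2) R r (c + α • F 0 + β • F 1 + γ • F 2)
      = (α ^ 2 + β ^ 2 + γ ^ 2 + R ^ 2 - r ^ 2) ^ 2 - 4 * R ^ 2 * (α ^ 2 + β ^ 2) := by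
  rw [torusPolynomial, norm_sq_orthonormalBasis_sum, inner_orthonormalBasis_sum]
  ring

theorem exists_eq_orthonormalBasis_sum (F : OrthonormalBasis (Fin 3) ℝ E3) (c y : E3) :
    ∃ α β γ : ℝ, y = c + α • F 0 + β • F 1 + γ • F 2 := by
  refine ⟨inner ℝ (F 0) (y - c), inner ℝ (F 1) (y - c), inner ℝ (F 2) (y - c), ?_⟩
  have := F.sum_repr' (y - c)
  rw [Fin.sum_univ_three] at this
  rw [add_assoc, add_assoc, ← add_assoc (_ • F 0), this]
  abel

theorem mem_torusOfRevolution_iff_torusPolynomial (F : OrthonormalBasis (Fin 3) ℝ E3) (c : E3)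
    {R r : ℝ} (hr : 0 < r) (hR : r < R) (y : E3) :
    y ∈ torusOfRevolution c (F 2) R r ↔ torusPolynomial c (F 2) R r y = 0 := by
  rw [mem_torusOfRevolution_iff]
  constructor
  · rintro ⟨u, v, rfl⟩
    rw [torusPolynomial_orthonormalBasis_sum]
    have hu := Real.cos_sq_add_sin_sq u
    have hv := Real.cos_sq_add_sin_sq v
    have e1 : ((R + r * Real.cos u) * Real.cos v) ^ 2 + ((R + r * Real.cos u) * Real.sin v) ^ 2
        = (R + r * Real.cos u) ^ 2 := by
      linear_combination (R + r * Real.cos u) ^ 2 * hv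
    have e2 : (R + r * Real.cos u) ^ 2 + (r * Real.sin u) ^ 2 + R ^ 2 - r ^ 2
        = 2 * R * (R + r * Real.cos u) := by
      linear_combination r ^ 2 * hu
    rw [e1, e2]
    ring
  · obtain ⟨α, β, γ, rfl⟩ := exists_eq_orthonormalBasis_sum F c y
    rw [torusPolynomial_orthonormalBasis_sum]
    intro h0
    set ρ := √(α ^ 2 + β ^ 2) with hρ
    have hρ2 : ρ ^ 2 = α ^ 2 + β ^ 2 := Real.sq_sqrt (by positivity)
    have hρ0 : 0 ≤ ρ := Real.sqrt_nonneg _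
    rw [← hρ2] at h0
    have hRr : 0 < R ^ 2 - r ^ 2 := by nlinarith
    have hpos : 0 < ρ ^ 2 + γ ^ 2 + R ^ 2 - r ^ 2 + 2 * R * ρ := by
      have : 0 ≤ R * ρ := mul_nonneg (hr.trans hR).le hρ0
      nlinarith [sq_nonneg ρ, sq_nonneg γ]
    have h1 : ρ ^ 2 + γ ^ 2 + R ^ 2 - r ^ 2 - 2 * R * ρ = 0 := by
      refine (mul_eq_zero.1 ?_).resolve_right hpos.ne'
      linear_combination h0
    have hρ1 : ρ ≠ 0 := by
      intro h2
      rw [h2] at h1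
      nlinarith [sq_nonneg γ]
    obtain ⟨u, hu, hu'⟩ : ∃ u, (ρ - R) / r = Real.cos u ∧ γ / r = Real.sin u := by
      refine exists_cos_sin_of_sq_add_sq_eq_one ?_
      field_simp
      linear_combination h1
    obtain ⟨v, hv, hv'⟩ : ∃ v, α / ρ = Real.cos v ∧ β / ρ = Real.sin v := by
      refine exists_cos_sin_of_sq_add_sq_eq_one ?_
      field_simp
      exact hρ2.symm
    refine ⟨u, v, ?_⟩
    rw [← hu, ← hu', ← hv, ← hv']
    have e1 : R + r * ((ρ - R) / r) = ρ := by field_simp; ring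
    rw [e1, mul_div_cancel₀ _ hρ1, mul_div_cancel₀ _ hρ1, mul_div_cancel₀ _ hr.ne']

theorem isLocalDefiningFunction_torusPolynomial (F : OrthonormalBasis (Fin 3) ℝ E3) (c : E3)
    {R r c₀ s₀ : ℝ} (hr : 0 < r) (hR : r < R) (h : c₀ ^ 2 + s₀ ^ 2 = 1) :
    IsLocalDefiningFunction (torusOfRevolution c (F 2) R r)
      (c + (R + r * c₀) • F 0 + (r * s₀) • F 2) (torusPolynomial c (F 2) R r) where
  contDiffAt := (contDiff_torusPolynomial c (F 2) R r).contDiffAt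
  mem_iff := Eventually.of_forall (mem_torusOfRevolution_iff_torusPolynomial F c hr hR)
  fderiv_ne_zero := by
    intro h0
    have hρ : 0 < R + r * c₀ := torusRadius_pos hr hR h
    -- The polynomial is not stationary along the normal line.
    have h1 : HasDerivAt (fun t : ℝ => c + (R + r * c₀) • F 0 + (r * s₀) • F 2 +
        t • (c₀ • F 0 + s₀ • F 2)) (c₀ • F 0 + s₀ • F 2) 0 := by
      simpa using ((hasDerivAt_id (0 : ℝ)).smul_const (c₀ • F 0 + s₀ • F 2)).const_add
        (c + (R + r * c₀) • F 0 + (r * s₀) • F 2)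
    have h2 : HasFDerivAt (torusPolynomial c (F 2) R r) (0 : E3 →L[ℝ] ℝ)
        (c + (R + r * c₀) • F 0 + (r * s₀) • F 2 + (0 : ℝ) • (c₀ • F 0 + s₀ • F 2)) := by
      rw [zero_smul, add_zero, ← h0]
      exact ((contDiff_torusPolynomial c (F 2) R r).differentiable (by simp) _).hasFDerivAt
    have h3 := h2.comp_hasDerivAt 0 h1
    have h4 : (torusPolynomial c (F 2) R r ∘ fun t : ℝ => c + (R + r * c₀) • F 0 +
        (r * s₀) • F 2 + t • (c₀ • F 0 + s₀ • F 2)) = fun t => (2 * r * t + t ^ 2) *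
          (2 * r * t + t ^ 2 + 4 * R * (R + r * c₀ + t * c₀)) := by
      funext t
      have : c + (R + r * c₀) • F 0 + (r * s₀) • F 2 + t • (c₀ • F 0 + s₀ • F 2)
          = c + (R + r * c₀ + t * c₀) • F 0 + (0 : ℝ) • F 1 + (r * s₀ + t * s₀) • F 2 := by
        module
      rw [Function.comp_apply, this, torusPolynomial_orthonormalBasis_sum]
      have e1 : (R + r * c₀ + t * c₀) ^ 2 + 0 ^ 2 + (r * s₀ + t * s₀) ^ 2 + R ^ 2 - r ^ 2
          = 2 * r * t + t ^ 2 + 2 * R * (R + r * c₀ + t * c₀) := by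
        linear_combination (r + t) ^ 2 * h
      rw [e1]
      ring
    rw [h4] at h3
    have h5 := ((((hasDerivAt_id (0 : ℝ)).const_mul (2 * r)).add
      ((hasDerivAt_id (0 : ℝ)).pow 2)).mul
      ((((hasDerivAt_id (0 : ℝ)).const_mul (2 * r)).add ((hasDerivAt_id (0 : ℝ)).pow 2)).add
        ((((hasDerivAt_id (0 : ℝ)).mul_const c₀).const_add (R + r * c₀)).const_mul (4 * R))))
    have h6 := h3.unique h5
    simp at h6
    rcases h6 with h6 | h6
    · exact hr.ne' h6
    · rcases h6 with h6 | h6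
      · exact (hr.trans hR).ne' h6
      · exact hρ.ne' h6

theorem exists_hasPrincipalCurvatures_torusOfRevolution
    (F : OrthonormalBasis (Fin 3) ℝ E3) (c : E3) {R r c₀ s₀ : ℝ} (hr : 0 < r) (hR : r < R)
    (h : c₀ ^ 2 + s₀ ^ 2 = 1) :
    ∃ κ₁ κ₂ : ℝ, HasPrincipalCurvatures (torusOfRevolution c (F 2) R r)
      (c + (R + r * c₀) • F 0 + (r * s₀) • F 2) κ₁ κ₂ := by
  have hg := isLocalDefiningFunction_torusPolynomial F c hr hR h
  obtain ⟨l, hl, hnl, hD, hb⟩ := fderiv_defining_torusOfRevolution F c hr hR h hg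
  have hx : c + (R + r * c₀) • F 0 + (r * s₀) • F 2 ∈ torusOfRevolution c (F 2) R r := by
    obtain ⟨u, hu, hu'⟩ := exists_cos_sin_of_sq_add_sq_eq_one h
    exact (mem_torusOfRevolution_iff F c R r _).2 ⟨u, 0, by simp [hu, hu']⟩
  have i01 : (inner ℝ (F 0) (F 1) : ℝ) = 0 := F.inner_eq_zero (by decide)
  have i02 : (inner ℝ (F 0) (F 2) : ℝ) = 0 := F.inner_eq_zero (by decide)
  have i20 : (inner ℝ (F 2) (F 0) : ℝ) = 0 := F.inner_eq_zero (by decide)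
  have i21 : (inner ℝ (F 2) (F 1) : ℝ) = 0 := F.inner_eq_zero (by decide)
  have hb11 := hb 1 0 1 0
  have hb22 := hb 0 1 0 1
  have hb12 := hb 1 0 0 1
  simp only [one_smul, zero_smul, add_zero, zero_add] at hb11 hb22 hb12
  refine ⟨_, _, hx, _, hg, -s₀ • F 0 + c₀ • F 2, F 1, ?_, F.norm_eq_one 1, ?_, ?_, ?_,
    ((div_mul_cancel₀ _ (norm_ne_zero_iff.2 hg.fderiv_ne_zero)).symm),
    ((div_mul_cancel₀ _ (norm_ne_zero_iff.2 hg.fderiv_ne_zero)).symm), ?_⟩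
  · have : ‖-s₀ • F 0 + c₀ • F 2‖ ^ 2 = 1 := by
      rw [norm_add_sq_real, norm_smul, norm_smul, real_inner_smul_left, real_inner_smul_right,
        i02, F.norm_eq_one, F.norm_eq_one]
      simpa [add_comm] using h
    exact (pow_eq_one_iff_of_nonneg (norm_nonneg _) two_ne_zero).1 this
  · rw [inner_add_left, real_inner_smul_left, real_inner_smul_left, i01, i21]
    ring
  · rw [hD]
    simp only [inner_add_right, real_inner_smul_right, i02, i20, real_inner_self_eq_norm_sq,
      F.norm_eq_one]
    ring
  · rw [hD, i01, i21]
    ring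
  · rw [hb12]
    ring

/-! ### Potential and energy of a torus of revolution -/

/-- The integral of the inverse squared distance from the axis, which is
`‖x - c‖ ^ 2 - inner ℝ n (x - c) ^ 2`. It is a product of two integrals in the chart around a point
of the outer equator. -/
theorem integral_torusOfRevolution_div_axisDist_sq {c n : E3} {R r : ℝ} (hn : ‖n‖ = 1) (hr : 0 < r)
    (hR : r < R) :
    IntegrableOn (fun x : E3 => 1 / (‖x - c‖ ^ 2 - inner ℝ n (x - c) ^ 2))
        (torusOfRevolution c n R r) μHE[2] ∧
      ∫ x in torusOfRevolution c n R r, 1 / (‖x - c‖ ^ 2 - inner ℝ n (x - c) ^ 2) ∂μHE[2]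
        = 4 * Real.pi ^ 2 * r / √(R ^ 2 - r ^ 2) := by
  obtain ⟨F, rfl⟩ := exists_orthonormalBasis_fin_three_of_norm hn
  have h : (1 : ℝ) ^ 2 + 0 ^ 2 = 1 := by norm_num
  obtain ⟨hemb, hmap⟩ := restrict_torusOfRevolution_eq F c hr hR h
  have hrad := torusChartRadius_pos hr hR h
  have hquad := torusChartRadius_mul_quadratic (R := R) (r := r) h
  rw [mul_one] at hquad
  have hRr : 0 < R + r := by linarith
  have hH : 0 < R ^ 2 - r ^ 2 := by nlinarith
  set d : ℝ × ℝ → ℝ := fun p => 2 * r / (1 + p.1 ^ 2) *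
    (2 * torusChartRadius R r 1 0 p.1 / (1 + p.2 ^ 2)) with hd
  have hd0 : ∀ p, 0 ≤ d p := fun p => by
    have := hrad p.1
    simp only [hd]
    positivity
  have hdm : Measurable d := by
    have := continuous_torusChartRadius (R := R) (r := r) (c₀ := 1) (s₀ := 0)
    have := this.measurable
    simp only [hd]
    fun_prop
  set H := √(R ^ 2 - r ^ 2) with hHdef
  have hH0 : 0 < H := Real.sqrt_pos.2 hH
  have hH2 : H ^ 2 = R ^ 2 - r ^ 2 := Real.sq_sqrt hH.le
  have hf : ∀ p, 1 / (‖torusChart F c R r 1 0 p - c‖ ^ 2 -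
      inner ℝ (F 2) (torusChart F c R r 1 0 p - c) ^ 2) =
        1 / torusChartRadius R r 1 0 p.1 ^ 2 := fun p => by
    rw [torusChart, norm_sq_orthonormalBasis_sum, inner_orthonormalBasis_sum]
    congr 1
    have := one_add_sq_pos p.2
    field_simp
    ring
  have hprod : ∀ p, d p * (1 / torusChartRadius R r 1 0 p.1 ^ 2)
      = (4 * r * (R + r) / H ^ 2 * (1 + ((R + r) / H * p.1) ^ 2)⁻¹) * (1 + p.2 ^ 2)⁻¹ := fun p => by
    have h1 := hrad p.1
    have h2 := one_add_sq_pos p.1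
    have h3 := one_add_sq_pos p.2
    have h4 : H ^ 2 * (1 + ((R + r) / H * p.1) ^ 2)
        = (R + r) * (torusChartRadius R r 1 0 p.1 * (1 + p.1 ^ 2)) := by
      rw [hquad, ← hH2]
      field_simp
      ring
    have h5 : (1 + ((R + r) / H * p.1) ^ 2)⁻¹
        = H ^ 2 / ((R + r) * (torusChartRadius R r 1 0 p.1 * (1 + p.1 ^ 2))) := by
      rw [← h4]
      field_simp
    rw [h5]
    simp only [hd]
    field_simp
    ring
  have hk : (R + r) / H ≠ 0 := (div_pos hRr hH0).ne'
  have i1 : Integrable fun y : ℝ => 4 * r * (R + r) / H ^ 2 * (1 + ((R + r) / H * y) ^ 2)⁻¹ :=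
    (integrable_inv_one_add_sq.comp_mul_left' hk).const_mul _
  have i2 : Integrable fun p : ℝ × ℝ => d p * (1 / torusChartRadius R r 1 0 p.1 ^ 2) := by
    simp_rw [hprod]
    exact i1.mul_prod integrable_inv_one_add_sq
  have hdm' : Measurable fun p => (d p).toNNReal := hdm.real_toNNReal
  have hden : (volume : Measure (ℝ × ℝ)).withDensity (fun p => ENNReal.ofReal (d p))
      = volume.withDensity fun p => ((d p).toNNReal : ENNReal) := rfl
  constructor
  · rw [IntegrableOn, hmap, hemb.integrable_map_iff, hden,
      integrable_withDensity_iff_integrable_smul hdm']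
    refine i2.congr (Eventually.of_forall fun p => ?_)
    simp only [Function.comp_apply, hf, NNReal.smul_def, Real.coe_toNNReal _ (hd0 p), smul_eq_mul]
  · rw [hmap, hemb.integral_map, hden, integral_withDensity_eq_integral_smul hdm']
    have e1 : ∀ p, (d p).toNNReal • (1 / (‖torusChart F c R r 1 0 p - c‖ ^ 2 -
      inner ℝ (F 2) (torusChart F c R r 1 0 p - c) ^ 2)) =
        (4 * r * (R + r) / H ^ 2 * (1 + ((R + r) / H * p.1) ^ 2)⁻¹) * (1 + p.2 ^ 2)⁻¹ := fun p => by
      rw [hf, NNReal.smul_def, Real.coe_toNNReal _ (hd0 p), smul_eq_mul, hprod]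
    simp_rw [e1]
    rw [Measure.volume_eq_prod, integral_prod_mul (fun y : ℝ => 4 * r * (R + r) / H ^ 2 *
      (1 + ((R + r) / H * y) ^ 2)⁻¹) (fun y : ℝ => (1 + y ^ 2)⁻¹), integral_const_mul,
      Measure.integral_comp_mul_left (fun y : ℝ => (1 + y ^ 2)⁻¹), integral_univ_inv_one_add_sq,
      abs_of_pos (by positivity), smul_eq_mul]
    field_simp

theorem measurableSet_torusOfRevolution {c n : E3} {R r : ℝ} (hn : ‖n‖ = 1) (hr : 0 < r)
    (hR : r < R) : MeasurableSet (torusOfRevolution c n R r) := by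
  obtain ⟨F, rfl⟩ := exists_orthonormalBasis_fin_three_of_norm hn
  have : torusOfRevolution c (F 2) R r = torusPolynomial c (F 2) R r ⁻¹' {0} :=
    Set.ext fun y => mem_torusOfRevolution_iff_torusPolynomial F c hr hR y
  rw [this]
  exact (isClosed_singleton.preimage
    (contDiff_torusPolynomial c (F 2) R r).continuous).measurableSet

/-- A point of a torus of revolution in a frame adapted to it. -/
theorem exists_orthonormalBasis_of_mem_torusOfRevolution {c n x : E3} {R r : ℝ} (hn : ‖n‖ = 1)
    (hx : x ∈ torusOfRevolution c n R r) :
    ∃ (F : OrthonormalBasis (Fin 3) ℝ E3) (c₀ s₀ : ℝ), F 2 = n ∧ c₀ ^ 2 + s₀ ^ 2 = 1 ∧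
      x = c + (R + r * c₀) • F 0 + (r * s₀) • F 2 ∧
      ‖x - c‖ ^ 2 - inner ℝ n (x - c) ^ 2 = (R + r * c₀) ^ 2 := by
  obtain ⟨w, hw, hnw, u, rfl⟩ := hx
  obtain ⟨F, rfl, rfl⟩ := exists_orthonormalBasis_fin_three hw hn hnw
  refine ⟨F, Real.cos u, Real.sin u, rfl, Real.cos_sq_add_sin_sq u, rfl, ?_⟩
  have h1 := norm_sq_orthonormalBasis_sum F c (R + r * Real.cos u) 0 (r * Real.sin u)
  have h2 := inner_orthonormalBasis_sum F c (R + r * Real.cos u) 0 (r * Real.sin u)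
  rw [zero_smul, add_zero] at h1 h2
  rw [h1, h2]
  ring

theorem euclideanHausdorffMeasure_torusOfRevolution_lt_top {c n : E3} {R r : ℝ} (hn : ‖n‖ = 1)
    (hr : 0 < r) (hR : r < R) : μHE[2] (torusOfRevolution c n R r) < ⊤ := by
  have h1 := (integral_torusOfRevolution_div_axisDist_sq (c := c) hn hr hR).1
  have h2 : IntegrableOn (fun _ : E3 => (1 : ℝ)) (torusOfRevolution c n R r) μHE[2] := by
    refine (h1.const_mul ((R + r) ^ 2)).mono' aestronglyMeasurable_const ?_
    refine (ae_restrict_iff' (measurableSet_torusOfRevolution hn hr hR)).2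
      (Eventually.of_forall fun x hx => ?_)
    obtain ⟨F, c₀, s₀, -, h, -, hρ⟩ := exists_orthonormalBasis_of_mem_torusOfRevolution hn hx
    have hpos := torusRadius_pos hr hR h
    rw [hρ, norm_one, mul_one_div, one_le_div (by positivity)]
    have : c₀ ≤ 1 := by nlinarith [sq_nonneg s₀]
    exact pow_le_pow_left₀ hpos.le (by nlinarith) 2
  simpa using (integrableOn_const_iff (C := (1 : ℝ)) (by simp)).1 h2

/-- The renormalized potential of the torus with radii `R` and `r` is this constant divided by the
squared distance to the axis. -/
noncomputable def torusPotentialConstant (R r : ℝ) : ℝ :=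
  Real.pi / 8 * ((3 * Real.log 2 - 1) * (R / r) ^ 2 + 2 - 2 * (r / R) ^ 2)

theorem integral_torusOfRevolution_diff_ball (F : OrthonormalBasis (Fin 3) ℝ E3) (c : E3)
    {R r c₀ s₀ ε : ℝ} (hr : 0 < r) (hR : r < R) (h : c₀ ^ 2 + s₀ ^ 2 = 1) (hε : 0 < ε) :
    ∫ y in torusOfRevolution c (F 2) R r \
        Metric.ball (c + (R + r * c₀) • F 0 + (r * s₀) • F 2) ε,
        1 / dist (c + (R + r * c₀) • F 0 + (r * s₀) • F 2) y ^ 4 ∂μHE[2]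
      = 1 / (4 * r ^ 2 * (R + r * c₀) ^ 2) *
        ∫ p in truncatedRegion (R + r * c₀) (r * s₀) (4 * r ^ 2 * (R + r * c₀) ^ 2 / ε ^ 2),
          chordDensity r (R ^ 2 - r ^ 2) p := by
  have hH : 0 < R ^ 2 - r ^ 2 := by nlinarith
  rw [integral_eq_lintegral_of_nonneg_ae (Eventually.of_forall fun y => by
      dsimp only [Pi.zero_apply]; positivity)
      (Measurable.aestronglyMeasurable (by fun_prop)),
    integral_eq_lintegral_of_nonneg_ae (Eventually.of_forall fun y => chordDensity_nonneg hH y)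
      (measurable_chordDensity _ _).aestronglyMeasurable,
    lintegral_torusOfRevolution_diff_ball F c hr hR h hε, ENNReal.toReal_mul,
    ENNReal.toReal_ofReal (by positivity)]

theorem integrableOn_torusOfRevolution_diff_ball {c n : E3} {R r ε : ℝ} (hn : ‖n‖ = 1) (hr : 0 < r)
    (hR : r < R) (x : E3) (hε : 0 < ε) :
    IntegrableOn (fun y : E3 => 1 / dist x y ^ 4) (torusOfRevolution c n R r \ Metric.ball x ε)
      μHE[2] := by
  have hm := (measurableSet_torusOfRevolution (c := c) hn hr hR).diff
    (Metric.isOpen_ball (x := x) (ε := ε)).measurableSet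
  have hfin : μHE[2] (torusOfRevolution c n R r \ Metric.ball x ε) < ⊤ :=
    (measure_mono Set.sdiff_subset).trans_lt
      (euclideanHausdorffMeasure_torusOfRevolution_lt_top hn hr hR)
  refine Measure.integrableOn_of_bounded (M := 1 / ε ^ 4) hfin.ne
    (Measurable.aestronglyMeasurable (by fun_prop))
    ((ae_restrict_iff' hm).2 (Eventually.of_forall fun y hy => ?_))
  have hd : ε ≤ dist x y := by
    have := hy.2
    rw [Metric.mem_ball, not_lt, dist_comm] at this
    exact this
  rw [Real.norm_of_nonneg (by positivity)]
  exact one_div_le_one_div_of_le (by positivity) (pow_le_pow_left₀ hε.le hd 4)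

/-- The constant terms `σ ^ 2 - ρ ^ 2` of the integral and the curvature terms combine, so that the
limit depends on the base point only through its distance from the axis. -/
theorem tendsto_potential_torusOfRevolution (F : OrthonormalBasis (Fin 3) ℝ E3) (c : E3)
    {R r c₀ s₀ : ℝ} (hr : 0 < r) (hR : r < R) (h : c₀ ^ 2 + s₀ ^ 2 = 1) :
    Tendsto (fun ε : ℝ =>
        (∫ y in torusOfRevolution c (F 2) R r \
            Metric.ball (c + (R + r * c₀) • F 0 + (r * s₀) • F 2) ε,
          1 / dist (c + (R + r * c₀) • F 0 + (r * s₀) • F 2) y ^ 4 ∂μHE[2]) - Real.pi / ε ^ 2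
          + Real.pi * (R / (r * (R + r * c₀))) ^ 2 / 16 *
              Real.log ((R / (r * (R + r * c₀))) ^ 2 * ε ^ 2)
          + Real.pi * (c₀ / (r * (R + r * c₀))) / 4)
      (𝓝[>] 0) (𝓝 (torusPotentialConstant R r / (R + r * c₀) ^ 2)) := by
  have hρ : 0 < R + r * c₀ := torusRadius_pos hr hR h
  have hH : 0 < R ^ 2 - r ^ 2 := by nlinarith
  have hR0 : 0 < R := hr.trans hR
  have hN : Tendsto (fun ε : ℝ => 4 * r ^ 2 * (R + r * c₀) ^ 2 / ε ^ 2) (𝓝[>] 0) atTop := by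
    have h1 : Tendsto (fun ε : ℝ => (ε ^ 2)⁻¹) (𝓝[>] 0) atTop := by
      have := (tendsto_pow_atTop (α := ℝ) two_ne_zero).comp (tendsto_inv_nhdsGT_zero (𝕜 := ℝ))
      refine this.congr fun ε => ?_
      simp [inv_pow]
    exact (h1.const_mul_atTop (show 0 < 4 * r ^ 2 * (R + r * c₀) ^ 2 by positivity))
  have ht := (((tendsto_integral_chordDensity hr hH (R + r * c₀) (r * s₀)).comp hN).const_mul
    (1 / (4 * r ^ 2 * (R + r * c₀) ^ 2))).add_const
      (Real.pi * (R / (r * (R + r * c₀))) ^ 2 / 16 * Real.log (4 * R ^ 2)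
        + Real.pi * (c₀ / (r * (R + r * c₀))) / 4)
  have hlog : Real.log (4 * R ^ 2) = 2 * Real.log 2 + Real.log (R ^ 2) := by
    rw [Real.log_mul (by norm_num) (by positivity), show (4 : ℝ) = 2 ^ 2 by norm_num, Real.log_pow]
    norm_num
  have hlim : 1 / (4 * r ^ 2 * (R + r * c₀) ^ 2) * (Real.pi / 2 * (-(R + r * c₀) ^ 2 +
      ((r * s₀) ^ 2 + (R ^ 2 - r ^ 2 + r ^ 2) / 2 + (R ^ 2 - r ^ 2 + r ^ 2) / 2 *
        (2 * Real.log 2 - Real.log (R ^ 2 - r ^ 2 + r ^ 2))) -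
          r ^ 4 * (2 / (R ^ 2 - r ^ 2 + r ^ 2)))
      + ((R ^ 2 - r ^ 2) / 2 * (Real.pi * Real.log 2 - Real.pi / 2) +
        r ^ 2 / 2 * (Real.pi * Real.log 2 + Real.pi / 2))) +
      (Real.pi * (R / (r * (R + r * c₀))) ^ 2 / 16 * Real.log (4 * R ^ 2)
        + Real.pi * (c₀ / (r * (R + r * c₀))) / 4)
      = torusPotentialConstant R r / (R + r * c₀) ^ 2 := by
    rw [sub_add_cancel, hlog, torusPotentialConstant]
    have hs : s₀ ^ 2 = 1 - c₀ ^ 2 := by linarith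
    rw [mul_pow r s₀, hs]
    generalize hρ' : R + r * c₀ = ρ at *
    have hc : c₀ = (ρ - R) / r := by rw [← hρ']; field_simp; ring
    rw [hc]
    field_simp
    ring
  rw [hlim] at ht
  refine ht.congr' ?_
  filter_upwards [self_mem_nhdsWithin] with ε hε
  have hε0 : 0 < ε := hε
  rw [integral_torusOfRevolution_diff_ball F c hr hR h hε0, sub_add_cancel]
  simp only [Function.comp_apply]
  have e1 : Real.log (4 * r ^ 2 * (R + r * c₀) ^ 2 / ε ^ 2) = Real.log (4 * R ^ 2) -
      Real.log ((R / (r * (R + r * c₀))) ^ 2 * ε ^ 2) := by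
    rw [← Real.log_div (by positivity) (by positivity)]
    congr 1
    field_simp
  rw [e1]
  generalize (∫ p in truncatedRegion (R + r * c₀) (r * s₀)
    (4 * r ^ 2 * (R + r * c₀) ^ 2 / ε ^ 2), chordDensity r (R ^ 2 - r ^ 2) p) = J
  generalize Real.log ((R / (r * (R + r * c₀))) ^ 2 * ε ^ 2) = l₁
  generalize Real.log (4 * R ^ 2) = l₂
  field_simp
  ring

theorem hasRenormalizedPotential_torusOfRevolution_iff {c n x : E3} {R r v : ℝ} (hn : ‖n‖ = 1)
    (hr : 0 < r) (hR : r < R) (hx : x ∈ torusOfRevolution c n R r) :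
    HasRenormalizedPotential (torusOfRevolution c n R r) x v ↔
      v = torusPotentialConstant R r * (1 / (‖x - c‖ ^ 2 - inner ℝ n (x - c) ^ 2)) := by
  obtain ⟨F, c₀, s₀, rfl, h, rfl, hρ⟩ := exists_orthonormalBasis_of_mem_torusOfRevolution hn hx
  have ht := tendsto_potential_torusOfRevolution F c hr hR h
  rw [hρ, mul_one_div]
  constructor
  · rintro ⟨κ₁, κ₂, hκ, -, hlim⟩
    obtain ⟨h1, h2⟩ := hκ.sub_sq_and_mul_of_torusOfRevolution F c hr hR h
    rw [h1, h2] at hlim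
    exact tendsto_nhds_unique hlim ht
  · rintro rfl
    obtain ⟨κ₁, κ₂, hκ⟩ := exists_hasPrincipalCurvatures_torusOfRevolution F c hr hR h
    obtain ⟨h1, h2⟩ := hκ.sub_sq_and_mul_of_torusOfRevolution F c hr hR h
    refine ⟨κ₁, κ₂, hκ, fun ε hε => integrableOn_torusOfRevolution_diff_ball hn hr hR _ hε, ?_⟩
    rw [h1, h2]
    exact ht

theorem hasAucklySadunEnergy_torusOfRevolution_iff {c n : E3} {R r E : ℝ} (hn : ‖n‖ = 1)
    (hr : 0 < r) (hR : r < R) :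
    HasAucklySadunEnergy (torusOfRevolution c n R r) E ↔
      E = torusPotentialConstant R r * (4 * Real.pi ^ 2 * r / √(R ^ 2 - r ^ 2)) := by
  obtain ⟨h1, h2⟩ := integral_torusOfRevolution_div_axisDist_sq (c := c) hn hr hR
  constructor
  · rintro ⟨V, hV, -, rfl⟩
    rw [← h2, ← integral_const_mul]
    exact setIntegral_congr_fun (measurableSet_torusOfRevolution hn hr hR) fun x hx =>
      (hasRenormalizedPotential_torusOfRevolution_iff hn hr hR hx).1 (hV x hx)
  · rintro rfl
    refine ⟨fun x => torusPotentialConstant R r * (1 / (‖x - c‖ ^ 2 - inner ℝ n (x - c) ^ 2)),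
      fun x hx => (hasRenormalizedPotential_torusOfRevolution_iff hn hr hR hx).2 rfl,
      h1.const_mul _, ?_⟩
    rw [integral_const_mul, h2]

/-- With `X = (R / r) ^ 2` and `t = X / √(X - 1)` the energy is an increasing function of
`t ≥ 2`, and `t` has its minimum `2` at `X = 2`. -/
theorem le_torusEnergy {R r : ℝ} (hr : 0 < r) (hR : r < R) :
    Real.pi ^ 3 * (6 * Real.log 2 - 1) / 2 ≤
        torusPotentialConstant R r * (4 * Real.pi ^ 2 * r / √(R ^ 2 - r ^ 2)) ∧
      (torusPotentialConstant R r * (4 * Real.pi ^ 2 * r / √(R ^ 2 - r ^ 2))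
        = Real.pi ^ 3 * (6 * Real.log 2 - 1) / 2 ↔ R = √2 * r) := by
  have hH : 0 < R ^ 2 - r ^ 2 := by nlinarith
  have hR0 : 0 < R := hr.trans hR
  set H := √(R ^ 2 - r ^ 2) with hHdef
  have hH0 : 0 < H := Real.sqrt_pos.2 hH
  have hH2 : H ^ 2 = R ^ 2 - r ^ 2 := Real.sq_sqrt hH.le
  have hlog : 1 / 2 < 3 * Real.log 2 - 1 := by linarith [Real.log_two_gt_d9]
  set t := R ^ 2 / (r * H) with ht
  have ht2 : t - 2 = (H - r) ^ 2 / (r * H) := by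
    rw [ht]
    field_simp
    linear_combination -hH2
  have ht0 : 0 < t := by positivity
  have ht2' : 0 ≤ t - 2 := by rw [ht2]; positivity
  have e1 : torusPotentialConstant R r * (4 * Real.pi ^ 2 * r / H) -
      Real.pi ^ 3 * (6 * Real.log 2 - 1) / 2 =
        Real.pi ^ 3 / 2 * ((t - 2) * (3 * Real.log 2 - 1 - 1 / t)) := by
    rw [torusPotentialConstant, ht]
    field_simp
    linear_combination (-16 * r ^ 2) * hH2
  have hk : 0 < 3 * Real.log 2 - 1 - 1 / t := by
    have : 1 / t ≤ 1 / 2 := one_div_le_one_div_of_le (by norm_num) (by linarith)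
    linarith
  have hpi : 0 < Real.pi ^ 3 / 2 := by positivity
  constructor
  · have := mul_nonneg hpi.le (mul_nonneg ht2' hk.le)
    linarith
  · rw [← sub_eq_zero, e1, mul_eq_zero_iff_left hpi.ne', mul_eq_zero_iff_right hk.ne', ht2,
      div_eq_zero_iff, or_iff_left (mul_pos hr hH0).ne', sq_eq_zero_iff, sub_eq_zero]
    have h2 : √2 ^ 2 = 2 := Real.sq_sqrt (by norm_num)
    constructor
    · intro h3
      rw [h3] at hH2
      refine (pow_left_inj₀ hR0.le (by positivity) two_ne_zero).1 ?_
      rw [mul_pow, h2]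
      linarith
    · intro h3
      refine (pow_left_inj₀ hH0.le hr.le two_ne_zero).1 ?_
      rw [hH2, h3, mul_pow, h2]
      ring

theorem Complex.norm_eq_one_div_sqrt_two_iff (z : ℂ) :
    ‖z‖ = 1 / √2 ↔ z.re ^ 2 + z.im ^ 2 = 1 / 2 := by
  have h : (1 / √2) ^ 2 = 1 / 2 := by rw [div_pow, Real.sq_sqrt (by norm_num), one_pow]
  rw [← pow_left_inj₀ (norm_nonneg z) (by positivity) two_ne_zero, h, Complex.sq_norm,
    Complex.normSq_apply, sq, sq]

theorem stereographicProjection_image_cliffordTorus :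
    stereographicProjection '' cliffordTorus
      = torusOfRevolution 0 (EuclideanSpace.single (2 : Fin 3) (1 : ℝ)) (√2) 1 := by
  have h2 : √2 ^ 2 = 2 := Real.sq_sqrt (by norm_num)
  have h20 : 0 < √2 := by positivity
  have h21 : 1 < √2 := by
    rw [← Real.sqrt_one]
    exact Real.sqrt_lt_sqrt (by norm_num) (by norm_num)
  ext x
  constructor
  · rintro ⟨⟨z₁, z₂⟩, ⟨hz₁, hz₂⟩, rfl⟩
    rw [Complex.norm_eq_one_div_sqrt_two_iff] at hz₁ hz₂
    dsimp only at hz₁ hz₂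
    have hq : 0 < 1 - z₂.im := by nlinarith [sq_nonneg z₂.re]
    obtain ⟨u, hu, hu'⟩ : ∃ u, 1 / (√2 * (1 - z₂.im)) - √2 = Real.cos u ∧
        z₂.re / (1 - z₂.im) = Real.sin u := by
      refine exists_cos_sin_of_sq_add_sq_eq_one ?_
      have e1 : 1 / (√2 * (1 - z₂.im)) - √2 = (2 * z₂.im - 1) / (√2 * (1 - z₂.im)) := by
        field_simp
        linear_combination (z₂.im - 1) * h2
      rw [e1, div_pow, mul_pow, h2]
      field_simp
      linear_combination 2 * hz₂
    refine ⟨!₂[√2 * z₁.re, √2 * z₁.im, 0], ?_, ?_, u, ?_⟩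
    · rw [EuclideanSpace.norm_eq, Real.sqrt_eq_one]
      simp [Fin.sum_univ_three, mul_pow]
      linarith
    · simp [EuclideanSpace.inner_single_left]
    · rw [← hu, ← hu']
      ext i
      fin_cases i <;> simp [stereographicProjection] <;> field_simp
  · rintro ⟨w, hw, hnw, u, rfl⟩
    have hw2 : w 2 = 0 := by simpa [EuclideanSpace.inner_single_left] using hnw
    have hw1 : w 0 ^ 2 + w 1 ^ 2 = 1 := by
      rw [EuclideanSpace.norm_eq, Real.sqrt_eq_one] at hw
      simpa [Fin.sum_univ_three, hw2] using hw
    have hρ : 0 < √2 + Real.cos u := by linarith [Real.neg_one_le_cos u]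
    have hcs := Real.cos_sq_add_sin_sq u
    refine ⟨(⟨w 0 / √2, w 1 / √2⟩, ⟨Real.sin u / (√2 * (√2 + Real.cos u)),
      1 - 1 / (√2 * (√2 + Real.cos u))⟩), ⟨?_, ?_⟩, ?_⟩
    · rw [Complex.norm_eq_one_div_sqrt_two_iff]
      dsimp only
      rw [div_pow, div_pow, h2]
      linarith
    · rw [Complex.norm_eq_one_div_sqrt_two_iff]
      dsimp only
      generalize √2 = a at *
      field_simp
      have hs : Real.sin u ^ 2 = 1 - Real.cos u ^ 2 := by linarith
      have h3 : a ^ 3 = 2 * a := by rw [pow_succ, h2]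
      have h4 : a ^ 4 = 4 := by rw [show 4 = 2 * 2 from rfl, pow_mul, h2]; norm_num
      rw [hs]
      ring_nf
      rw [h4, h3, h2]
      ring
    · ext i
      fin_cases i <;> simp [stereographicProjection, hw2] <;> field_simp

theorem mainTheorem2 :
    stereographicProjection '' cliffordTorus
        = torusOfRevolution 0 (EuclideanSpace.single (2 : Fin 3) (1 : ℝ)) (√2) 1 ∧
    HasAucklySadunEnergy (stereographicProjection '' cliffordTorus)
      (Real.pi ^ 3 * (6 * Real.log 2 - 1) / 2) ∧
    ∀ (c n : E3) (R r : ℝ), ‖n‖ = 1 → 0 < r → r < R →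
      ∃ E : ℝ, HasAucklySadunEnergy (torusOfRevolution c n R r) E ∧
        (∀ E' : ℝ, HasAucklySadunEnergy (torusOfRevolution c n R r) E' → E' = E) ∧
        Real.pi ^ 3 * (6 * Real.log 2 - 1) / 2 ≤ E ∧
        (E = Real.pi ^ 3 * (6 * Real.log 2 - 1) / 2 ↔ R = √2 * r) := by
  have h21 : 1 < √2 := by
    rw [← Real.sqrt_one]
    exact Real.sqrt_lt_sqrt (by norm_num) (by norm_num)
  refine ⟨stereographicProjection_image_cliffordTorus, ?_, fun c n R r hn hr hR => ?_⟩
  · rw [stereographicProjection_image_cliffordTorus,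
      hasAucklySadunEnergy_torusOfRevolution_iff (by simp) one_pos h21]
    exact ((le_torusEnergy one_pos h21).2.2 (mul_one _).symm).symm
  · exact ⟨_, (hasAucklySadunEnergy_torusOfRevolution_iff hn hr hR).2 rfl,
      fun E' hE' => (hasAucklySadunEnergy_torusOfRevolution_iff hn hr hR).1 hE',
      le_torusEnergy hr hR⟩
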